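/- **Implicit learning in degree-bounded polynomial calculus and PCR.** *Setting.* Let $\mathbb F$ be a field and $x_1,\dots,x_n$ ($n\ge 1$) Boolean variables. In polynomial calculus (PC) the indeterminates are $x_1,\dots,x_n$; in polynomial calculus with resolution (PCR) there is in addition an indeterminate $\bar x_i$ for each $i$, standing for $\neg x_i$. Lines are equations $[p=0]$ with $p$ a polynomial over $\mathbb F$ in the indeterminates, written as a sum of monomials. The axioms are $[0=0]$, $[\alpha^2-\alpha=0]$ for each indeterminate $\alpha$, and, in PCR, $[x_i+\bar x_i-1=0]$ for each $i$. The rules are linear combination (from $[p=0]$, $[q=0]$ infer $[ap+bq=0]$, $a,b\in\mathbb F$) and multiplication (from $[p=0]$ infer $[\alpha p=0]$). A derivation has degree $d$ if every polynomial in it has total degree at most $d$. A partial assignment is a $\rho\in\{0,1,*\}^n$; put $\rho(\bar x_i)=\neg\rho(x_i)$ if $\rho(x_i)\ne *$ and $\rho(\bar x_i)=*$ otherwise. For a polynomial $h=\sum_s c_s\prod_i\alpha_i^{s_i}$ and a set $S$ of indeterminates let $c_S=\sum_{\mathrm{supp}(s)=S}c_s$. The equation $[h=0]$ is *witnessed to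 be satisfied* in $\rho$ if, for every $S$ with $c_S\neq 0$, either $\rho$ sets all members of $S$ to $1$ or it sets some member of $S$ to $0$, and the sum of $c_S$ over all $S$ whose members are all set to $1$ is $0$. A mask is a map $\{0,1\}^n\to\{0,1,*\}^n$ that sends each $x$ to a partial assignment agreeing with $x$ wherever it is not $*$. A masking process $M$ is a random mask, and $M(D)$ is the distribution of the mask applied to an independent $x\sim D$. *Statement.* Fix PC or PCR and a degree bound $d$. There are a single deterministic algorithm, a sample size $m(\gamma,\delta)=O\!\left(\frac1{\gamma^2}\log\frac2\delta\right)$, and a constant in the $O(\cdot)$ bounds depending only on the choice of PC or PCR and on $d$, such that the following holds for every field $\mathbb F$, all $n\ge1$, all lists of polynomials $p_1,\dots,p_\ell$ and all $q$ of degree at most $d$ (given as lists of terms with distinct monomials), and all $\epsilon,\gamma,\delta\in(0,1)$. Given $q$, $p_1,\dots,p_\ell$, $\epsilon$, $\gamma$ (the last two through their binary digits) and $m(\gamma,\delta)$ partial assignments, the algorithm always halts within time $$O\!\left(\frac{\ell+n^d}{\gamma^2}\,n^{2d}\log\frac2\delta\right)$$ on a random access machine with unit-cost field operations. Moreover, for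 every distribution $D$ on $\{0,1\}^n$ and every masking process $M$, when the partial assignments are drawn independently from $M(D)$: 1. If there are polynomials $h_1,\dots,h_k$ such that, with probability at least $1-\epsilon+\gamma$ over $\rho\sim M(D)$, all of $[h_1=0],\dots,[h_k=0]$ are witnessed to be satisfied in $\rho$, and there is a degree-$d$ PC (respectively PCR) derivation of $[q=0]$ from $[p_1=0],\dots,[p_\ell=0],[h_1=0],\dots,[h_k=0]$, then the algorithm accepts with probability at least $1-\delta$. 2. If $[(p_1=0)\wedge\cdots\wedge(p_\ell=0)\Rightarrow(q=0)]$ is at most $(1-\epsilon-\gamma)$-valid with respect to $D$, that is, $\Pr_{x\sim D}\big[\text{all } p_j(x)=0 \text{ implies } q(x)=0\big]\le 1-\epsilon-\gamma$, then the algorithm rejects with probability at least $1-\delta$. -/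

import Mathlib

namespace PolyCalc

/-! ## Assignments, partial assignments and masking -/

/-- Total Boolean assignments to the variables `x_0, …, x_{n-1}`. -/
abbrev Assign (n : ℕ) : Type := Fin n → Bool

/-- Partial assignments in `{0, 1, *}^n`; the value `none` is `*`. -/
abbrev PAssign (n : ℕ) : Type := Fin n → Option Bool

instance : MeasurableSpace (Option Bool) := ⊤

/-- `ρ` is consistent with `x`: wherever `ρ` is not `*`, it agrees with `x`. -/
def Consistent {n : ℕ} (ρ : PAssign n) (x : Assign n) : Prop :=
  ∀ i b, ρ i = some b → b = x i

/-- A mask sends each assignment to a partial assignment that is consistent with it. -/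
def Mask (n : ℕ) : Type := {f : Assign n → PAssign n // ∀ x, Consistent (f x) x}

/-- The distribution `M(D)` on partial assignments: draw `x` from `D` and, independently, a mask
from the masking process `M` (a random mask), and apply the mask to `x`. -/
noncomputable def masked {n : ℕ} (M : PMF (Mask n)) (D : PMF (Assign n)) : PMF (PAssign n) :=
  D.bind fun x => M.map fun f => f.1 x

/-! ## Polynomial calculus (PC) and polynomial calculus with resolution (PCR) -/

/-- The two proof systems. -/
inductive PCSystem where
  | pc
  | pcr

/-- The indeterminates over `n` variables.  The pair `(i, true)` is the variable `x_i`, and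
`(i, false)` is its formal negation `x̄_i`, which exists only in PCR. -/
abbrev Indet (sys : PCSystem) (n : ℕ) : Type := {l : Fin n × Bool // sys = .pc → l.2 = true}

/-- The Boolean value of an indeterminate under a total assignment. -/
def Indet.val {sys : PCSystem} {n : ℕ} (x : Assign n) (l : Indet sys n) : Bool :=
  x l.1.1 == l.1.2

/-- The value (`none` if masked) of an indeterminate under a partial assignment. -/
def Indet.pval {sys : PCSystem} {n : ℕ} (ρ : PAssign n) (l : Indet sys n) : Option Bool :=
  (ρ l.1.1).map (· == l.1.2)

open MvPolynomial in
/-- `Derives d H p`: the equation `[p = 0]` has a degree-`d` derivation from the equations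
`[h = 0]`, `h ∈ H`.  Every line of the derivation has total degree at most `d`. -/
inductive Derives {F : Type*} [Field F] {sys : PCSystem} {n : ℕ} (d : ℕ)
    (H : Set (MvPolynomial (Indet sys n) F)) : MvPolynomial (Indet sys n) F → Prop
  /-- assertion of a hypothesis -/
  | hyp (p : MvPolynomial (Indet sys n) F) :
      p ∈ H → p.totalDegree ≤ d → Derives d H p
  /-- the axiom `[0 = 0]` -/
  | zero : Derives d H 0
  /-- the Boolean axiom `[α² - α = 0]` of an indeterminate `α` -/
  | boolean (α : Indet sys n) :
      (X α ^ 2 - X α : MvPolynomial (Indet sys n) F).totalDegree ≤ d →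
      Derives d H (X α ^ 2 - X α)
  /-- the complementarity axiom `[x + x̄ - 1 = 0]` of a variable (only PCR has such a pair) -/
  | compl (α β : Indet sys n) :
      α.1.1 = β.1.1 → α.1.2 = true → β.1.2 = false →
      (X α + X β - 1 : MvPolynomial (Indet sys n) F).totalDegree ≤ d →
      Derives d H (X α + X β - 1)
  /-- linear combination -/
  | lin (a b : F) (p q : MvPolynomial (Indet sys n) F) :
      Derives d H p → Derives d H q → (C a * p + C b * q).totalDegree ≤ d →
      Derives d H (C a * p + C b * q)
  /-- multiplication by an indeterminate -/
  | mul (α : Indet sys n) (p : MvPolynomial (Indet sys n) F) :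
      Derives d H p → (X α * p).totalDegree ≤ d → Derives d H (X α * p)

/-- The equation `[p = 0]` holds under the total assignment `x`. -/
def HoldsAt {F : Type*} [Field F] {sys : PCSystem} {n : ℕ} (x : Assign n)
    (p : MvPolynomial (Indet sys n) F) : Prop :=
  MvPolynomial.eval (fun l => if l.val x then (1 : F) else 0) p = 0

/-- The conjunction over `S` (the Boolean meaning of a monomial with set of indeterminates `S`) is
witnessed to be true: all its members are set to true. -/
def ConjTrue {sys : PCSystem} {n : ℕ} (ρ : PAssign n) (S : Finset (Indet sys n)) : Prop :=
  ∀ l ∈ S, l.pval ρ = some true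

/-- The conjunction over `S` is witnessed to be false: some member is set to false. -/
def ConjFalse {sys : PCSystem} {n : ℕ} (ρ : PAssign n) (S : Finset (Indet sys n)) : Prop :=
  ∃ l ∈ S, l.pval ρ = some false

/-- The coefficient `c_S = ∑_{supp(s) = S} c_s` of the conjunction over `S` in `p`. -/
noncomputable def conjCoeff {F : Type*} [Field F] {sys : PCSystem} {n : ℕ}
    (p : MvPolynomial (Indet sys n) F) (S : Finset (Indet sys n)) : F :=
  ∑ s ∈ p.support with s.support = S, p.coeff s

open Classical in
/-- `[p = 0]` is witnessed true in `ρ`: all conjunctions with nonzero coefficient are witnessed,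
and with their witnessed values the sum evaluates to zero. -/
def WitnessedZero {F : Type*} [Field F] {sys : PCSystem} {n : ℕ} (ρ : PAssign n)
    (p : MvPolynomial (Indet sys n) F) : Prop :=
  (∀ S, conjCoeff p S ≠ 0 → ConjTrue ρ S ∨ ConjFalse ρ S) ∧
    ∑ S : Finset (Indet sys n) with ConjTrue ρ S, conjCoeff p S = 0

/-! ## Polynomials as lists of terms -/

/-- A polynomial written as a sum of terms, each a coefficient with a list of indeterminates. -/
abbrev TermList (F : Type*) (sys : PCSystem) (n : ℕ) : Type _ := List (F × List (Indet sys n))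

/-- The polynomial that a list of terms stands for. -/
noncomputable def TermList.poly {F : Type*} [Field F] {sys : PCSystem} {n : ℕ}
    (L : TermList F sys n) : MvPolynomial (Indet sys n) F :=
  (L.map fun t => MvPolynomial.C t.1 * (t.2.map MvPolynomial.X).prod).sum

/-- Sum-of-monomials representation of a polynomial of degree at most `d`: every term has degree
at most `d`, and no monomial is listed twice. -/
def TermList.IsRep {F : Type*} {sys : PCSystem} {n : ℕ} (d : ℕ) (L : TermList F sys n) : Prop :=
  (∀ t ∈ L, t.2.length ≤ d) ∧ (L.map fun t => (t.2 : Multiset (Indet sys n))).Nodup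

/-! ## Random access machines with unit-cost field operations

A program is a structured random access program with scalar variables and arrays, both of natural
numbers and of field elements.  Every name is a number that is written in the program, and the
number of indices in an array access is fixed by the program text.  Natural numbers can be added,
subtracted (with truncation) and compared; field elements can be added, subtracted, multiplied,
divided and compared with zero.  Programs do not mention the field. -/

/-- Memory: scalar variables and arrays of natural numbers, and of field elements. -/
structure Memory (F : Type*) where
  nvar : ℕ → ℕ
  narr : ℕ → List ℕ → ℕ
  fvar : ℕ → F
  farr : ℕ → List ℕ → F

/-- Elementary instructions.  In array accesses, the list gives the names of the natural number
variables that hold the indices. -/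
inductive Instr where
  | const (x k : ℕ)
  | add (x y z : ℕ)
  | sub (x y z : ℕ)
  | load (x a : ℕ) (idx : List ℕ)
  | store (a : ℕ) (idx : List ℕ) (x : ℕ)
  | fzero (u : ℕ)
  | fone (u : ℕ)
  | fadd (u v w : ℕ)
  | fsub (u v w : ℕ)
  | fmul (u v w : ℕ)
  | fdiv (u v w : ℕ)
  | fload (u a : ℕ) (idx : List ℕ)
  | fstore (a : ℕ) (idx : List ℕ) (u : ℕ)

/-- The effect of an elementary instruction (division by zero gives zero). -/
def Instr.apply {F : Type*} [Field F] (s : Memory F) : Instr → Memory F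
  | .const x k => { s with nvar := Function.update s.nvar x k }
  | .add x y z => { s with nvar := Function.update s.nvar x (s.nvar y + s.nvar z) }
  | .sub x y z => { s with nvar := Function.update s.nvar x (s.nvar y - s.nvar z) }
  | .load x a idx => { s with nvar := Function.update s.nvar x (s.narr a (idx.map s.nvar)) }
  | .store a idx x =>
      { s with
        narr := Function.update s.narr a
          (Function.update (s.narr a) (idx.map s.nvar) (s.nvar x)) }
  | .fzero u => { s with fvar := Function.update s.fvar u 0 }
  | .fone u => { s with fvar := Function.update s.fvar u 1 }
  | .fadd u v w => { s with fvar := Function.update s.fvar u (s.fvar v + s.fvar w) }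
  | .fsub u v w => { s with fvar := Function.update s.fvar u (s.fvar v - s.fvar w) }
  | .fmul u v w => { s with fvar := Function.update s.fvar u (s.fvar v * s.fvar w) }
  | .fdiv u v w => { s with fvar := Function.update s.fvar u (s.fvar v / s.fvar w) }
  | .fload u a idx => { s with fvar := Function.update s.fvar u (s.farr a (idx.map s.nvar)) }
  | .fstore a idx u =>
      { s with
        farr := Function.update s.farr a
          (Function.update (s.farr a) (idx.map s.nvar) (s.fvar u)) }

/-- Tests: comparison of two natural numbers, and the zero test in the field. -/
inductive Test where
  | lt (x y : ℕ)
  | isZero (u : ℕ)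

/-- The truth value of a test. -/
def Test.Holds {F : Type*} [Field F] (s : Memory F) : Test → Prop
  | .lt x y => s.nvar x < s.nvar y
  | .isZero u => s.fvar u = 0

/-- Programs. -/
inductive Prog where
  | instr (i : Instr)
  | seq (c₁ c₂ : Prog)
  | ite (b : Test) (c₁ c₂ : Prog)
  | loop (b : Test) (c : Prog)

/-- `Exec c s t s'`: started in memory `s`, the program `c` halts after exactly `t` steps, with
memory `s'`.  Each elementary instruction and each evaluation of a test is one step. -/
inductive Exec {F : Type*} [Field F] : Prog → Memory F → ℕ → Memory F → Prop
  | instr (i : Instr) (s : Memory F) : Exec (.instr i) s 1 (i.apply s)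
  | seq {c₁ c₂ : Prog} {s s' s'' : Memory F} {t₁ t₂ : ℕ} :
      Exec c₁ s t₁ s' → Exec c₂ s' t₂ s'' → Exec (.seq c₁ c₂) s (t₁ + t₂) s''
  | ite_true {b : Test} {c₁ c₂ : Prog} {s s' : Memory F} {t : ℕ} :
      b.Holds s → Exec c₁ s t s' → Exec (.ite b c₁ c₂) s (t + 1) s'
  | ite_false {b : Test} {c₁ c₂ : Prog} {s s' : Memory F} {t : ℕ} :
      ¬ b.Holds s → Exec c₂ s t s' → Exec (.ite b c₁ c₂) s (t + 1) s'
  | loop_done {b : Test} {c : Prog} {s : Memory F} :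
      ¬ b.Holds s → Exec (.loop b c) s 1 s
  | loop_step {b : Test} {c : Prog} {s s' s'' : Memory F} {t₁ t₂ : ℕ} :
      b.Holds s → Exec c s t₁ s' → Exec (.loop b c) s' t₂ s'' →
      Exec (.loop b c) s (t₁ + t₂ + 1) s''

/-- Programs are deterministic: the step count and the final memory are determined. -/
theorem Exec.unique {F : Type*} [Field F] {c : Prog} {s s₁ s₂ : Memory F} {t₁ t₂ : ℕ}
    (h₁ : Exec c s t₁ s₁) (h₂ : Exec c s t₂ s₂) : t₁ = t₂ ∧ s₁ = s₂ := by
  induction h₁ generalizing t₂ s₂ with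
  | instr i s => cases h₂; exact ⟨rfl, rfl⟩
  | seq _ _ ih ih' =>
    cases h₂ with
    | seq a b =>
      obtain ⟨rfl, rfl⟩ := ih a
      obtain ⟨rfl, rfl⟩ := ih' b
      exact ⟨rfl, rfl⟩
  | ite_true hb _ ih =>
    cases h₂ with
    | ite_true _ a => obtain ⟨rfl, rfl⟩ := ih a; exact ⟨rfl, rfl⟩
    | ite_false hn _ => exact absurd hb hn
  | ite_false hb _ ih =>
    cases h₂ with
    | ite_true hn _ => exact absurd hn hb
    | ite_false _ a => obtain ⟨rfl, rfl⟩ := ih a; exact ⟨rfl, rfl⟩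
  | loop_done hb =>
    cases h₂ with
    | loop_done _ => exact ⟨rfl, rfl⟩
    | loop_step hn _ _ => exact absurd hn hb
  | loop_step hb _ _ ih ih' =>
    cases h₂ with
    | loop_done hn => exact absurd hb hn
    | loop_step _ a b =>
      obtain ⟨rfl, rfl⟩ := ih a
      obtain ⟨rfl, rfl⟩ := ih' b
      exact ⟨rfl, rfl⟩

/-- The program halts within time `T` (a real bound on the number of steps). -/
def HaltsWithin {F : Type*} [Field F] (c : Prog) (s : Memory F) (T : ℝ) : Prop :=
  ∃ t s', Exec c s t s' ∧ (t : ℝ) ≤ T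

/-- The program halts and accepts: variable `0` is `1` at the end. -/
def Accepts {F : Type*} [Field F] (c : Prog) (s : Memory F) : Prop :=
  ∃ t s', Exec c s t s' ∧ s'.nvar 0 = 1

/-- The program halts and rejects: variable `0` is `0` at the end. -/
def Rejects {F : Type*} [Field F] (c : Prog) (s : Memory F) : Prop :=
  ∃ t s', Exec c s t s' ∧ s'.nvar 0 = 0

/-! ## Layout of the input -/

/-- The number of an indeterminate: `x_i` has number `i`, and `x̄_i` has number `n + i`. -/
def Indet.code {sys : PCSystem} {n : ℕ} (l : Indet sys n) : ℕ :=
  if l.1.2 then l.1.1 else n + l.1.1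

/-- `0`, `1` for the Boolean values and `2` for `*`. -/
def starCode : Option Bool → ℕ
  | some false => 0
  | some true => 1
  | none => 2

/-- The binary digit number `k + 1` after the point of a real number in `[0, 1)`. -/
noncomputable def bit (r : ℝ) (k : ℕ) : ℕ := ⌊r * 2 ^ (k + 1)⌋₊ % 2

/-- The initial memory.  Variables `0, 1, 2` hold the number of variables `n`, the number `ℓ` of
hypotheses and the number `m` of examples.  Polynomial number `j < ℓ` is the hypothesis `p_j`, and
polynomial number `ℓ` is the query `q`.  Array `0` at `[j]`: number of terms of polynomial `j`;
array `1` at `[j, t]`: degree of its term `t`; array `2` at `[j, t, k]`: number of indeterminate `k`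
in that term; field array `0` at `[j, t]`: coefficient of that term.  Array `3` at `[i, v]`: value
of variable `v` in example `i`.  Arrays `4` and `5`: binary digits of `ε` and of `γ`.  All other
cells are zero. -/
noncomputable def inputMemory {F : Type*} [Field F] {sys : PCSystem} {n m : ℕ}
    (p : List (TermList F sys n)) (q : TermList F sys n) (ε γ : ℝ) (ρ : Fin m → PAssign n) :
    Memory F where
  nvar := fun x => match x with
    | 0 => n
    | 1 => p.length
    | 2 => m
    | _ => 0
  narr := fun a idx => match a, idx with
    | 0, [j] => ((p ++ [q]).getD j []).length
    | 1, [j, t] => (((p ++ [q]).getD j []).getD t (0, [])).2.length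
    | 2, [j, t, k] => (((((p ++ [q]).getD j []).getD t (0, [])).2.map Indet.code).getD k 0)
    | 3, [i, v] => if h : i < m ∧ v < n then starCode (ρ ⟨i, h.1⟩ ⟨v, h.2⟩) else 0
    | 4, [k] => bit ε k
    | 5, [k] => bit γ k
    | _, _ => 0
  fvar := fun _ => 0
  farr := fun a idx => match a, idx with
    | 0, [j, t] => (((p ++ [q]).getD j []).getD t (0, [])).1
    | _, _ => 0

end PolyCalc

open PolyCalc MeasureTheory

namespace PolyCalc

/-! ## The space of words

A word is a list of at most `d` letters.  The letters are numbered `1, …, 2n`, the letter `0` is a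
blank, and a word is represented by the number with these digits in base `2n + 1`, the last letter
being the most significant digit. -/

/-! For one partial assignment `ρ`, provability becomes linear algebra of dimension `N = base n ^
d`. Polynomials of degree at most `d` are represented as vectors over words of at most `d` letters.
`closureSpace` is the least subspace that contains the relations between words (order and repetition
of letters do not matter, complementary letters add up to 1, letters known from `ρ` have their
value), contains the hypotheses `p_j`, and is closed under multiplication by letters of vectors
supported on words shorter than `d`. An example counts as a failure if `q` is not in this space.

Completeness (`vec_mem_closureSpace_of_derives`): if `[h = 0]` is witnessed in `ρ`, then modulo the
relations each conjunction of `h` becomes 1 or 0 and `h` vanishes. So a degree-`d` derivation from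
the `p_j` and witnessed `h_i` stays in the closure, although the `h_i` are never found explicitly.
Soundness (`holdsAt_of_vec_mem_closureSpace`): if `x` is consistent with `ρ` and satisfies all
`p_j`, evaluation at `x` is a linear functional whose kernel is a closed space, so `q` in the
closure gives `q(x) = 0`. The letters for negations are used for PC as well. They only enlarge the
closure, and evaluation still respects them, so one program serves both systems.

Under `M(D)` the probability of failure is therefore at most `ε - γ` in the first case and at least
`ε + γ` in the second. By Hoeffding's inequality, `O(log(2/δ)/γ²)` examples separate the two when
the fraction of failures is compared with `ε`. The machine knows `ε` only through its digits and
compares with `⌊ε * P⌋ / P` for a power of two `P ≥ m`. This rounding is worth at most one example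
and is paid for by half of the margin `γ`.

The closure is computed as an echelon basis whose rows are indexed by their last nonzero position
(`run_insertVec`, at `O(N²)` per vector). Words shorter than `d` are exactly the small codes, so the
vectors that may be multiplied are combinations of the rows with small pivot. It suffices to
multiply each such row by each letter once (`run_closureLoop`). The relations are chosen so sparsely
that only `O(N)` of them are inserted. One example thus costs `O((ℓ + N) N²)`, and `N ≤ 3^d n^d`. -/

/-- The base of the representation of words. -/
abbrev base (n : ℕ) : ℕ := 2 * n + 1

/-- The number of words whose last letter is blank. -/
def lowCount (n : ℕ) : ℕ → ℕ
  | 0 => 0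
  | d + 1 => base n ^ d

/-- The number of words whose last two letters are blank. -/
def lowCount₂ (n : ℕ) : ℕ → ℕ
  | 0 => 0
  | d + 1 => lowCount n d

section Words

variable {F : Type*} [Field F]

/-- The vector with entries `1`, `u`, `w` at `a`, `b`, `c`, added up where these coincide. -/
def tri (a b c : ℕ) (u w : F) : ℕ → F :=
  Pi.single a 1 + Pi.single b u + Pi.single c w

/-- The vector of a word of length less than `d` is moved to that of the word followed by the
letter `k`. -/
def shift (d n k : ℕ) : (ℕ → F) →ₗ[F] (ℕ → F) where
  toFun f c :=
    if k * lowCount n d ≤ c ∧ c < k * lowCount n d + lowCount n d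
    then f (c - k * lowCount n d) else 0
  map_add' f g := by funext c; dsimp; split_ifs <;> simp
  map_smul' a f := by funext c; dsimp; split_ifs <;> simp

theorem shift_single (d n k c : ℕ) (a : F) (hc : c < lowCount n d) :
    shift d n k (Pi.single c a) = Pi.single (c + k * lowCount n d) a := by
  funext e
  simp only [shift, LinearMap.coe_mk, AddHom.coe_mk, Pi.single_apply]
  split_ifs <;> first | rfl | omega

/-- The linear relations between words: letters may be permuted, a letter may be repeated, the two
letters of a variable add up to the empty word, and the letter of a variable whose value is known
may be replaced with this value. -/
inductive IsRelation (d : ℕ) {n : ℕ} (ρ : PAssign n) : (ℕ → F) → Prop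
  | rot (w i : ℕ) : w < lowCount n d → i < base n →
      IsRelation d ρ (tri (w + i * lowCount n d) (i + w * base n) (i + w * base n) (-1) 0)
  | swap (u i j : ℕ) : u < lowCount₂ n d → i < base n → j < base n →
      IsRelation d ρ (tri (u + i * lowCount₂ n d + j * lowCount n d)
        (u + j * lowCount₂ n d + i * lowCount n d) (u + j * lowCount₂ n d + i * lowCount n d)
        (-1) 0)
  | idem (u i : ℕ) : u < lowCount₂ n d → i < base n →
      IsRelation d ρ (tri (u + i * lowCount₂ n d + i * lowCount n d)
        (u + i * lowCount₂ n d) (u + i * lowCount₂ n d) (-1) 0)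
  | compl (w : ℕ) (i : Fin n) : w < lowCount n d →
      IsRelation d ρ (tri (w + (i + 1) * lowCount n d) (w + (n + i + 1) * lowCount n d) w 1 (-1))
  | value (w : ℕ) (i : Fin n) (b : Bool) : w < lowCount n d → ρ i = some b →
      IsRelation d ρ (tri (w + (i + 1) * lowCount n d) w w (if b then -1 else 0) 0)

variable {sys : PCSystem} {n : ℕ}

/-- The representation of a word. -/
def wordCode (w : List (Indet sys n)) : ℕ :=
  Nat.ofDigits (base n) (w.map fun l => l.code + 1)

/-- The vector of a polynomial. -/
def TermList.vec (L : TermList F sys n) : ℕ → F :=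
  (L.map fun t => Pi.single (wordCode t.2) t.1).sum

/-- The subspaces that contain the relations and the hypotheses and are closed under
multiplication within degree `d`. -/
structure IsClosedSpace (d : ℕ) (ρ : PAssign n) (p : List (TermList F sys n))
    (W : Submodule F (ℕ → F)) : Prop where
  rel : ∀ f, IsRelation d ρ f → f ∈ W
  hyp : ∀ L ∈ p, L.vec ∈ W
  mul : ∀ f ∈ W, (∀ c, lowCount n d ≤ c → f c = 0) → ∀ l < 2 * n, shift d n (l + 1) f ∈ W

/-- The least closed subspace. -/
def closureSpace (d : ℕ) (ρ : PAssign n) (p : List (TermList F sys n)) :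
    Submodule F (ℕ → F) :=
  sInf {W | IsClosedSpace d ρ p W}

/-- All three conditions pass to intersections. In `mul` the support condition on the vector does
not refer to the subspace. -/
theorem isClosedSpace_closureSpace (d : ℕ) (ρ : PAssign n) (p : List (TermList F sys n)) :
    IsClosedSpace d ρ p (closureSpace d ρ p) where
  rel f hf := by
    simp only [closureSpace, Submodule.mem_sInf]
    exact fun W hW => hW.rel f hf
  hyp L hL := by
    simp only [closureSpace, Submodule.mem_sInf]
    exact fun W hW => hW.hyp L hL
  mul f hf hc l hl := by
    simp only [closureSpace, Submodule.mem_sInf] at hf ⊢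
    exact fun W hW => hW.mul f (hf W hW) hc l hl

theorem closureSpace_le {d : ℕ} {ρ : PAssign n} {p : List (TermList F sys n)}
    {W : Submodule F (ℕ → F)} (hW : IsClosedSpace d ρ p W) : closureSpace d ρ p ≤ W :=
  sInf_le hW

theorem Indet.code_lt (l : Indet sys n) : l.code < 2 * n := by
  have := l.1.1.2
  unfold Indet.code
  split_ifs <;> omega

theorem Indet.code_injective : Function.Injective (Indet.code : Indet sys n → ℕ) := by
  rintro ⟨⟨i, b⟩, h⟩ ⟨⟨j, c⟩, h'⟩ e
  have := i.2
  have := j.2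
  cases b <;> cases c <;> simp [Indet.code] at e ⊢ <;> omega

theorem lowCount_mul_base {d : ℕ} (hd : 0 < d) : lowCount n d * base n = base n ^ d := by
  obtain ⟨d, rfl⟩ := Nat.exists_eq_succ_of_ne_zero hd.ne'
  simp [lowCount, pow_succ]

theorem wordCode_lt (w : List (Indet sys n)) (d : ℕ) (hw : w.length ≤ d) :
    wordCode w < base n ^ d := by
  -- For `n = 0` the base is 1 and the digit bound is not available, but then only the empty word
  -- exists. A nonempty word supplies a letter, and with it `1 < base n`.
  rcases w with _ | ⟨l, w⟩
  · simp [wordCode]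
  · have hb : 1 < base n := by have := l.code_lt; unfold base; omega
    refine lt_of_lt_of_le (Nat.ofDigits_lt_base_pow_length hb ?_)
      (Nat.pow_le_pow_right (by omega) (by rw [List.length_map]; exact hw))
    intro x hx
    obtain ⟨l, -, rfl⟩ := List.mem_map.1 hx
    have := l.code_lt
    unfold base; omega

theorem wordCode_lt_lowCount (w : List (Indet sys n)) (d : ℕ) (hw : w.length < d) :
    wordCode w < lowCount n d := by
  obtain ⟨d, rfl⟩ := Nat.exists_eq_succ_of_ne_zero (Nat.ne_of_gt (by omega : 0 < d))
  exact wordCode_lt w d (by omega)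

end Words

/-! ### Calculus of words modulo a closed subspace -/

section Closed

variable {F : Type*} [Field F] {sys : PCSystem} {n d : ℕ} {ρ : PAssign n}
  {p : List (TermList F sys n)} {W : Submodule F (ℕ → F)}

/-- Turns the relations with two terms into equations between classes in the quotient, where they
can be chained. -/
theorem tri_self_mem_iff (a b : ℕ) :
    tri a b b (-1 : F) 0 ∈ W ↔
      W.mkQ (Pi.single a (1 : F)) = W.mkQ (Pi.single b (1 : F)) := by
  rw [← sub_eq_zero, ← map_sub, Submodule.mkQ_apply, Submodule.Quotient.mk_eq_zero]
  have : tri a b b (-1 : F) 0 = Pi.single a 1 - Pi.single b 1 := by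
    simp [tri, Pi.single_neg, sub_eq_add_neg]
  rw [this]

/-- The class of a list of digits in the quotient space. -/
def digitClass (n : ℕ) (W : Submodule F (ℕ → F)) (l : List ℕ) : (ℕ → F) ⧸ W :=
  W.mkQ (Pi.single (Nat.ofDigits (base n) l) 1)

theorem ofDigits_lt_pow {n : ℕ} {l : List ℕ} (hl : ∀ x ∈ l, x < base n) :
    Nat.ofDigits (base n) l < base n ^ l.length := by
  rcases Nat.eq_zero_or_pos n with rfl | hn
  · have : Nat.ofDigits (base 0) l = 0 := by
      induction l with
      | nil => rfl
      | cons a l ih =>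
        have h1 := hl a (by simp)
        simp only [base] at *
        rw [Nat.ofDigits_cons, ih (fun x hx => hl x (by simp [hx]))]
        simp; omega
    rw [this]; positivity
  · exact Nat.ofDigits_lt_base_pow_length (by unfold base; omega) hl

/-- The list has full length `d`, blanks included, so its last entry is the top digit, of weight
`lowCount n d`. -/
theorem IsClosedSpace.digitClass_rotate (hW : IsClosedSpace d ρ p W) (i : ℕ) (l : List ℕ)
    (hlen : l.length + 1 = d) (hl : ∀ x ∈ l, x < base n) (hi : i < base n) :
    digitClass n W (l ++ [i]) = digitClass n W (i :: l) := by
  subst hlen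
  have h1 := ofDigits_lt_pow hl
  have := hW.rel _ (.rot (Nat.ofDigits (base n) l) i h1 hi)
  rw [tri_self_mem_iff] at this
  simp only [digitClass, Nat.ofDigits_append, Nat.ofDigits_cons, Nat.ofDigits_nil]
  simp only [lowCount] at this
  convert this using 3 <;> simp [mul_comm]

theorem IsClosedSpace.digitClass_rotate_append (hW : IsClosedSpace d ρ p W) (l l' : List ℕ)
    (hlen : l.length + l'.length = d) (hl : ∀ x ∈ l, x < base n) (hl' : ∀ x ∈ l', x < base n) :
    digitClass n W (l ++ l') = digitClass n W (l' ++ l) := by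
  induction l generalizing l' with
  | nil => simp
  | cons a l ih =>
    have hall : ∀ x ∈ l ++ l', x < base n := by
      intro x hx
      rcases List.mem_append.1 hx with h | h
      · exact hl x (by simp [h])
      · exact hl' x h
    have h1 := hW.digitClass_rotate a (l ++ l') (by simp at hlen ⊢; omega) hall (hl a (by simp))
    have h2 := ih (l' ++ [a]) (by simp at hlen ⊢; omega) (fun x hx => hl x (by simp [hx]))
      (by
        intro x hx
        rcases List.mem_append.1 hx with h | h
        · exact hl' x h
        · simp at h; subst h; exact hl x (by simp))
    rw [List.cons_append, ← h1, List.append_assoc, h2]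
    simp

theorem IsClosedSpace.digitClass_swap (hW : IsClosedSpace d ρ p W) (i j : ℕ) (l : List ℕ)
    (hlen : l.length + 2 = d) (hl : ∀ x ∈ l, x < base n) (hi : i < base n) (hj : j < base n) :
    digitClass n W (l ++ [i, j]) = digitClass n W (l ++ [j, i]) := by
  subst hlen
  have h1 := ofDigits_lt_pow hl
  have := hW.rel _ (.swap (Nat.ofDigits (base n) l) i j h1 hi hj)
  rw [tri_self_mem_iff] at this
  simp only [digitClass, Nat.ofDigits_append, Nat.ofDigits_cons, Nat.ofDigits_nil]
  simp only [lowCount, lowCount₂] at this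
  convert this using 3 <;> · simp; ring

theorem IsClosedSpace.digitClass_idem (hW : IsClosedSpace d ρ p W) (i : ℕ) (l : List ℕ)
    (hlen : l.length + 2 = d) (hl : ∀ x ∈ l, x < base n) (hi : i < base n) :
    digitClass n W (l ++ [i, i]) = digitClass n W (l ++ [i]) := by
  subst hlen
  have h1 := ofDigits_lt_pow hl
  have := hW.rel _ (.idem (Nat.ofDigits (base n) l) i h1 hi)
  rw [tri_self_mem_iff] at this
  simp only [digitClass, Nat.ofDigits_append, Nat.ofDigits_cons, Nat.ofDigits_nil]
  simp only [lowCount, lowCount₂] at this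
  convert this using 3 <;> · simp; try ring

/-- Rotations and the exchange of the last two places generate all permutations: an adjacent pair is
rotated to the end, exchanged there and rotated back. Both families of relations have at most `base
n ^ d` members. The induction carries an arbitrary prefix `a`, because the relations apply only to
lists of total length `d`. -/
theorem IsClosedSpace.digitClass_perm (hW : IsClosedSpace d ρ p W) {l₁ l₂ : List ℕ}
    (h : l₁.Perm l₂) (hl : ∀ x ∈ l₁, x < base n) (a : List ℕ) (ha : ∀ x ∈ a, x < base n)
    (hlen : a.length + l₁.length = d) :
    digitClass n W (a ++ l₁) = digitClass n W (a ++ l₂) := by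
  induction h generalizing a with
  | nil => rfl
  | cons x h ih =>
    have := ih (fun y hy => hl y (by simp [hy])) (a ++ [x])
      (by
        intro y hy
        rcases List.mem_append.1 hy with h | h
        · exact ha y h
        · simp at h; subst h; exact hl y (by simp))
      (by simp at hlen ⊢; omega)
    simpa using this
  | swap x y l =>
    have hx := hl x (by simp)
    have hy := hl y (by simp)
    have hl' : ∀ z ∈ l, z < base n := fun z hz => hl z (by simp [hz])
    have hla : ∀ z ∈ l ++ a, z < base n := by
      intro z hz
      rcases List.mem_append.1 hz with h | h
      · exact hl' z h
      · exact ha z h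
    have key : ∀ x y, x < base n → y < base n →
        digitClass n W (a ++ x :: y :: l) = digitClass n W ((l ++ a) ++ [x, y]) := by
      intro x y hx hy
      have := hW.digitClass_rotate_append (a ++ [x, y]) l (by simp at hlen ⊢; omega)
        (by
          intro z hz
          simp only [List.mem_append, List.mem_cons, List.not_mem_nil, or_false] at hz
          rcases hz with h | rfl | rfl
          · exact ha z h
          · exact hx
          · exact hy) hl'
      simpa using this
    rw [key y x hy hx, key x y hx hy]
    exact hW.digitClass_swap y x _ (by simp at hlen ⊢; omega) hla hy hx
  | trans h₁ h₂ ih₁ ih₂ =>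
    rw [ih₁ hl a ha hlen]
    exact ih₂ (fun y hy => hl y (h₁.mem_iff.2 hy)) a ha (by rw [← h₁.length_eq]; exact hlen)

/-- The class of a word in the quotient space. -/
def wordClass (W : Submodule F (ℕ → F)) (w : List (Indet sys n)) : (ℕ → F) ⧸ W :=
  W.mkQ (Pi.single (wordCode w) 1)

theorem wordClass_eq_digitClass (w : List (Indet sys n)) (k : ℕ) :
    wordClass W w = digitClass n W ((w.map fun l => l.code + 1) ++ List.replicate k 0) := by
  simp [wordClass, digitClass, wordCode, Nat.ofDigits_append_replicate_zero]

theorem digits_lt (w : List (Indet sys n)) (k : ℕ) :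
    ∀ x ∈ (w.map fun l => l.code + 1) ++ List.replicate k 0, x < base n := by
  intro x hx
  rcases List.mem_append.1 hx with h | h
  · obtain ⟨l, -, rfl⟩ := List.mem_map.1 h
    have := l.code_lt
    unfold base; omega
  · rw [List.eq_of_mem_replicate h]; unfold base; omega

theorem IsClosedSpace.wordClass_perm (hW : IsClosedSpace d ρ p W) {w₁ w₂ : List (Indet sys n)}
    (h : w₁.Perm w₂) (hlen : w₁.length ≤ d) : wordClass W w₁ = wordClass W w₂ := by
  rw [wordClass_eq_digitClass w₁ (d - w₁.length), wordClass_eq_digitClass w₂ (d - w₁.length)]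
  exact hW.digitClass_perm ((h.map _).append_right _) (digits_lt _ _) [] (by simp)
    (by simp; omega)

/-- The relation merges two equal digits at the end of a list of length `d`, so both copies of `α`
are first permuted to the end. Merging leaves the list one digit short. A top digit 0 restores the
length without changing the number, and this new blank is permuted behind the word. -/
theorem IsClosedSpace.wordClass_idem (hW : IsClosedSpace d ρ p W) (α : Indet sys n)
    (w : List (Indet sys n)) (hlen : w.length + 2 ≤ d) :
    wordClass W (α :: α :: w) = wordClass W (α :: w) := by
  set k := d - (w.length + 2)
  set t := (w.map fun l => l.code + 1) ++ List.replicate k 0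
  have ht := digits_lt w k
  have ha : α.code + 1 < base n := by have := α.code_lt; unfold base; omega
  have htl : t.length + 2 = d := by simp [t, k]; omega
  rw [wordClass_eq_digitClass (α :: α :: w) k, wordClass_eq_digitClass (α :: w) (k + 1)]
  have h1 := hW.digitClass_idem (α.code + 1) t htl ht ha
  have h2 := hW.digitClass_perm (l₁ := t ++ [α.code + 1, α.code + 1])
    (l₂ := (α.code + 1) :: (α.code + 1) :: t) List.perm_append_comm
    (by
      intro x hx
      simp only [List.mem_append, List.mem_cons, List.not_mem_nil, or_false, or_self] at hx
      rcases hx with h | rfl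
      · exact ht x h
      · exact ha) [] (by simp) (by simp; omega)
  have h3 := hW.digitClass_perm (l₁ := t ++ [α.code + 1, 0])
    (l₂ := (α.code + 1) :: (t ++ [0]))
    (by
      have : (t ++ [α.code + 1, 0]).Perm ([α.code + 1] ++ t ++ [0]) := by
        rw [show t ++ [α.code + 1, 0] = t ++ [α.code + 1] ++ [0] by simp]
        exact List.perm_append_comm.append_right _
      simpa only [List.cons_append, List.nil_append] using this)
    (by
      intro x hx
      simp only [List.mem_append, List.mem_cons, List.not_mem_nil, or_false] at hx
      rcases hx with h | rfl | rfl
      · exact ht x h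
      · exact ha
      · unfold base; omega) [] (by simp) (by simp; omega)
  have h4 : digitClass n W (t ++ [α.code + 1, 0]) = digitClass n W (t ++ [α.code + 1]) := by
    simp [digitClass, Nat.ofDigits_append, Nat.ofDigits_cons]
  simp only [List.nil_append] at h2 h3
  have e1 : (List.map (fun l : Indet sys n => l.code + 1) (α :: α :: w)) ++ List.replicate k 0
      = (α.code + 1) :: (α.code + 1) :: t := by simp [t]
  have e2 : (List.map (fun l : Indet sys n => l.code + 1) (α :: w)) ++ List.replicate (k + 1) 0
      = (α.code + 1) :: (t ++ [0]) := by simp [t, List.replicate_succ']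
  rw [e1, e2, ← h2, h1, ← h4, h3]

/-- A word of length less than `d` followed by a letter represents the word with the letter added
in front. -/
theorem IsClosedSpace.mkQ_single_add (hW : IsClosedSpace d ρ p W) (α : Indet sys n)
    (w : List (Indet sys n)) (hlen : w.length < d) :
    W.mkQ (Pi.single (wordCode w + (α.code + 1) * lowCount n d) 1) = wordClass W (α :: w) := by
  obtain ⟨d, rfl⟩ := Nat.exists_eq_succ_of_ne_zero (Nat.ne_of_gt (by omega : 0 < d))
  have hle : w.length ≤ d := by omega
  have ha : α.code + 1 < base n := by have := α.code_lt; unfold base; omega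
  have h := hW.digitClass_rotate (α.code + 1)
    ((w.map fun l => l.code + 1) ++ List.replicate (d - w.length) 0) (by simp; omega)
    (digits_lt _ _) ha
  rw [wordClass_eq_digitClass _ (d - w.length), List.map_cons, List.cons_append, ← h]
  have hz : Nat.ofDigits (base n) (List.replicate (d - w.length) 0) = 0 := by
    simp
  simp only [digitClass, Nat.ofDigits_append, hz, mul_zero, add_zero, lowCount,
    wordCode, List.length_append, List.length_map, List.length_replicate,
    Nat.add_sub_cancel' hle, Nat.ofDigits_singleton]
  rw [mul_comm]

theorem IsClosedSpace.mkQ_shift (hW : IsClosedSpace d ρ p W) (α : Indet sys n)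
    (w : List (Indet sys n)) (hlen : w.length < d) :
    W.mkQ (shift d n (α.code + 1) (Pi.single (wordCode w) 1)) = wordClass W (α :: w) := by
  rw [shift_single _ _ _ _ _ (wordCode_lt_lowCount w d hlen), hW.mkQ_single_add α w hlen]

/-- The difference of the two unit vectors lies in `W` and is supported on words shorter than `d`,
so closure under multiplication applies to it. -/
theorem IsClosedSpace.wordClass_cons (hW : IsClosedSpace d ρ p W) (α : Indet sys n)
    {w₁ w₂ : List (Indet sys n)} (h : wordClass W w₁ = wordClass W w₂) (h₁ : w₁.length < d)
    (h₂ : w₂.length < d) : wordClass W (α :: w₁) = wordClass W (α :: w₂) := by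
  rw [← hW.mkQ_shift α w₁ h₁, ← hW.mkQ_shift α w₂ h₂]
  rw [wordClass, wordClass, ← sub_eq_zero, ← map_sub, Submodule.mkQ_apply,
    Submodule.Quotient.mk_eq_zero] at h
  rw [← sub_eq_zero, ← map_sub, ← map_sub, Submodule.mkQ_apply,
    Submodule.Quotient.mk_eq_zero]
  have c₁ := wordCode_lt_lowCount w₁ d h₁
  have c₂ := wordCode_lt_lowCount w₂ d h₂
  refine hW.mul _ h ?_ _ α.code_lt
  intro c hc
  rw [Pi.sub_apply, Pi.single_eq_of_ne (by omega), Pi.single_eq_of_ne (by omega), sub_zero]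

/-- A head that occurs again in the tail is absorbed by that copy, which a permutation brings next
to it. Any other head is put in front of the congruence already known for the tail. -/
theorem IsClosedSpace.wordClass_dedup [DecidableEq (Indet sys n)] (hW : IsClosedSpace d ρ p W)
    (w : List (Indet sys n)) (hlen : w.length ≤ d) :
    wordClass W w = wordClass W w.dedup := by
  induction w with
  | nil => simp
  | cons α w ih =>
    have hlen' : w.length < d := by simpa using hlen
    have ih := ih hlen'.le
    have hd : w.dedup.length ≤ w.length := (List.dedup_sublist w).length_le
    by_cases hα : α ∈ w
    · rw [List.dedup_cons_of_mem hα, ← ih]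
      have hp := List.perm_cons_erase hα
      have hl : (w.erase α).length + 1 = w.length := by simpa using hp.length_eq.symm
      rw [hW.wordClass_perm (hp.cons α) hlen, hW.wordClass_perm hp hlen'.le]
      exact hW.wordClass_idem α _ (by omega)
    · rw [List.dedup_cons_of_notMem hα]
      exact hW.wordClass_cons α ih hlen' (by omega)

theorem IsClosedSpace.wordClass_compl (hW : IsClosedSpace d ρ p W) (α β : Indet sys n)
    (h : α.1.1 = β.1.1) (hα : α.1.2 = true) (hβ : β.1.2 = false)
    (w : List (Indet sys n)) (hlen : w.length < d) :
    wordClass W (α :: w) + wordClass W (β :: w) = wordClass W w := by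
  have := hW.rel _ (.compl (wordCode w) α.1.1 (wordCode_lt_lowCount w d hlen))
  rw [← hW.mkQ_single_add α w hlen, ← hW.mkQ_single_add β w hlen, wordClass, ← sub_eq_zero,
    ← map_add, ← map_sub, Submodule.mkQ_apply, Submodule.Quotient.mk_eq_zero]
  convert this using 1
  simp [tri, Indet.code, hα, hβ, h, Pi.single_neg, sub_eq_add_neg]

/-- The relations give known values only to the letters `x_i`. The value of a negated letter follows
by complementarity from its positive partner, which exists in both systems. -/
theorem IsClosedSpace.wordClass_value (hW : IsClosedSpace d ρ p W) (α : Indet sys n) (b : Bool)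
    (hb : α.pval ρ = some b)  (w : List (Indet sys n)) (hlen : w.length < d) :
    wordClass W (α :: w) = if b then wordClass W w else 0 := by
  have key : ∀ (α : Indet sys n) (b : Bool), ρ α.1.1 = some b → α.1.2 = true →
      wordClass W (α :: w) = if b then wordClass W w else 0 := by
    intro α b hb hα
    have := hW.rel _ (.value (wordCode w) α.1.1 b (wordCode_lt_lowCount w d hlen) hb)
    rw [← hW.mkQ_single_add α w hlen]
    cases b with
    | true =>
      simp only [if_true] at this ⊢
      rw [tri_self_mem_iff] at this
      rw [wordClass, ← this]
      simp [Indet.code, hα]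
    | false =>
      simp only [Bool.false_eq_true, if_false] at this ⊢
      rw [Submodule.mkQ_apply, Submodule.Quotient.mk_eq_zero]
      convert this using 1
      simp [tri, Indet.code, hα]
  obtain ⟨c, hc, hbc⟩ : ∃ c, ρ α.1.1 = some c ∧ (c == α.1.2) = b := by
    simpa [Indet.pval] using hb
  cases hα : α.1.2 with
  | true =>
    rw [hα] at hbc
    simp at hbc
    subst hbc
    exact key α c hc hα
  | false =>
    rw [hα] at hbc
    have := hW.wordClass_compl ⟨(α.1.1, true), by simp⟩ α rfl rfl hα w hlen
    rw [key ⟨(α.1.1, true), by simp⟩ c hc rfl] at this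
    subst hbc
    cases c <;> simpa using this

end Closed

/-! ## Completeness: derivations stay in the closure -/

section Completeness

variable {F : Type*} [Field F] {sys : PCSystem} {n d : ℕ} {ρ : PAssign n}
  {p : List (TermList F sys n)} {W : Submodule F (ℕ → F)}

open MvPolynomial

/-- The vector of a polynomial, with the letters of each monomial in some order. -/
noncomputable def polyVec :
    MvPolynomial (Indet sys n) F →ₗ[F] (ℕ → F) :=
  (basisMonomials (Indet sys n) F).constr F
    fun s => Pi.single (wordCode (Finsupp.toMultiset s).toList) 1

theorem polyVec_monomial (s : Indet sys n →₀ ℕ) (a : F) :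
    polyVec (monomial s a) = a • Pi.single (wordCode (Finsupp.toMultiset s).toList) (1 : F) := by
  have h : monomial s a = a • (basisMonomials (Indet sys n) F) s := by
    simp [coe_basisMonomials, smul_monomial]
  rw [h, map_smul, polyVec, Module.Basis.constr_basis]

theorem mkQ_polyVec_monomial (s : Indet sys n →₀ ℕ) (a : F) :
    W.mkQ (polyVec (monomial s a)) = a • wordClass W (Finsupp.toMultiset s).toList := by
  rw [polyVec_monomial, map_smul, wordClass]

theorem C_mul_prod_X (a : F) (w : List (Indet sys n)) :
    C a * (w.map X).prod = monomial (Multiset.toFinsupp (w : Multiset (Indet sys n))) a := by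
  induction w with
  | nil => simp
  | cons α w ih =>
    rw [List.map_cons, List.prod_cons, mul_left_comm, ih, X, monomial_mul, one_mul]
    congr 1
    rw [← Multiset.cons_coe, ← Multiset.singleton_add, map_add, Multiset.toFinsupp_singleton]

/-- The input and `polyVec` may order the letters of a monomial differently. Modulo `W` the order is
irrelevant. -/
theorem IsClosedSpace.mkQ_polyVec_poly (hW : IsClosedSpace d ρ p W) (L : TermList F sys n)
    (hL : ∀ t ∈ L, t.2.length ≤ d) : W.mkQ (polyVec L.poly) = W.mkQ L.vec := by
  induction L with
  | nil => simp [TermList.poly, TermList.vec]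
  | cons t L ih =>
    have ih := ih fun t ht => hL t (by simp [ht])
    have ht := hL t (by simp)
    simp only [TermList.poly, TermList.vec, List.map_cons, List.sum_cons, map_add] at ih ⊢
    rw [ih, C_mul_prod_X, mkQ_polyVec_monomial]
    congr 1
    rw [hW.wordClass_perm (w₂ := t.2) (by
      rw [← Multiset.coe_eq_coe]; simp) (by simpa using ht), wordClass, ← map_smul,
      ← Pi.single_smul, smul_eq_mul, mul_one]

theorem polyVec_eq_sum (g : MvPolynomial (Indet sys n) F) :
    polyVec g = ∑ s ∈ g.support, polyVec (monomial s (g.coeff s)) := by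
  conv_lhs => rw [g.as_sum, map_sum]

theorem length_toList_toMultiset_le {g : MvPolynomial (Indet sys n) F} {s : Indet sys n →₀ ℕ}
    (hs : s ∈ g.support) : (Finsupp.toMultiset s).toList.length ≤ g.totalDegree := by
  rw [Multiset.length_toList, Finsupp.card_toMultiset]
  exact le_totalDegree hs

theorem IsClosedSpace.mkQ_polyVec_X_mul (hW : IsClosedSpace d ρ p W) (α : Indet sys n)
    (g : MvPolynomial (Indet sys n) F) (hg : g.totalDegree < d) :
    W.mkQ (polyVec (X α * g)) = W.mkQ (shift d n (α.code + 1) (polyVec g)) := by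
  conv_lhs => rw [g.as_sum, Finset.mul_sum, map_sum, map_sum]
  rw [polyVec_eq_sum, map_sum, map_sum]
  refine Finset.sum_congr rfl fun s hs => ?_
  have hlen := length_toList_toMultiset_le hs
  rw [X, monomial_mul, one_mul, mkQ_polyVec_monomial, polyVec_monomial, map_smul, map_smul,
    hW.mkQ_shift α _ (by omega)]
  congr 1
  refine hW.wordClass_perm ?_ ?_
  · rw [← Multiset.coe_eq_coe, ← Multiset.cons_coe, ← Multiset.singleton_add]
    simp
  · rw [Multiset.length_toList] at hlen ⊢
    rw [map_add, Multiset.card_add, Finsupp.toMultiset_single, one_smul,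
      Multiset.card_singleton]
    omega

/-- Degree less than `d` means that only words shorter than `d` occur. Their codes are below
`lowCount n d`, which is the support condition in `IsClosedSpace.mul`. -/
theorem IsClosedSpace.polyVec_X_mul_mem (hW : IsClosedSpace d ρ p W) (α : Indet sys n)
    (g : MvPolynomial (Indet sys n) F) (hg : g.totalDegree < d) (h : polyVec g ∈ W) :
    polyVec (X α * g) ∈ W := by
  rw [← Submodule.Quotient.mk_eq_zero, ← Submodule.mkQ_apply, hW.mkQ_polyVec_X_mul α g hg,
    Submodule.mkQ_apply, Submodule.Quotient.mk_eq_zero]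
  refine hW.mul _ h (fun c hc => ?_) _ α.code_lt
  rw [polyVec_eq_sum, Finset.sum_apply]
  refine Finset.sum_eq_zero fun s hs => ?_
  have hlen := length_toList_toMultiset_le hs
  have := wordCode_lt_lowCount (Finsupp.toMultiset s).toList d (by omega)
  rw [polyVec_monomial, Pi.smul_apply, Pi.single_eq_of_ne (by omega), smul_zero]

theorem IsClosedSpace.wordClass_conjTrue (hW : IsClosedSpace d ρ p W) (w : List (Indet sys n))
    (hlen : w.length ≤ d) (h : ∀ l ∈ w, l.pval ρ = some true) :
    wordClass W w = wordClass W ([] : List (Indet sys n)) := by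
  induction w with
  | nil => rfl
  | cons α w ih =>
    rw [hW.wordClass_value α true (h α (by simp)) w (by simpa using hlen), if_pos rfl]
    exact ih (by simp at hlen; omega) fun l hl => h l (by simp [hl])

theorem IsClosedSpace.wordClass_conjFalse [DecidableEq (Indet sys n)]
    (hW : IsClosedSpace d ρ p W) (w : List (Indet sys n))
    (hlen : w.length ≤ d) (h : ∃ l ∈ w, l.pval ρ = some false) : wordClass W w = 0 := by
  obtain ⟨α, hα, hv⟩ := h
  have hp := List.perm_cons_erase hα
  have hl : (w.erase α).length + 1 = w.length := by simpa using hp.length_eq.symm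
  rw [hW.wordClass_perm hp hlen, hW.wordClass_value α false hv _ (by omega)]
  simp

/-- Idempotence reduces each monomial to the word of its support, so terms with equal support `S`
collect to `conjCoeff h S`. Every conjunction with nonzero coefficient is witnessed: its word is
congruent to the empty word or to zero. What remains is the empty word times the witnessed sum,
which is 0. -/
theorem IsClosedSpace.polyVec_mem_of_witnessedZero (hW : IsClosedSpace d ρ p W)
    (h : MvPolynomial (Indet sys n) F) (hdeg : h.totalDegree ≤ d) (hw : WitnessedZero ρ h) :
    polyVec h ∈ W := by
  classical
  rw [← Submodule.Quotient.mk_eq_zero, ← Submodule.mkQ_apply, polyVec_eq_sum, map_sum]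
  have h1 : ∀ s ∈ h.support, W.mkQ (polyVec (monomial s (h.coeff s))) =
      h.coeff s • wordClass W s.support.toList := by
    intro s hs
    have hlen := (length_toList_toMultiset_le hs).trans hdeg
    rw [mkQ_polyVec_monomial, hW.wordClass_dedup _ hlen]
    congr 1
    refine hW.wordClass_perm ?_ ((List.dedup_sublist _).length_le.trans hlen)
    rw [List.perm_ext_iff_of_nodup (List.nodup_dedup _) (Finset.nodup_toList _)]
    intro a
    simp
  rw [Finset.sum_congr rfl h1, ← Finset.sum_fiberwise (s := h.support) (g := fun s => s.support)]
  have h2 : ∀ S : Finset (Indet sys n), ∑ s ∈ h.support with s.support = S,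
      h.coeff s • wordClass W s.support.toList = conjCoeff h S • wordClass W S.toList := by
    intro S
    rw [conjCoeff, Finset.sum_smul]
    refine Finset.sum_congr (by congr) fun s hs => ?_
    rw [(Finset.mem_filter.1 hs).2]
  -- A nonzero coefficient forces `S` to be the support of a monomial of `h`, so the word of `S` is
  -- short enough for the rules above.
  have hcard : ∀ S : Finset (Indet sys n), conjCoeff h S ≠ 0 → S.toList.length ≤ d := by
    intro S hS
    obtain ⟨s, hs, -⟩ := Finset.exists_ne_zero_of_sum_ne_zero hS
    obtain ⟨hs', rfl⟩ := Finset.mem_filter.1 hs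
    refine le_trans ?_ ((length_toList_toMultiset_le hs').trans hdeg)
    rw [Finset.length_toList, Multiset.length_toList, ← Finsupp.toFinset_toMultiset]
    exact Multiset.toFinset_card_le _
  have h3 : ∀ S : Finset (Indet sys n), conjCoeff h S • wordClass W S.toList =
      if ConjTrue ρ S then conjCoeff h S • wordClass W ([] : List (Indet sys n)) else 0 := by
    intro S
    by_cases hS : conjCoeff h S = 0
    · simp [hS]
    · have hl := hcard S hS
      split_ifs with ht
      · rw [hW.wordClass_conjTrue _ hl (by simpa [ConjTrue] using ht)]
      · have hf := (hw.1 S hS).resolve_left ht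
        rw [hW.wordClass_conjFalse _ hl (by simpa [ConjFalse] using hf), smul_zero]
  simp only [h2, h3]
  rw [← Finset.sum_filter, ← Finset.sum_smul]
  have := hw.2
  rw [show (∑ S : Finset (Indet sys n) with ConjTrue ρ S, conjCoeff h S) = 0 by
    convert this, zero_smul]

/-- Induction on the derivation: each axiom is a relation, each rule an operation under which `W` is
closed. Witnessed hypotheses cost nothing, since they already lie in `W`. -/
theorem IsClosedSpace.polyVec_mem_of_derives (hW : IsClosedSpace d ρ p W)
    (hp : ∀ L ∈ p, ∀ t ∈ L, t.2.length ≤ d) (h : List (MvPolynomial (Indet sys n) F))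
    (hh : ∀ g ∈ h, WitnessedZero ρ g) {q : MvPolynomial (Indet sys n) F}
    (hq : Derives d {g | g ∈ p.map TermList.poly ∨ g ∈ h} q) : polyVec q ∈ W := by
  induction hq with
  | hyp g hg hdeg =>
    rcases hg with hg | hg
    · obtain ⟨L, hL, rfl⟩ := List.mem_map.1 hg
      rw [← Submodule.Quotient.mk_eq_zero, ← Submodule.mkQ_apply,
        hW.mkQ_polyVec_poly L (hp L hL), Submodule.mkQ_apply, Submodule.Quotient.mk_eq_zero]
      exact hW.hyp L hL
    · exact hW.polyVec_mem_of_witnessedZero g hdeg (hh g hg)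
  | zero => simp
  | boolean α hdeg =>
    have hX2 : (X α ^ 2 : MvPolynomial (Indet sys n) F) =
        monomial (Finsupp.single α 2) 1 := by rw [X_pow_eq_monomial]
    -- The monomial `α²` has coefficient 1 and does not cancel against `α`, so the axiom fits into
    -- degree `d` only if `2 ≤ d`. Only then are there relations for a repeated letter.
    have hd : 2 ≤ d := by
      refine le_trans ?_ hdeg
      have : Finsupp.single α 2 ∈ (X α ^ 2 - X α : MvPolynomial (Indet sys n) F).support := by
        rw [mem_support_iff, coeff_sub, hX2, coeff_monomial, X, coeff_monomial]
        have : (Finsupp.single α 1 : Indet sys n →₀ ℕ) ≠ Finsupp.single α 2 := by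
          intro h
          have := DFunLike.congr_fun h α
          simp at this
        simp [this]
      simpa using le_totalDegree this
    rw [← Submodule.Quotient.mk_eq_zero, ← Submodule.mkQ_apply, hX2, X, map_sub, map_sub,
      mkQ_polyVec_monomial, mkQ_polyVec_monomial, sub_eq_zero]
    have e1 : wordClass W (Finsupp.toMultiset (Finsupp.single α 2)).toList =
        wordClass W [α, α] := hW.wordClass_perm (by
          rw [← Multiset.coe_eq_coe]
          simp [Finsupp.toMultiset_single, Multiset.nsmul_singleton, Multiset.replicate_succ]
          rfl)
          (by simp [hd])
    rw [e1, hW.wordClass_idem α [] (by simpa using hd)]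
    simp [Finsupp.toMultiset_single]
  | compl α β h1 h2 h3 hdeg =>
    have hne : α ≠ β := by rintro rfl; simp [h2] at h3
    have hd : 1 ≤ d := by
      refine le_trans ?_ hdeg
      have : Finsupp.single α 1 ∈ (X α + X β - 1 : MvPolynomial (Indet sys n) F).support := by
        rw [mem_support_iff, coeff_sub, coeff_add, X, X, coeff_monomial, coeff_monomial,
          coeff_one]
        have h : (Finsupp.single β 1 : Indet sys n →₀ ℕ) ≠ Finsupp.single α 1 := by
          intro h
          have := DFunLike.congr_fun h α
          simp [hne.symm] at this
        have h' : (0 : Indet sys n →₀ ℕ) ≠ Finsupp.single α 1 := by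
          intro h
          have := DFunLike.congr_fun h α
          simp at this
        simp [h, h']
      simpa using le_totalDegree this
    have h1' : (1 : MvPolynomial (Indet sys n) F) = monomial 0 1 := by simp
    rw [← Submodule.Quotient.mk_eq_zero, ← Submodule.mkQ_apply, h1', X, X, map_sub, map_sub,
      map_add, map_add, mkQ_polyVec_monomial, mkQ_polyVec_monomial, mkQ_polyVec_monomial,
      sub_eq_zero]
    simpa [Finsupp.toMultiset_single] using hW.wordClass_compl α β h1 h2 h3 [] hd
  | lin a b f g _ _ _ ihf ihg =>
    rw [map_add, ← smul_eq_C_mul, ← smul_eq_C_mul, map_smul, map_smul]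
    exact W.add_mem (W.smul_mem _ ihf) (W.smul_mem _ ihg)
  | mul α g _ hdeg ih =>
    -- The degree of a product is additive only for nonzero factors. For `g ≠ 0` it yields degree of
    -- `g` less than `d`.
    by_cases hg : g = 0
    · simp [hg]
    · refine hW.polyVec_X_mul_mem α g ?_ ih
      rw [totalDegree_mul_of_isDomain (X_ne_zero α) hg, totalDegree_X] at hdeg
      omega

theorem vec_mem_closureSpace_of_derives
    (hp : ∀ L ∈ p, L.IsRep d) {q : TermList F sys n} (hqd : q.IsRep d)
    (h : List (MvPolynomial (Indet sys n) F)) (hh : ∀ g ∈ h, WitnessedZero ρ g)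
    (hq : Derives d {g | g ∈ p.map TermList.poly ∨ g ∈ h} q.poly) :
    q.vec ∈ closureSpace d ρ p := by
  have hW := isClosedSpace_closureSpace d ρ p
  have := hW.polyVec_mem_of_derives (fun L hL => (hp L hL).1) h hh hq
  rwa [← Submodule.Quotient.mk_eq_zero, ← Submodule.mkQ_apply, hW.mkQ_polyVec_poly q hqd.1,
    Submodule.mkQ_apply, Submodule.Quotient.mk_eq_zero] at this

end Completeness

/-! ## Soundness: the closure vanishes where the hypotheses hold -/

section Soundness

variable {F : Type*} [Field F] {sys : PCSystem} {n d : ℕ}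

/-- The value of a letter under a total assignment. -/
def letterVal (F : Type*) [Field F] {n : ℕ} (x : Assign n) (k : ℕ) : F :=
  if k = 0 then 1
  else if h : k - 1 < n then (if x ⟨k - 1, h⟩ then 1 else 0)
  else if h : k - 1 - n < n then (if x ⟨k - 1 - n, h⟩ then 0 else 1)
  else 0

/-- The value of a word under a total assignment. -/
def wordVal (F : Type*) [Field F] {n : ℕ} (x : Assign n) (c : ℕ) : F :=
  ((Nat.digits (base n) c).map (letterVal F x)).prod

/-- `Nat.digits` drops the blanks at the top. This is harmless because a blank has value 1. -/
theorem wordVal_ofDigits (hn : 1 ≤ n) (x : Assign n) (l : List ℕ) (hl : ∀ k ∈ l, k < base n) :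
    wordVal F x (Nat.ofDigits (base n) l) = (l.map (letterVal F x)).prod := by
  induction l with
  | nil => simp [wordVal]
  | cons a l ih =>
    have ih := ih fun k hk => hl k (by simp [hk])
    rw [Nat.ofDigits_cons]
    by_cases h : a = 0 ∧ Nat.ofDigits (base n) l = 0
    · rw [h.2] at ih
      simp only [h.1, h.2, mul_zero, add_zero, List.map_cons, List.prod_cons, ← ih]
      simp [wordVal, letterVal]
    · rw [wordVal, Nat.digits_add _ (by unfold base; omega) _ _ (hl a (by simp)) (by tauto)]
      simp only [List.map_cons, List.prod_cons, ← ih, wordVal]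

theorem exists_digits (n k w : ℕ) (hw : w < base n ^ k) :
    ∃ l : List ℕ, l.length = k ∧ (∀ i ∈ l, i < base n) ∧ Nat.ofDigits (base n) l = w := by
  induction k generalizing w with
  | zero => exact ⟨[], rfl, by simp, by simp at hw; simp [hw]⟩
  | succ k ih =>
    obtain ⟨l, hlen, hl, hw'⟩ := ih (w / base n) (by
      apply Nat.div_lt_of_lt_mul; rwa [mul_comm, ← pow_succ])
    refine ⟨w % base n :: l, by simp [hlen], ?_, ?_⟩
    · intro i hi
      rcases List.mem_cons.1 hi with rfl | hi
      · exact Nat.mod_lt _ (by unfold base; omega)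
      · exact hl i hi
    · rw [Nat.ofDigits_cons, hw', Nat.mod_add_div]

theorem wordVal_add_mul_lowCount (hn : 1 ≤ n) (x : Assign n) (w i : ℕ) (hw : w < lowCount n d)
    (hi : i < base n) :
    wordVal F x (w + i * lowCount n d) = wordVal F x w * letterVal F x i := by
  rcases d with _ | d
  · simp [lowCount] at hw
  obtain ⟨l, hlen, hl, rfl⟩ := exists_digits n d w hw
  have h : Nat.ofDigits (base n) l + i * lowCount n (d + 1) =
      Nat.ofDigits (base n) (l ++ [i]) := by
    simp [Nat.ofDigits_append, lowCount, hlen, mul_comm]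
  rw [h, wordVal_ofDigits hn x _ (by
    intro k hk
    rcases List.mem_append.1 hk with h | h
    · exact hl k h
    · simp at h; omega), wordVal_ofDigits hn x _ hl]
  simp

theorem wordVal_add_mul_base (hn : 1 ≤ n) (x : Assign n) (w i : ℕ) (hi : i < base n) :
    wordVal F x (i + w * base n) = letterVal F x i * wordVal F x w := by
  by_cases h : i = 0 ∧ w = 0
  · simp [h.1, h.2, wordVal, letterVal]
  · rw [wordVal, mul_comm, Nat.digits_add _ (by unfold base; omega) _ _ hi (by tauto)]
    simp [wordVal]

theorem add_mul_lowCount_lt (w i : ℕ) (hw : w < lowCount n d) (hi : i < base n) :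
    w + i * lowCount n d < base n ^ d := by
  rcases d with _ | d
  · simp [lowCount] at hw
  · simp only [lowCount] at *
    calc w + i * base n ^ d < base n ^ d + i * base n ^ d := by omega
      _ = (i + 1) * base n ^ d := by ring
      _ ≤ base n * base n ^ d := Nat.mul_le_mul_right _ hi
      _ = base n ^ (d + 1) := by ring

theorem add_mul_base_lt (w i : ℕ) (hw : w < lowCount n d) (hi : i < base n) :
    i + w * base n < base n ^ d := by
  rcases d with _ | d
  · simp [lowCount] at hw
  · simp only [lowCount] at *
    calc i + w * base n < base n + w * base n := by omega
      _ = (w + 1) * base n := by ring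
      _ ≤ base n ^ d * base n := Nat.mul_le_mul_right _ hw
      _ = base n ^ (d + 1) := by ring

theorem lowCount_le (n d : ℕ) : lowCount n d ≤ base n ^ d := by
  rcases d with _ | d
  · simp [lowCount]
  · exact Nat.pow_le_pow_right (by unfold base; omega) (by omega)

theorem add_mul_lowCount₂_lt (u i : ℕ) (hu : u < lowCount₂ n d) (hi : i < base n) :
    u + i * lowCount₂ n d < lowCount n d := by
  rcases d with _ | d
  · simp [lowCount₂] at hu
  · exact add_mul_lowCount_lt u i hu hi

theorem lowCount₂_le (n d : ℕ) : lowCount₂ n d ≤ lowCount n d := by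
  rcases d with _ | d
  · simp [lowCount₂, lowCount]
  · exact lowCount_le n d

theorem wordVal_add_mul_lowCount₂ (hn : 1 ≤ n) (x : Assign n) (u i : ℕ)
    (hu : u < lowCount₂ n d) (hi : i < base n) :
    wordVal F x (u + i * lowCount₂ n d) = wordVal F x u * letterVal F x i := by
  rcases d with _ | d
  · simp [lowCount₂] at hu
  · exact wordVal_add_mul_lowCount hn x u i hu hi

/-- The value of a vector under a total assignment. -/
def evalVec (F : Type*) [Field F] {n : ℕ} (d : ℕ) (x : Assign n) : (ℕ → F) →ₗ[F] F where
  toFun f := ∑ c ∈ Finset.range (base n ^ d), f c * wordVal F x c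
  map_add' f g := by simp [add_mul, Finset.sum_add_distrib]
  map_smul' a f := by simp [mul_assoc, Finset.mul_sum]

theorem evalVec_single (x : Assign n) (c : ℕ) (a : F) (hc : c < base n ^ d) :
    evalVec F d x (Pi.single c a) = a * wordVal F x c := by
  simp only [evalVec, LinearMap.coe_mk, AddHom.coe_mk]
  rw [Finset.sum_eq_single_of_mem c (Finset.mem_range.2 hc)]
  · simp
  · intro b _ hb; simp [Pi.single_eq_of_ne hb]

theorem evalVec_tri (x : Assign n) (a b c : ℕ) (u w : F) (ha : a < base n ^ d)
    (hb : b < base n ^ d) (hc : c < base n ^ d) :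
    evalVec F d x (tri a b c u w) =
      wordVal F x a + u * wordVal F x b + w * wordVal F x c := by
  simp [tri, evalVec_single, ha, hb, hc]

theorem eq_sum_single (f : ℕ → F) (m : ℕ) (hf : ∀ c, m ≤ c → f c = 0) :
    f = ∑ c ∈ Finset.range m, Pi.single c (f c) := by
  funext e
  rw [Finset.sum_apply]
  by_cases he : e < m
  · rw [Finset.sum_eq_single_of_mem e (Finset.mem_range.2 he)]
    · simp
    · intro b _ hb; simp [Pi.single_eq_of_ne hb.symm]
  · rw [hf e (by omega), Finset.sum_eq_zero]
    intro c hc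
    rw [Pi.single_eq_of_ne]
    have := Finset.mem_range.1 hc
    omega

theorem evalVec_shift (hn : 1 ≤ n) (x : Assign n) (f : ℕ → F) (k : ℕ) (hk : k < base n)
    (hf : ∀ c, lowCount n d ≤ c → f c = 0) :
    evalVec F d x (shift d n k f) = evalVec F d x f * letterVal F x k := by
  rw [eq_sum_single f _ hf]
  simp only [map_sum, Finset.sum_mul]
  refine Finset.sum_congr rfl fun c hc => ?_
  have hc := Finset.mem_range.1 hc
  rw [shift_single _ _ _ _ _ hc, evalVec_single _ _ _ (add_mul_lowCount_lt _ _ hc hk),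
    evalVec_single _ _ _ (hc.trans_le (lowCount_le n d)), wordVal_add_mul_lowCount hn x _ _ hc hk,
    mul_assoc]

theorem letterVal_code (x : Assign n) (l : Indet sys n) :
    letterVal F x (l.code + 1) = if l.val x then 1 else 0 := by
  obtain ⟨⟨i, b⟩, h⟩ := l
  cases b
  · cases hx : x i <;> simp [letterVal, Indet.code, Indet.val, hx]
  · simp [letterVal, Indet.code, Indet.val]

theorem evalVec_vec (hn : 1 ≤ n) (x : Assign n) (L : TermList F sys n)
    (hL : ∀ t ∈ L, t.2.length ≤ d) :
    evalVec F d x L.vec = MvPolynomial.eval (fun l => if l.val x then (1 : F) else 0) L.poly := by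
  rw [TermList.vec, TermList.poly, map_list_sum, map_list_sum, List.map_map, List.map_map]
  congr 1
  refine List.map_congr_left fun t ht => ?_
  simp only [Function.comp, map_mul, MvPolynomial.eval_C]
  rw [evalVec_single _ _ _ (wordCode_lt _ _ (hL t ht)), wordCode, wordVal_ofDigits hn]
  · rw [map_list_prod, List.map_map, List.map_map]
    congr 2
    refine List.map_congr_left fun l _ => ?_
    simp [letterVal_code]
  · intro k hk
    obtain ⟨l, -, rfl⟩ := List.mem_map.1 hk
    have := l.code_lt
    unfold base; omega

theorem letterVal_pos (x : Assign n) (i : Fin n) :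
    letterVal F x (i + 1) = if x i then 1 else 0 := by
  simp [letterVal]

theorem letterVal_neg (x : Assign n) (i : Fin n) :
    letterVal F x (n + i + 1) = if x i then 0 else 1 := by
  simp [letterVal]

/-- For Boolean values every relation is an identity: products commute, 0 and 1 are idempotent,
complementary letters sum to 1, and a value known from `ρ` is the value in `x`. Multiplication by a
letter multiplies the value of the vector, so it preserves the value 0. -/
theorem isClosedSpace_ker_evalVec (hn : 1 ≤ n) (x : Assign n) (ρ : PAssign n)
    (hρ : Consistent ρ x) (p : List (TermList F sys n)) (hp : ∀ L ∈ p, L.IsRep d)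
    (hx : ∀ L ∈ p, HoldsAt x L.poly) :
    IsClosedSpace d ρ p (LinearMap.ker (evalVec F d x)) where
  rel f hf := by
    rw [LinearMap.mem_ker]
    cases hf with
    | rot w i hw hi =>
      have h1 := add_mul_lowCount_lt w i hw hi
      have h2 := add_mul_base_lt w i hw hi
      rw [evalVec_tri _ _ _ _ _ _ h1 h2 h2, wordVal_add_mul_lowCount hn x _ _ hw hi,
        wordVal_add_mul_base hn x _ _ hi]
      ring
    | swap u i j hu hi hj =>
      have hi' := add_mul_lowCount₂_lt u i hu hi
      have hj' := add_mul_lowCount₂_lt u j hu hj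
      have h1 := add_mul_lowCount_lt _ j hi' hj
      have h2 := add_mul_lowCount_lt _ i hj' hi
      rw [evalVec_tri _ _ _ _ _ _ h1 h2 h2, wordVal_add_mul_lowCount hn x _ _ hi' hj,
        wordVal_add_mul_lowCount hn x _ _ hj' hi, wordVal_add_mul_lowCount₂ hn x _ _ hu hi,
        wordVal_add_mul_lowCount₂ hn x _ _ hu hj]
      ring
    | idem u i hu hi =>
      have hi' := add_mul_lowCount₂_lt u i hu hi
      have h1 := add_mul_lowCount_lt _ i hi' hi
      have h2 := hi'.trans_le (lowCount_le n d)
      rw [evalVec_tri _ _ _ _ _ _ h1 h2 h2, wordVal_add_mul_lowCount hn x _ _ hi' hi,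
        wordVal_add_mul_lowCount₂ hn x _ _ hu hi]
      have : letterVal F x i * letterVal F x i = letterVal F x i := by
        unfold letterVal; split_ifs <;> simp
      rw [mul_assoc, this]
      ring
    | compl w i hw =>
      have hi1 : (i : ℕ) + 1 < base n := by have := i.2; unfold base; omega
      have hi2 : n + (i : ℕ) + 1 < base n := by have := i.2; unfold base; omega
      rw [evalVec_tri _ _ _ _ _ _ (add_mul_lowCount_lt _ _ hw hi1)
        (add_mul_lowCount_lt _ _ hw hi2) (hw.trans_le (lowCount_le n d)),
        wordVal_add_mul_lowCount hn x _ _ hw hi1, wordVal_add_mul_lowCount hn x _ _ hw hi2,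
        letterVal_pos, letterVal_neg]
      cases x i <;> simp
    | value w i b hw hb =>
      have hi1 : (i : ℕ) + 1 < base n := by have := i.2; unfold base; omega
      have hw' := hw.trans_le (lowCount_le n d)
      rw [evalVec_tri _ _ _ _ _ _ (add_mul_lowCount_lt _ _ hw hi1) hw' hw',
        wordVal_add_mul_lowCount hn x _ _ hw hi1, letterVal_pos, ← hρ i b hb]
      cases b <;> simp
  hyp L hL := by
    rw [LinearMap.mem_ker, evalVec_vec hn x L (hp L hL).1]
    exact hx L hL
  mul f hf hc l hl := by
    rw [LinearMap.mem_ker] at hf ⊢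
    rw [evalVec_shift hn x f _ (by unfold base; omega) hc, hf, zero_mul]

theorem holdsAt_of_vec_mem_closureSpace (hn : 1 ≤ n) {x : Assign n} {ρ : PAssign n}
    (hρ : Consistent ρ x) {p : List (TermList F sys n)} (hp : ∀ L ∈ p, L.IsRep d)
    {q : TermList F sys n} (hq : q.IsRep d) (hmem : q.vec ∈ closureSpace d ρ p)
    (hx : ∀ L ∈ p, HoldsAt x L.poly) : HoldsAt x q.poly := by
  have := closureSpace_le (isClosedSpace_ker_evalVec hn x ρ hρ p hp hx) hmem
  rwa [LinearMap.mem_ker, evalVec_vec hn x q hq.1] at this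

end Soundness

/-! ## Concentration -/

section Probability

open MeasureTheory ProbabilityTheory

instance : DiscreteMeasurableSpace (Option Bool) := ⟨fun _ => trivial⟩

/-- Hoeffding's inequality for the upper tail, applied to the indicator of `A` on independent
coordinates. -/
theorem measureReal_pi_card_ge_le {Ω : Type*} [MeasurableSpace Ω] (μ : Measure Ω)
    [IsProbabilityMeasure μ] (A : Set Ω) (hA : MeasurableSet A) [DecidablePred (· ∈ A)] (m : ℕ)
    (r : ℝ) (hr : 0 ≤ r) :
    (Measure.pi fun _ : Fin m => μ).real
      {ρ | m * μ.real A + r * m ≤ (Finset.univ.filter fun i => ρ i ∈ A).card} ≤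
      Real.exp (-(2 * r ^ 2 * m)) := by
  set X : Ω → ℝ := A.indicator 1 with hX
  have hXm : Measurable X := measurable_one.indicator hA
  have hint : ∫ ω, X ω ∂μ = μ.real A := by
    rw [hX, integral_indicator_one hA]
  -- A variable with values in `[0, 1]` has sub-Gaussian parameter 1/4 after centering. Over `m`
  -- coordinates and deviation `r * m` this gives the exponent `-2 r² m`.
  have hXi : ∀ i : Fin m, HasSubgaussianMGF
      (fun ρ : Fin m → Ω => X (ρ i) - μ.real A) ((‖(1 : ℝ) - 0‖₊ / 2) ^ 2)
      (Measure.pi fun _ : Fin m => μ) := by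
    intro i
    have h := hasSubgaussianMGF_of_mem_Icc (μ := Measure.pi fun _ : Fin m => μ)
      (X := fun ρ : Fin m → Ω => X (ρ i)) (a := 0) (b := 1)
      ((hXm.comp (measurable_pi_apply i)).aemeasurable)
      (Filter.Eventually.of_forall fun ρ => by
        by_cases h : ρ i ∈ A <;> simp [hX, h])
    have hi : ∫ ρ : Fin m → Ω, X (ρ i) ∂(Measure.pi fun _ : Fin m => μ) = μ.real A := by
      rw [integral_comp_eval (μ := fun _ : Fin m => μ) (f := X) hXm.aestronglyMeasurable, hint]
    rwa [hi] at h
  have hind : iIndepFun (fun (i : Fin m) (ρ : Fin m → Ω) => X (ρ i) - μ.real A)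
      (Measure.pi fun _ : Fin m => μ) :=
    iIndepFun_pi (μ := fun _ : Fin m => μ) (X := fun _ ω => X ω - μ.real A)
      fun _ => (hXm.sub_const _).aemeasurable
  have h := HasSubgaussianMGF.measure_sum_ge_le_of_iIndepFun hind (s := Finset.univ)
    (fun i _ => hXi i) (ε := r * m) (by positivity)
  refine le_trans (le_of_eq ?_) (h.trans (le_of_eq ?_))
  · congr 1
    ext ρ
    have : ∑ i : Fin m, (X (ρ i) - μ.real A) =
        ((Finset.univ.filter fun i => ρ i ∈ A).card : ℝ) - m * μ.real A := by
      rw [Finset.sum_sub_distrib, Finset.card_filter]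
      push_cast
      simp [hX, Set.indicator_apply]
    simp only [Set.mem_ofPred_eq, this]
    constructor <;> intro h <;> linarith
  · congr 1
    rcases Nat.eq_zero_or_pos m with rfl | hm
    · simp
    · have : (m : ℝ) ≠ 0 := by positivity
      simp
      field_simp

theorem one_sub_le_measureReal_pi_of_le {Ω : Type*} [MeasurableSpace Ω]
    [Finite Ω] [MeasurableSingletonClass Ω] (μ : Measure Ω) [IsProbabilityMeasure μ]
    (A : Set Ω) [DecidablePred (· ∈ A)] (m : ℕ) (s r δ : ℝ) (hr : 0 ≤ r)
    (hs : μ.real A + r ≤ s) (hδ : Real.exp (-(2 * r ^ 2 * m)) ≤ δ) (S : Set (Fin m → Ω))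
    (hS : ∀ ρ, ((Finset.univ.filter fun i => ρ i ∈ A).card : ℝ) < s * m → ρ ∈ S) :
    1 - δ ≤ (Measure.pi fun _ : Fin m => μ).real S := by
  have h := measureReal_pi_card_ge_le μ A A.toFinite.measurableSet m r hr
  have hc : (Measure.pi fun _ : Fin m => μ).real Sᶜ ≤ δ := by
    refine (measureReal_mono ?_).trans (h.trans hδ)
    intro ρ hρ
    simp only [Set.mem_ofPred_eq]
    by_contra hlt
    push Not at hlt
    refine hρ (hS ρ (hlt.trans_le ?_))
    nlinarith [Nat.cast_nonneg (α := ℝ) m]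
  rw [probReal_compl_eq_one_sub S.toFinite.measurableSet] at hc
  linarith

/-- The lower tail for `A` is the upper tail for its complement, whose count is `m` minus the count
for `A`. -/
theorem one_sub_le_measureReal_pi_of_ge {Ω : Type*} [MeasurableSpace Ω]
    [Finite Ω] [MeasurableSingletonClass Ω] (μ : Measure Ω) [IsProbabilityMeasure μ]
    (A : Set Ω) [DecidablePred (· ∈ A)] (m : ℕ) (s r δ : ℝ) (hr : 0 ≤ r)
    (hs : s ≤ μ.real A - r) (hδ : Real.exp (-(2 * r ^ 2 * m)) ≤ δ) (S : Set (Fin m → Ω))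
    (hS : ∀ ρ, s * m < ((Finset.univ.filter fun i => ρ i ∈ A).card : ℝ) → ρ ∈ S) :
    1 - δ ≤ (Measure.pi fun _ : Fin m => μ).real S := by
  classical
  refine one_sub_le_measureReal_pi_of_le μ Aᶜ m (1 - s) r δ hr ?_ hδ S fun ρ hρ => hS ρ ?_
  · rw [probReal_compl_eq_one_sub A.toFinite.measurableSet]
    linarith
  · have h : (Finset.univ.filter fun i => ρ i ∈ A).card +
        (Finset.univ.filter fun i => ρ i ∈ Aᶜ).card = m := by
      have := Finset.card_filter_add_card_filter_not (s := (Finset.univ : Finset (Fin m)))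
        (fun i => ρ i ∈ A)
      simpa using this
    have h' : ((Finset.univ.filter fun i => ρ i ∈ A).card : ℝ) +
        (Finset.univ.filter fun i => ρ i ∈ Aᶜ).card = m := by exact_mod_cast h
    linarith

/-- A mask only produces partial assignments consistent with `x`. Hence an `x` outside `V` never
contributes to `G`, and an `x` in `V` contributes at most its own mass. -/
theorem measureReal_masked_le {n : ℕ} (M : PMF (Mask n)) (D : PMF (Assign n))
    (G : Set (PAssign n)) (V : Set (Assign n))
    (h : ∀ x ρ, Consistent ρ x → ρ ∈ G → x ∈ V) :
    (masked M D).toMeasure.real G ≤ D.toMeasure.real V := by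
  refine ENNReal.toReal_mono (measure_ne_top _ _) ?_
  rw [PMF.toMeasure_apply_eq_toOuterMeasure_apply _ G.toFinite.measurableSet,
    PMF.toMeasure_apply_eq_toOuterMeasure_apply _ V.toFinite.measurableSet, masked,
    PMF.toOuterMeasure_bind_apply, PMF.toOuterMeasure_apply]
  refine ENNReal.tsum_le_tsum fun x => ?_
  by_cases hx : x ∈ V
  · rw [Set.indicator_of_mem hx]
    calc D x * _ ≤ D x * 1 := by
          gcongr
          rw [← PMF.toMeasure_apply_eq_toOuterMeasure_apply _ G.toFinite.measurableSet]
          exact prob_le_one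
      _ = D x := mul_one _
  · rw [PMF.toOuterMeasure_map_apply]
    have : (fun f : Mask n => f.1 x) ⁻¹' G = ∅ := by
      ext f
      simp only [Set.mem_preimage, Set.mem_empty_iff_false, iff_false]
      exact fun hf => hx (h x _ (f.2 x) hf)
    simp [this]

end Probability

/-! ## Reasoning about programs -/

section Rules

variable {F : Type*}

namespace Memory

/-- Assign a natural number variable. -/
def setN (s : Memory F) (x k : ℕ) : Memory F :=
  { s with nvar := Function.update s.nvar x k }

/-- Assign a cell of a natural number array. -/
def setNA (s : Memory F) (a : ℕ) (i : List ℕ) (k : ℕ) : Memory F :=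
  { s with narr := Function.update s.narr a (Function.update (s.narr a) i k) }

/-- Assign a field variable. -/
def setF (s : Memory F) (u : ℕ) (v : F) : Memory F :=
  { s with fvar := Function.update s.fvar u v }

/-- Assign a cell of a field array. -/
def setFA (s : Memory F) (a : ℕ) (i : List ℕ) (v : F) : Memory F :=
  { s with farr := Function.update s.farr a (Function.update (s.farr a) i v) }

section Simp

variable (s : Memory F) (x y k a b u w : ℕ) (i j : List ℕ) (v : F)

@[simp] theorem setN_nvar : (s.setN x k).nvar y = if y = x then k else s.nvar y := by
  simp [setN, Function.update_apply]
@[simp] theorem setN_narr : (s.setN x k).narr = s.narr := rfl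
@[simp] theorem setN_fvar : (s.setN x k).fvar = s.fvar := rfl
@[simp] theorem setN_farr : (s.setN x k).farr = s.farr := rfl
@[simp] theorem setNA_nvar : (s.setNA a i k).nvar = s.nvar := rfl
@[simp] theorem setNA_narr :
    (s.setNA a i k).narr b j = if b = a ∧ j = i then k else s.narr b j := by
  by_cases h : b = a
  · subst h; simp [setNA, Function.update_apply]
  · simp [setNA, h]
@[simp] theorem setNA_fvar : (s.setNA a i k).fvar = s.fvar := rfl
@[simp] theorem setNA_farr : (s.setNA a i k).farr = s.farr := rfl
@[simp] theorem setF_nvar : (s.setF u v).nvar = s.nvar := rfl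
@[simp] theorem setF_narr : (s.setF u v).narr = s.narr := rfl
@[simp] theorem setF_fvar : (s.setF u v).fvar w = if w = u then v else s.fvar w := by
  simp [setF, Function.update_apply]
@[simp] theorem setF_farr : (s.setF u v).farr = s.farr := rfl
@[simp] theorem setFA_nvar : (s.setFA a i v).nvar = s.nvar := rfl
@[simp] theorem setFA_narr : (s.setFA a i v).narr = s.narr := rfl
@[simp] theorem setFA_fvar : (s.setFA a i v).fvar = s.fvar := rfl
@[simp] theorem setFA_farr :
    (s.setFA a i v).farr b j = if b = a ∧ j = i then v else s.farr b j := by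
  by_cases h : b = a
  · subst h; simp [setFA, Function.update_apply]
  · simp [setFA, h]

end Simp

end Memory

/-- The input arrays, the table in array `6`, the field constants and the variables below `k` are
the same. -/
structure SameBelow (k : ℕ) (s s' : Memory F) : Prop where
  nvar : ∀ x < k, s'.nvar x = s.nvar x
  narr : ∀ a < 7, s'.narr a = s.narr a
  fvar : ∀ u < 3, s'.fvar u = s.fvar u
  farr : s'.farr 0 = s.farr 0

namespace SameBelow

variable {k k' : ℕ} {s s' s'' : Memory F}

theorem refl (k : ℕ) (s : Memory F) : SameBelow k s s :=
  ⟨fun _ _ => rfl, fun _ _ => rfl, fun _ _ => rfl, rfl⟩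

theorem trans (h : SameBelow k s s') (h' : SameBelow k s' s'') : SameBelow k s s'' where
  nvar x hx := (h'.nvar x hx).trans (h.nvar x hx)
  narr a ha := (h'.narr a ha).trans (h.narr a ha)
  fvar u hu := (h'.fvar u hu).trans (h.fvar u hu)
  farr := h'.farr.trans h.farr

theorem mono (h : SameBelow k s s') (hk : k' ≤ k) : SameBelow k' s s' where
  nvar x hx := h.nvar x (by omega)
  narr := h.narr
  fvar := h.fvar
  farr := h.farr

theorem symm (h : SameBelow k s s') : SameBelow k s' s where
  nvar x hx := (h.nvar x hx).symm
  narr a ha := (h.narr a ha).symm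
  fvar u hu := (h.fvar u hu).symm
  farr := h.farr.symm

/-- Makes frame conditions a matter of rewriting: a write outside the protected part can be erased
from the final memory. Nested routines use ever larger variable numbers, so each protects the
variables of the routines around it. -/
theorem iff_right (h : SameBelow k s' s'') : SameBelow k s s'' ↔ SameBelow k s s' :=
  ⟨fun h' => h'.trans h.symm, fun h' => h'.trans h⟩

@[simp] theorem setN {x : ℕ} (v : ℕ) (hx : k ≤ x) :
    SameBelow k s (s'.setN x v) ↔ SameBelow k s s' :=
  iff_right ⟨fun y hy => by rw [Memory.setN_nvar, if_neg (by omega)], fun _ _ => rfl,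
    fun _ _ => rfl, rfl⟩

@[simp] theorem setNA {a : ℕ} (i : List ℕ) (v : ℕ) (ha : 7 ≤ a) :
    SameBelow k s (s'.setNA a i v) ↔ SameBelow k s s' :=
  iff_right ⟨fun _ _ => rfl,
    fun b hb => by funext j; rw [Memory.setNA_narr, if_neg (by omega)], fun _ _ => rfl, rfl⟩

@[simp] theorem setF {u : ℕ} (v : F) (hu : 3 ≤ u) :
    SameBelow k s (s'.setF u v) ↔ SameBelow k s s' :=
  iff_right ⟨fun _ _ => rfl, fun _ _ => rfl,
    fun w hw => by rw [Memory.setF_fvar, if_neg (by omega)], rfl⟩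

@[simp] theorem setFA {a : ℕ} (i : List ℕ) (v : F) (ha : 1 ≤ a) :
    SameBelow k s (s'.setFA a i v) ↔ SameBelow k s s' :=
  iff_right ⟨fun _ _ => rfl, fun _ _ => rfl, fun _ _ => rfl,
    by funext j; rw [Memory.setFA_farr, if_neg (by omega)]⟩

end SameBelow

variable [Field F]

namespace Instr

variable (s : Memory F) (x y z k a u v w : ℕ) (idx : List ℕ)

@[simp] theorem apply_const : (Instr.const x k).apply s = s.setN x k := rfl
@[simp] theorem apply_add : (Instr.add x y z).apply s = s.setN x (s.nvar y + s.nvar z) := rfl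
@[simp] theorem apply_sub : (Instr.sub x y z).apply s = s.setN x (s.nvar y - s.nvar z) := rfl
@[simp] theorem apply_load :
    (Instr.load x a idx).apply s = s.setN x (s.narr a (idx.map s.nvar)) := rfl
@[simp] theorem apply_store :
    (Instr.store a idx x).apply s = s.setNA a (idx.map s.nvar) (s.nvar x) := rfl
@[simp] theorem apply_fzero : (Instr.fzero u).apply s = s.setF u 0 := rfl
@[simp] theorem apply_fone : (Instr.fone u).apply s = s.setF u 1 := rfl
@[simp] theorem apply_fadd : (Instr.fadd u v w).apply s = s.setF u (s.fvar v + s.fvar w) := rfl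
@[simp] theorem apply_fsub : (Instr.fsub u v w).apply s = s.setF u (s.fvar v - s.fvar w) := rfl
@[simp] theorem apply_fmul : (Instr.fmul u v w).apply s = s.setF u (s.fvar v * s.fvar w) := rfl
@[simp] theorem apply_fdiv : (Instr.fdiv u v w).apply s = s.setF u (s.fvar v / s.fvar w) := rfl
@[simp] theorem apply_fload :
    (Instr.fload u a idx).apply s = s.setF u (s.farr a (idx.map s.nvar)) := rfl
@[simp] theorem apply_fstore :
    (Instr.fstore a idx u).apply s = s.setFA a (idx.map s.nvar) (s.fvar u) := rfl

end Instr

/-- The program halts within `T` steps in a memory with property `Q`. -/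
def Run (c : Prog) (s : Memory F) (T : ℕ) (Q : Memory F → Prop) : Prop :=
  ∃ t s', Exec c s t s' ∧ t ≤ T ∧ Q s'

theorem Run.mono {c : Prog} {s : Memory F} {T T' : ℕ} {Q Q' : Memory F → Prop}
    (h : Run c s T Q) (hT : T ≤ T') (hQ : ∀ s, Q s → Q' s) : Run c s T' Q' := by
  obtain ⟨t, s', he, ht, hq⟩ := h
  exact ⟨t, s', he, ht.trans hT, hQ _ hq⟩

theorem Run.seq {c₁ c₂ : Prog} {s : Memory F} {T₁ T₂ : ℕ} {Q : Memory F → Prop}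
    (h : Run c₁ s T₁ fun s' => Run c₂ s' T₂ Q) : Run (.seq c₁ c₂) s (T₁ + T₂) Q := by
  obtain ⟨t, s', he, ht, t', s'', he', ht', hq⟩ := h
  exact ⟨_, _, .seq he he', by omega, hq⟩

theorem Run.ite {b : Test} {c₁ c₂ : Prog} {s : Memory F} {T : ℕ} {Q : Memory F → Prop}
    (h₁ : b.Holds s → Run c₁ s T Q) (h₂ : ¬ b.Holds s → Run c₂ s T Q) :
    Run (.ite b c₁ c₂) s (T + 1) Q := by
  by_cases hb : b.Holds s
  · obtain ⟨t, s', he, ht, hq⟩ := h₁ hb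
    exact ⟨_, _, .ite_true hb he, by omega, hq⟩
  · obtain ⟨t, s', he, ht, hq⟩ := h₂ hb
    exact ⟨_, _, .ite_false hb he, by omega, hq⟩

/-- A sequence of instructions followed by a program. -/
def pre (is : List Instr) (c : Prog) : Prog :=
  is.foldr (fun i c => .seq (.instr i) c) c

/-- An instruction without a relevant effect. -/
def skip : Prog := .instr (.const 99 0)

theorem Run.skip {s : Memory F} {T : ℕ} {Q : Memory F → Prop} (h : Q (s.setN 99 0))
    (hT : 1 ≤ T := by omega) : Run skip s T Q :=
  ⟨1, _, .instr _ _, hT, h⟩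

theorem Run.pre {is : List Instr} {c : Prog} {s : Memory F} {T : ℕ} {Q : Memory F → Prop}
    (h : Run c (is.foldl (fun s i => i.apply s) s) T Q) :
    Run (pre is c) s (is.length + T) Q := by
  induction is generalizing s with
  | nil => simpa [PolyCalc.pre] using h
  | cons i is ih =>
    obtain ⟨t, s', he, ht, hq⟩ := ih h
    exact ⟨1 + t, s', .seq (.instr _ _) he, by simp; omega, hq⟩

/-- A sequence of instructions. -/
def block (is : List Instr) : Prog := pre is skip

theorem Run.block {is : List Instr} {s : Memory F} {T : ℕ} {Q : Memory F → Prop}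
    (h : Q ((is.foldl (fun s i => i.apply s) s).setN 99 0)) (hT : is.length + 1 ≤ T) :
    Run (block is) s T Q :=
  (Run.pre (Run.skip h le_rfl)).mono hT fun _ h => h

/-- The loop in which variable `x` runs through the numbers smaller than variable `y`.  Variable
`3` has to be `1`. -/
def forLoop (x y : ℕ) (c : Prog) : Prog :=
  .seq (.instr (.const x 0)) (.loop (.lt x y) (.seq c (.instr (.add x x 3))))

/-- A round costs the body, one test and one increment; the initialisation and the last test add 2.
The increment adds variable `3`, so the body has to leave this variable equal to 1 and the counter
unchanged. -/
theorem Run.forLoop {x y : ℕ} {c : Prog} {s : Memory F} {N T : ℕ} (I : ℕ → Memory F → Prop)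
    (h0 : I 0 (s.setN x 0)) (hy : ∀ k t, I k t → t.nvar x = k ∧ t.nvar y = N)
    (step : ∀ k t, k < N → I k t →
      Run c t T fun t' => t'.nvar x = k ∧ t'.nvar 3 = 1 ∧ I (k + 1) (t'.setN x (k + 1))) :
    Run (forLoop x y c) s (N * (T + 2) + 2) (I N) := by
  have key : ∀ j k t, k + j = N → I k t →
      Run (.loop (.lt x y) (.seq c (.instr (.add x x 3)))) t (j * (T + 2) + 1) (I N) := by
    intro j
    induction j with
    | zero =>
      intro k t hk hI
      obtain ⟨h1, h2⟩ := hy k t hI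
      exact ⟨1, t, .loop_done (by simp only [Test.Holds]; omega), by omega,
        by rwa [show N = k by omega]⟩
    | succ j ih =>
      intro k t hk hI
      obtain ⟨h1, h2⟩ := hy k t hI
      obtain ⟨t1, s1, he1, ht1, hx, h3, hI1⟩ := step k t (by omega) hI
      have e : (Instr.add x x 3).apply s1 = s1.setN x (k + 1) := by simp [hx, h3]
      obtain ⟨t2, s2, he2, ht2, hq⟩ := ih (k + 1) (s1.setN x (k + 1)) (by omega) hI1
      refine ⟨_, _, .loop_step (by simp only [Test.Holds]; omega)
        (.seq he1 (.instr _ _)) (e ▸ he2), ?_, hq⟩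
      rw [Nat.succ_mul]
      omega
  obtain ⟨t, s', he, ht, hq⟩ := key N 0 (s.setN x 0) (by omega) h0
  exact ⟨1 + t, s', .seq (.instr _ _) he, by omega, hq⟩

/-- The constants that the program keeps in memory. -/
structure Consts (n d : ℕ) (s : Memory F) : Prop where
  one : s.nvar 3 = 1
  base_eq : s.nvar 4 = base n
  words : s.nvar 5 = base n ^ d
  low : s.nvar 6 = lowCount n d
  low₂ : s.nvar 7 = lowCount₂ n d
  letters : s.nvar 8 = 2 * n
  zero' : s.fvar 0 = 0
  one' : s.fvar 1 = 1
  neg_one' : s.fvar 2 = -1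
  vars : s.nvar 0 = n
  table : ∀ k < d, ∀ i < base n, s.narr 6 [k, i] = i * base n ^ k

theorem Consts.of_same {n d k : ℕ} {s s' : Memory F} (h : Consts n d s) (hs : SameBelow k s s')
    (hk : 9 ≤ k := by omega) : Consts n d s' where
  one := (hs.nvar _ (by omega)).trans h.one
  base_eq := (hs.nvar _ (by omega)).trans h.base_eq
  words := (hs.nvar _ (by omega)).trans h.words
  low := (hs.nvar _ (by omega)).trans h.low
  low₂ := (hs.nvar _ (by omega)).trans h.low₂
  letters := (hs.nvar _ (by omega)).trans h.letters
  zero' := (hs.fvar _ (by omega)).trans h.zero'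
  one' := (hs.fvar _ (by omega)).trans h.one'
  neg_one' := (hs.fvar _ (by omega)).trans h.neg_one'
  vars := (hs.nvar _ (by omega)).trans h.vars
  table k hk i hi := by rw [hs.narr 6 (by omega)]; exact h.table k hk i hi

end Rules

/-! ## Echelon bases -/

section Echelon

variable {F : Type*} [Field F]

/-- Every nonzero row `b c` has its last nonzero entry at position `c`. -/
def IsEchelon (N : ℕ) (b : ℕ → ℕ → F) : Prop :=
  ∀ c, b c ≠ 0 → c < N ∧ b c c ≠ 0 ∧ ∀ t, c < t → b c t = 0

theorem exists_sum_of_mem_span_range {b : ℕ → ℕ → F} {f : ℕ → F}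
    (hf : f ∈ Submodule.span F (Set.range b)) :
    ∃ (A : Finset ℕ) (x : ℕ → F), (∀ c ∈ A, b c ≠ 0 ∧ x c ≠ 0) ∧ f = ∑ c ∈ A, x c • b c := by
  classical
  obtain ⟨x, rfl⟩ := Finsupp.mem_span_range_iff_exists_finsupp.1 hf
  refine ⟨x.support.filter fun c => b c ≠ 0, x, fun c hc => ?_, ?_⟩
  · rw [Finset.mem_filter, Finsupp.mem_support_iff] at hc
    exact ⟨hc.2, hc.1⟩
  · rw [Finsupp.sum, Finset.sum_filter]
    refine Finset.sum_congr rfl fun c _ => ?_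
    split_ifs with h
    · rfl
    · rw [not_not.1 h, smul_zero]

/-- At the largest index used, all other rows have already ended, so nothing can cancel its pivot.
Both the test for membership in the span and the description of vectors with small support rest on
this. -/
theorem IsEchelon.sum_apply_max {N : ℕ} {b : ℕ → ℕ → F} (hb : IsEchelon N b) {A : Finset ℕ}
    {x : ℕ → F} (hA : ∀ c ∈ A, b c ≠ 0 ∧ x c ≠ 0) (hne : A.Nonempty) :
    (∑ c ∈ A, x c • b c) (A.max' hne) ≠ 0 ∧
      ∀ t, A.max' hne < t → (∑ c ∈ A, x c • b c) t = 0 := by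
  have hmem := A.max'_mem hne
  constructor
  · rw [Finset.sum_apply, Finset.sum_eq_single_of_mem _ hmem]
    · obtain ⟨h1, h2⟩ := hA _ hmem
      rw [Pi.smul_apply, smul_eq_mul]
      exact mul_ne_zero h2 (hb _ h1).2.1
    · intro c hc hne'
      have hlt : c < A.max' hne := lt_of_le_of_ne (A.le_max' c hc) hne'
      rw [Pi.smul_apply, (hb c (hA c hc).1).2.2 _ hlt, smul_zero]
  · intro t ht
    rw [Finset.sum_apply, Finset.sum_eq_zero]
    intro c hc
    rw [Pi.smul_apply, (hb c (hA c hc).1).2.2 _ ((A.le_max' c hc).trans_lt ht), smul_zero]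

/-- A vector whose last nonzero entry is not a pivot is not in the span. -/
theorem IsEchelon.notMem_span {N : ℕ} {b : ℕ → ℕ → F} (hb : IsEchelon N b) {f : ℕ → F} {c : ℕ}
    (hc : f c ≠ 0) (hlast : ∀ t, c < t → f t = 0) (hbc : b c = 0) :
    f ∉ Submodule.span F (Set.range b) := by
  intro hf
  obtain ⟨A, x, hA, rfl⟩ := exists_sum_of_mem_span_range hf
  have hne : A.Nonempty := by
    rw [Finset.nonempty_iff_ne_empty]; rintro rfl; simp at hc
  obtain ⟨h1, h2⟩ := hb.sum_apply_max hA hne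
  rcases lt_trichotomy (A.max' hne) c with h | h | h
  · exact hc (h2 _ h)
  · exact (hA _ (A.max'_mem hne)).1 (h ▸ hbc)
  · exact h1 (hlast _ h)

/-- The vectors of the span with small support are spanned by the rows with small support. -/
theorem IsEchelon.exists_sum_low {N L : ℕ} {b : ℕ → ℕ → F} (hb : IsEchelon N b) {f : ℕ → F}
    (hf : f ∈ Submodule.span F (Set.range b)) (hlow : ∀ c, L ≤ c → f c = 0) :
    ∃ (A : Finset ℕ) (x : ℕ → F), (∀ c ∈ A, c < L ∧ b c ≠ 0) ∧ f = ∑ c ∈ A, x c • b c := by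
  obtain ⟨A, x, hA, rfl⟩ := exists_sum_of_mem_span_range hf
  refine ⟨A, x, fun c hc => ⟨?_, (hA c hc).1⟩, rfl⟩
  have hne : A.Nonempty := ⟨c, hc⟩
  refine (A.le_max' c hc).trans_lt ?_
  by_contra hlt
  exact (hb.sum_apply_max hA hne).1 (hlow _ (by omega))

theorem IsEchelon.update {N : ℕ} {b : ℕ → ℕ → F} (hb : IsEchelon N b) {f : ℕ → F} {c : ℕ}
    (hcN : c < N) (hc : f c ≠ 0) (hlast : ∀ t, c < t → f t = 0) :
    IsEchelon N (Function.update b c f) := by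
  intro e he
  by_cases h : e = c
  · subst h; simpa using ⟨hcN, hc, hlast⟩
  · rw [Function.update_of_ne h] at he ⊢
    exact hb e he

theorem span_range_update {b : ℕ → ℕ → F} {c : ℕ} (hbc : b c = 0) (f : ℕ → F) :
    Submodule.span F (Set.range (Function.update b c f)) =
      Submodule.span F (Set.range b) ⊔ Submodule.span F {f} := by
  apply le_antisymm
  · rw [Submodule.span_le]
    rintro _ ⟨e, rfl⟩
    by_cases h : e = c
    · subst h
      rw [Function.update_self]
      exact Submodule.mem_sup_right (Submodule.mem_span_singleton_self f)
    · rw [Function.update_of_ne h]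
      exact Submodule.mem_sup_left (Submodule.subset_span ⟨e, rfl⟩)
  · refine sup_le ?_ ?_
    · rw [Submodule.span_le]
      rintro _ ⟨e, rfl⟩
      by_cases h : e = c
      · subst h; rw [hbc]; exact Submodule.zero_mem _
      · exact Submodule.subset_span ⟨e, Function.update_of_ne h _ _⟩
    · rw [Submodule.span_singleton_le_iff_mem]
      exact Submodule.subset_span ⟨c, Function.update_self _ _ _⟩

theorem sup_span_singleton_congr {W : Submodule F (ℕ → F)} {f g : ℕ → F} (h : g - f ∈ W) :
    W ⊔ Submodule.span F {f} = W ⊔ Submodule.span F {g} := by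
  apply le_antisymm <;> refine sup_le le_sup_left ?_ <;>
    rw [Submodule.span_singleton_le_iff_mem]
  · rw [show f = -(g - f) + g by abel]
    exact Submodule.add_mem _ (Submodule.mem_sup_left (W.neg_mem h))
      (Submodule.mem_sup_right (Submodule.mem_span_singleton_self g))
  · rw [show g = (g - f) + f by abel]
    exact Submodule.add_mem _ (Submodule.mem_sup_left h)
      (Submodule.mem_sup_right (Submodule.mem_span_singleton_self f))

end Echelon

/-! ### Gaussian elimination, one vector at a time -/

section Insert

variable {F : Type*} [Field F] {n d : ℕ}

/-- The current vector, in field array `1`. -/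
def HoldsVec (v : ℕ → F) (s : Memory F) : Prop := ∀ c, s.farr 1 [c] = v c

/-- The current echelon basis, in field array `2`, with the queue of its pivots below `lowCount`,
in array `7` and variable `60`. -/
structure HoldsBasis (n d : ℕ) (b : ℕ → ℕ → F) (Q : List ℕ) (s : Memory F) : Prop where
  arr : ∀ c t, s.farr 2 [c, t] = b c t
  ech : IsEchelon (base n ^ d) b
  len : s.nvar 60 = Q.length
  queue : ∀ r c, Q[r]? = some c → s.narr 7 [r] = c
  nodup : Q.Nodup
  mem : ∀ c, c ∈ Q ↔ c < lowCount n d ∧ b c ≠ 0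

theorem HoldsBasis.congr {b : ℕ → ℕ → F} {Q : List ℕ} {s s' : Memory F}
    (h : HoldsBasis n d b Q s) (h2 : ∀ c t, s'.farr 2 [c, t] = s.farr 2 [c, t])
    (h60 : s'.nvar 60 = s.nvar 60)
    (h7 : ∀ r, s'.narr 7 [r] = s.narr 7 [r]) : HoldsBasis n d b Q s' where
  arr c t := (h2 c t).trans (h.arr c t)
  ech := h.ech
  len := h60.trans h.len
  queue r c hr := (h7 r).trans (h.queue r c hr)
  nodup := h.nodup
  mem := h.mem

/-- Subtract a multiple of row `63` of the basis from the current vector. -/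
def reduceLoop : Prog :=
  forLoop 64 5 (block [.fload 13 1 [64], .fload 14 2 [63, 64], .fmul 14 12 14, .fsub 13 13 14,
    .fstore 1 [64] 13])

theorem run_reduceLoop {s : Memory F} (hs : Consts n d s) (c : ℕ) (hc : s.nvar 63 = c) :
    Run reduceLoop s (base n ^ d * 8 + 2) fun s' =>
      SameBelow 64 s s' ∧ s'.narr = s.narr ∧ (∀ i, s'.farr 2 i = s.farr 2 i) ∧
      ∀ t, s'.farr 1 [t] = if t < base n ^ d then s.farr 1 [t] - s.fvar 12 * s.farr 2 [c, t]
        else s.farr 1 [t] := by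
  refine (Run.forLoop (N := base n ^ d) (T := 6) (I := fun k s' =>
    s'.nvar 64 = k ∧ SameBelow 64 s s' ∧ s'.narr = s.narr ∧ (∀ i, s'.farr 2 i = s.farr 2 i) ∧
      s'.fvar 12 = s.fvar 12 ∧
      ∀ t, s'.farr 1 [t] = if t < k then s.farr 1 [t] - s.fvar 12 * s.farr 2 [c, t]
        else s.farr 1 [t]) ?_ ?_ ?_).mono le_rfl ?_
  · simp [SameBelow.refl]
  · rintro k t ⟨h1, h2, -⟩
    exact ⟨h1, (h2.nvar 5 (by omega)).trans hs.words⟩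
  · rintro k t hk ⟨h1, h2, h3, h4, h5, h6⟩
    have h63 : t.nvar 63 = c := (h2.nvar 63 (by omega)).trans hc
    have hone := (hs.of_same h2).one
    refine Run.block ?_ (by simp)
    simp [h1, h2, h3, h4, h5, h6, h63, hone]
    intro e
    rcases lt_trichotomy e k with h | rfl | h
    · simp [h, h.ne, h.le]
    · simp
    · simp [h.ne', show ¬ e < k by omega, show ¬ e ≤ k by omega]
  · rintro s' ⟨h1, h2, h3, h4, h5, h6⟩
    exact ⟨h2, h3, h4, h6⟩

/-- Move the current vector to row `63` of the basis. -/
def moveLoop : Prog :=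
  forLoop 64 5 (block [.fload 13 1 [64], .fstore 2 [63, 64] 13, .fstore 1 [64] 0])

theorem run_moveLoop {s : Memory F} (hs : Consts n d s) (c : ℕ) (hc : s.nvar 63 = c) :
    Run moveLoop s (base n ^ d * 6 + 2) fun s' =>
      SameBelow 64 s s' ∧ s'.narr = s.narr ∧
      (∀ e t, s'.farr 2 [e, t] = if e = c ∧ t < base n ^ d then s.farr 1 [t]
        else s.farr 2 [e, t]) ∧
      ∀ t, s'.farr 1 [t] = if t < base n ^ d then 0 else s.farr 1 [t] := by
  refine (Run.forLoop (N := base n ^ d) (T := 4) (I := fun k s' =>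
    s'.nvar 64 = k ∧ SameBelow 64 s s' ∧ s'.narr = s.narr ∧
      (∀ e t, s'.farr 2 [e, t] = if e = c ∧ t < k then s.farr 1 [t] else s.farr 2 [e, t]) ∧
      ∀ t, s'.farr 1 [t] = if t < k then 0 else s.farr 1 [t]) ?_ ?_ ?_).mono le_rfl ?_
  · simp [SameBelow.refl]
  · rintro k t ⟨h1, h2, -⟩
    exact ⟨h1, (h2.nvar 5 (by omega)).trans hs.words⟩
  · rintro k t hk ⟨h1, h2, h3, h4, h5⟩
    have h63 : t.nvar 63 = c := (h2.nvar 63 (by omega)).trans hc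
    have hone := (hs.of_same h2).one
    have hzero := (hs.of_same h2).zero'
    refine Run.block ?_ (by simp)
    simp [h1, h2, h3, h4, h5, h63, hone, hzero]
    constructor
    · intro e t
      rcases lt_trichotomy t k with h | rfl | h
      · simp [h, h.ne, h.le]
      · simp
      · simp [h.ne', show ¬ t < k by omega, show ¬ t ≤ k by omega]
    · intro t
      rcases lt_trichotomy t k with h | rfl | h
      · simp [h, h.ne, h.le]
      · simp
      · simp [h.ne', show ¬ t < k by omega, show ¬ t ≤ k by omega]
  · rintro s' ⟨h1, h2, h3, h4, h5⟩
    exact ⟨h2, h3, h4, h5⟩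

/-- Insert the current vector into the basis and make it zero.  Variable `61` becomes `1` if the
vector is not in the span of the basis. -/
def insertVec : Prog :=
  forLoop 62 5 (pre [.sub 63 5 62, .sub 63 63 3, .fload 10 1 [63]]
    (.ite (.isZero 10) skip (pre [.fload 11 2 [63, 63]]
      (.ite (.isZero 11)
        (.seq moveLoop (pre [.const 61 1]
          (.ite (.lt 63 6) (block [.store 7 [60] 63, .add 60 60 3]) skip)))
        (pre [.fdiv 12 10 11] reduceLoop)))))

/-- The effect of the insertion of `v` into a basis `b`: the new basis. -/
structure Extends (n d : ℕ) (b : ℕ → ℕ → F) (Q : List ℕ) (v : ℕ → F) (b' : ℕ → ℕ → F)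
    (Q' : List ℕ) : Prop where
  span : Submodule.span F (Set.range b') =
    Submodule.span F (Set.range b) ⊔ Submodule.span F {v}
  queue : Q <+: Q'
  rows : ∀ c, b c ≠ 0 → b' c = b c

/-- Positions are cleared from the top down. As long as pivots are available, the remainder `u`
stays congruent to `v` modulo the old span. If everything is cleared, `v` was in the span. If a
nonzero entry meets a position without pivot, then `u`, and hence `v`, is outside the span; `u`
becomes the new row, and the remaining rounds run idly on the zero vector. -/
theorem run_insertVec {s : Memory F} (hs : Consts n d s) {b : ℕ → ℕ → F} {Q : List ℕ}
    (hb : HoldsBasis n d b Q s) {v : ℕ → F} (hv : HoldsVec v s)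
    (hN : ∀ c, base n ^ d ≤ c → v c = 0) :
    Run insertVec s (base n ^ d * (base n ^ d * 8 + 20) + 2) fun s' =>
      SameBelow 60 s s' ∧ HoldsVec (0 : ℕ → F) s' ∧ ∃ b' Q', HoldsBasis n d b' Q' s' ∧
        Extends n d b Q v b' Q' ∧
        (v ∈ Submodule.span F (Set.range b) ∧ s'.nvar 61 = s.nvar 61 ∨
          v ∉ Submodule.span F (Set.range b) ∧ s'.nvar 61 = 1) := by
  set W := Submodule.span F (Set.range b) with hW
  refine (Run.forLoop (N := base n ^ d) (T := base n ^ d * 8 + 18) (I := fun k s' =>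
    s'.nvar 62 = k ∧ SameBelow 60 s s' ∧ ∃ u, HoldsVec u s' ∧
      (∀ c, base n ^ d - k ≤ c → u c = 0) ∧
      (HoldsBasis n d b Q s' ∧ s'.nvar 61 = s.nvar 61 ∧ v - u ∈ W ∨
        u = 0 ∧ ∃ b' Q', HoldsBasis n d b' Q' s' ∧ Extends n d b Q v b' Q' ∧ v ∉ W ∧
          s'.nvar 61 = 1)) ?_ ?_ ?_).mono le_rfl ?_
  · refine ⟨by simp, by simp [SameBelow.refl], v, hv, by simpa using hN, Or.inl ⟨?_, by simp,
      by simp⟩⟩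
    exact hb.congr (by simp) (by simp) (by simp)
  · rintro k t ⟨h1, h2, -⟩
    exact ⟨h1, (h2.nvar 5 (by omega)).trans hs.words⟩
  · rintro k t hk ⟨h1, h2, u, hu, hu0, hcase⟩
    have ht := hs.of_same h2
    -- The highest position not yet cleared, since the loop counter runs upwards.
    set c := base n ^ d - k - 1 with hc
    have hcN : c < base n ^ d := by omega
    refine (Run.pre (T := base n ^ d * 8 + 15) ?_).mono (by simp; omega) fun _ h => h
    simp only [List.foldl_cons, List.foldl_nil, Instr.apply_sub, Instr.apply_fload]
    set t1 := ((t.setN 63 (t.nvar 5 - t.nvar 62)).setN 63 _).setF 10 _ with ht1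
    have hs1 : SameBelow 60 s t1 := by simp [ht1, h2]
    have c1 := hs.of_same hs1
    have n62 : t1.nvar 62 = k := by simp [ht1, h1]
    have n63 : t1.nvar 63 = c := by simp [ht1, ht.words, ht.one, h1, hc]
    have n60 : t1.nvar 60 = t.nvar 60 := by simp [ht1]
    have n61 : t1.nvar 61 = t.nvar 61 := by simp [ht1]
    have a1 : t1.narr = t.narr := by simp [ht1]
    have a2 : t1.farr = t.farr := by simp [ht1]
    have f10 : t1.fvar 10 = u c := by simp [ht1, ht.words, ht.one, h1, hc, hu _]
    clear_value t1
    have hu1 : HoldsVec u t1 := fun e => by rw [a2]; exact hu e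
    have hu0' : ∀ e, c < e → u e = 0 := fun e he => hu0 e (by omega)
    refine Run.mono (Run.ite (T := base n ^ d * 8 + 14) ?_ ?_) (by omega) fun _ h => h
    · intro hz
      have hz : u c = 0 := by simpa [Test.Holds, f10] using hz
      refine Run.skip ?_
      refine ⟨by simp [n62], by simp [c1.one], by simp, by simp [hs1], u, fun e => by
        simpa using hu1 e, ?_, ?_⟩
      · intro e he
        rcases Nat.lt_or_ge c e with h | h
        · exact hu0' e h
        · rwa [show e = c by omega]
      · rcases hcase with ⟨hB, h61, hm⟩ | ⟨rfl, b', Q', hB, hE, hm, h61⟩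
        · exact Or.inl ⟨hB.congr (by simp [a2]) (by simp [n60]) (by simp [a1]),
            by simp [n61, h61], hm⟩
        · exact Or.inr ⟨rfl, b', Q', hB.congr (by simp [a2]) (by simp [n60]) (by simp [a1]), hE,
            hm, by simp [n61, h61]⟩
    · intro hnz
      have hnz : u c ≠ 0 := by simpa [Test.Holds, f10] using hnz
      -- A nonzero entry rules out that the vector has already been moved into the basis.
      obtain ⟨hB, h61, hm⟩ : HoldsBasis n d b Q t ∧ t.nvar 61 = s.nvar 61 ∧ v - u ∈ W := by
        rcases hcase with h | ⟨rfl, -⟩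
        · exact h
        · simp at hnz
      refine (Run.pre (T := base n ^ d * 8 + 13) ?_).mono (by simp; omega) fun _ h => h
      simp only [List.foldl_cons, List.foldl_nil, Instr.apply_fload, List.map_cons, List.map_nil,
        n63, a2, hB.arr]
      set t2 := t1.setF 11 (b c c) with ht2
      have hs2 : SameBelow 60 s t2 := by simp [ht2, hs1]
      have c2 := hs.of_same hs2
      have m62 : t2.nvar 62 = k := by simp [ht2, n62]
      have m63 : t2.nvar 63 = c := by simp [ht2, n63]
      have m60 : t2.nvar 60 = t.nvar 60 := by simp [ht2, n60]
      have m61 : t2.nvar 61 = s.nvar 61 := by simp [ht2, n61, h61]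
      have e1 : t2.narr = t.narr := by simp [ht2, a1]
      have e2 : t2.farr = t.farr := by simp [ht2, a2]
      have g10 : t2.fvar 10 = u c := by simp [ht2, f10]
      have g11 : t2.fvar 11 = b c c := by simp [ht2]
      clear_value t2
      refine Run.mono (Run.ite (T := base n ^ d * 8 + 12) ?_ ?_) (by omega) fun _ h => h
      · intro hz
        have hz : b c c = 0 := by simpa [Test.Holds, g11] using hz
        -- A nonzero row has a nonzero entry at its own index, so testing this one entry tells
        -- whether the row is empty.
        have hbc : b c = 0 := by
          by_contra h
          exact (hB.ech c h).2.1 hz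
        have huW : u ∉ W := hB.ech.notMem_span hnz hu0' hbc
        have hvW : v ∉ W := fun h => huW (by
          have := W.sub_mem h hm
          simpa using this)
        refine (Run.seq (T₂ := 6) ((run_moveLoop c2 c m63).mono le_rfl ?_)).mono (by omega)
          fun _ h => h
        rintro t3 ⟨q1, q2, q3, q4⟩
        have hs3 := hs2.trans (q1.mono (by omega))
        have c3 := hs.of_same hs3
        have l62 : t3.nvar 62 = k := (q1.nvar 62 (by omega)).trans m62
        have l63 : t3.nvar 63 = c := (q1.nvar 63 (by omega)).trans m63
        have l60 : t3.nvar 60 = Q.length :=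
          ((q1.nvar 60 (by omega)).trans m60).trans hB.len
        have hv3 : ∀ e, t3.farr 1 [e] = 0 := by
          intro e
          rw [q4, e2, hu e]
          split_ifs with h
          · rfl
          · exact hu0' e (by omega)
        have hb3 : ∀ e x, t3.farr 2 [e, x] = Function.update b c u e x := by
          intro e x
          rw [q3, e2, hu x, hB.arr e x]
          by_cases he : e = c
          · subst he
            rw [Function.update_self]
            split_ifs with h
            · rfl
            · rw [hbc, hu0' x (by omega)]; rfl
          · rw [Function.update_of_ne he, if_neg (by tauto)]
        have hE : Extends n d b Q v (Function.update b c u) Q :=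
          { span := by
              rw [span_range_update hbc, sup_span_singleton_congr hm]
            queue := List.prefix_refl _
            rows := fun e he => Function.update_of_ne (by rintro rfl; exact he hbc) _ _ }
        have hech := hB.ech.update hcN hnz hu0'
        have hune : u ≠ 0 := by rintro rfl; simp at hnz
        refine (Run.pre (T := 4) ?_).mono (by simp) fun _ h => h
        simp only [List.foldl_cons, List.foldl_nil, Instr.apply_const]
        refine Run.ite (T := 3) ?_ ?_
        · intro hlt
          have hlt : c < lowCount n d := by simpa [Test.Holds, l63, c3.low] using hlt
          refine Run.block ?_ (by simp)
          refine ⟨by simp [l62], by simp [c3.one], by simp, by simp [hs3], 0, fun e => by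
            simpa using hv3 e, by simp, Or.inr ⟨rfl, Function.update b c u, Q ++ [c], ?_, ?_, hvW,
              by simp⟩⟩
          · refine ⟨by simpa using hb3, hech, by simp [l60, c3.one], ?_, ?_, ?_⟩
            · intro r x hr
              simp only [List.foldl_cons, List.foldl_nil, Instr.apply_store, Instr.apply_add,
                Memory.setN_narr, Memory.setNA_narr, Memory.setN_nvar, List.map_cons,
                List.map_nil, List.cons.injEq, and_true, true_and]
              simp [l60, l63, q2, e1]
              rw [List.getElem?_append] at hr
              split_ifs at hr with h
              · rw [if_neg (by omega)]
                exact hB.queue r x hr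
              · rw [List.getElem?_singleton] at hr
                split_ifs at hr with h'
                rw [if_pos (by omega)]
                exact Option.some.inj hr
            · rw [List.nodup_append]
              refine ⟨hB.nodup, by simp, ?_⟩
              rintro x hx y hy rfl
              rw [List.mem_singleton] at hy
              subst hy
              exact ((hB.mem _).1 hx).2 hbc
            · intro e
              rw [List.mem_append, List.mem_singleton, hB.mem]
              by_cases he : e = c
              · subst he; simp [hlt, hune]
              · simp [he]
          · exact { hE with queue := List.prefix_append _ _ }
        · intro hlt
          have hlt : ¬ c < lowCount n d := by simpa [Test.Holds, l63, c3.low] using hlt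
          refine Run.skip ?_
          refine ⟨by simp [l62], by simp [c3.one], by simp, by simp [hs3], 0, fun e => by
            simpa using hv3 e, by simp, Or.inr ⟨rfl, Function.update b c u, Q, ?_, hE, hvW,
              by simp⟩⟩
          refine ⟨by simpa using hb3, hech, by simp [l60], ?_, hB.nodup, ?_⟩
          · intro r x hr
            simpa [q2, e1] using hB.queue r x hr
          · intro e
            rw [hB.mem]
            by_cases he : e = c
            · subst he; simp [hlt]
            · simp [he]
      · intro hz
        have hz : b c c ≠ 0 := by simpa [Test.Holds, g11] using hz
        have hbc : b c ≠ 0 := fun h => hz (by rw [h]; rfl)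
        refine (Run.pre (T := base n ^ d * 8 + 2) ?_).mono (by simp; omega) fun _ h => h
        simp only [List.foldl_cons, List.foldl_nil, Instr.apply_fdiv, g10, g11]
        have c3 : Consts n d (t2.setF 12 (u c / b c c)) :=
          hs.of_same (k := 60) (by simp [hs2])
        refine (run_reduceLoop c3 c (by simp [m63])).mono le_rfl ?_
        rintro t3 ⟨q1, q2, q3, q4⟩
        have hs3 : SameBelow 60 s t3 := SameBelow.trans (by simp [hs2]) (q1.mono (by omega))
        have hval : ∀ e, t3.farr 1 [e] = (u - (u c / b c c) • b c) e := by
          intro e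
          rw [q4]
          simp only [Memory.setF_farr, Memory.setF_fvar, if_true, e2, hu e, hB.arr, Pi.sub_apply,
            Pi.smul_apply, smul_eq_mul]
          split_ifs with h
          · rfl
          · rw [(hB.ech c hbc).2.2 e (by omega), mul_zero, sub_zero]
        refine ⟨?_, (hs.of_same hs3).one, by simp, by simp [hs3], u - (u c / b c c) • b c,
          fun e => by simpa using hval e, ?_, Or.inl ⟨?_, ?_, ?_⟩⟩
        · rw [q1.nvar 62 (by omega)]; simp [m62]
        · intro e he
          rw [Pi.sub_apply, Pi.smul_apply, smul_eq_mul]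
          rcases Nat.lt_or_ge c e with h | h
          · rw [hu0' e h, (hB.ech c hbc).2.2 e h]; simp
          · rw [show e = c by omega, div_mul_cancel₀ _ hz, sub_self]
        · refine hB.congr (fun e x => ?_) ?_ (fun r => ?_)
          · simp [q3, e2]
          · have := q1.nvar 60 (by omega)
            simpa [m60] using this
          · simp [q2, e1]
        · have := q1.nvar 61 (by omega)
          simpa [m61] using this
        · rw [← sub_add]
          exact W.add_mem hm (W.smul_mem _ (Submodule.subset_span ⟨c, rfl⟩))
  · rintro s' ⟨h1, h2, u, hu, hu0, hcase⟩
    have hu0 : u = 0 := funext fun c => hu0 c (by omega)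
    subst hu0
    refine ⟨h2, hu, ?_⟩
    rcases hcase with ⟨hB, h61, hm⟩ | ⟨-, b', Q', hB, hE, hm, h61⟩
    · rw [sub_zero] at hm
      refine ⟨b, Q, hB, ⟨?_, List.prefix_refl _, fun _ _ => rfl⟩, Or.inl ⟨hm, h61⟩⟩
      rw [sup_eq_left.2 ((Submodule.span_singleton_le_iff_mem _ _).2 hm)]
    · exact ⟨b', Q', hB, hE, Or.inr ⟨hm, h61⟩⟩

end Insert

/-! ### Inserting the relations common to all examples -/

section Generate

variable {F : Type*} [Field F] {n d : ℕ}

/-- The time for the insertion of a vector of length `N`. -/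
def insertTime (N : ℕ) : ℕ := N * (N * 8 + 20) + 2

/-- The current vector is zero, and the span of the basis contains `G` and lies in `Top`. -/
def Spans (n d : ℕ) (G : Set (ℕ → F)) (Top : Submodule F (ℕ → F)) (s : Memory F) : Prop :=
  HoldsVec (0 : ℕ → F) s ∧ ∃ b Q, HoldsBasis n d b Q s ∧
    G ⊆ Submodule.span F (Set.range b) ∧ Submodule.span F (Set.range b) ≤ Top

theorem Spans.congr {G : Set (ℕ → F)} {Top : Submodule F (ℕ → F)} {s s' : Memory F}
    (h : Spans n d G Top s) (h2 : s'.farr = s.farr) (h60 : s'.nvar 60 = s.nvar 60)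
    (h7 : s'.narr = s.narr) : Spans n d G Top s' := by
  obtain ⟨hv, b, Q, hb, h⟩ := h
  exact ⟨fun c => by rw [h2]; exact hv c, b, Q,
    hb.congr (fun c t => by rw [h2]) h60 (fun r => by rw [h7]), h⟩

@[simp] theorem spans_setN {G : Set (ℕ → F)} {Top : Submodule F (ℕ → F)} {s : Memory F} {x k : ℕ}
    (hx : x ≠ 60) : Spans n d G Top (s.setN x k) ↔ Spans n d G Top s :=
  ⟨fun h => h.congr rfl (by simp [hx.symm]) rfl, fun h => h.congr rfl (by simp [hx.symm]) rfl⟩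

theorem Spans.mono {G G' : Set (ℕ → F)} {Top : Submodule F (ℕ → F)} {s : Memory F}
    (h : Spans n d G Top s) (hG : G' ⊆ G) : Spans n d G' Top s := by
  obtain ⟨hv, b, Q, hb, h, h'⟩ := h
  exact ⟨hv, b, Q, hb, hG.trans h, h'⟩

/-- A loop whose body adds generators. -/
theorem Run.forLoop_spans {x y : ℕ} {c : Prog} {s : Memory F} {N T : ℕ} {G : Set (ℕ → F)}
    {Top : Submodule F (ℕ → F)} (R : ℕ → Set (ℕ → F)) (E : ℕ → Memory F → Prop)
    (hs : Consts n d s) (hx : 9 ≤ x ∧ x < 60) (hy : y < x) (hN : s.nvar y = N)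
    (hE : ∀ k t i, E k t → E k (t.setN x i)) (h0 : Spans n d G Top s) (hE0 : E 0 s)
    (body : ∀ k t G, k < N → SameBelow x s t → t.nvar x = k → E k t → Spans n d G Top t →
      Run c t T fun t' => SameBelow (x + 1) t t' ∧ Spans n d (G ∪ R k) Top t' ∧ E (k + 1) t') :
    Run (PolyCalc.forLoop x y c) s (N * (T + 2) + 2) fun s' =>
      SameBelow x s s' ∧ Spans n d (G ∪ {f | ∃ k < N, f ∈ R k}) Top s' ∧ E N s' := by
  refine (Run.forLoop (N := N) (T := T) (I := fun k s' => s'.nvar x = k ∧ SameBelow x s s' ∧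
    Spans n d (G ∪ {f | ∃ j < k, f ∈ R j}) Top s' ∧ E k s') ?_ ?_ ?_).mono le_rfl ?_
  · refine ⟨by simp, by simp [SameBelow.refl], ?_, hE _ _ _ hE0⟩
    rw [spans_setN (by omega)]
    exact h0.mono (by simp)
  · rintro k t ⟨h1, h2, -⟩
    exact ⟨h1, (h2.nvar y hy).trans hN⟩
  · rintro k t hk ⟨h1, h2, h3, h4⟩
    refine (body k t _ hk h2 h1 h4 h3).mono le_rfl ?_
    rintro t' ⟨q1, q2, q3⟩
    have hsame := h2.trans (q1.mono (by omega))
    refine ⟨(q1.nvar x (by omega)).trans h1, (hs.of_same hsame hx.1).one, by simp,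
      (SameBelow.setN _ le_rfl).2 hsame, ?_, hE _ _ _ q3⟩
    rw [spans_setN (by omega)]
    refine q2.mono ?_
    rintro f (hf | ⟨j, hj, hf⟩)
    · exact Or.inl (Or.inl hf)
    · rcases Nat.lt_succ_iff_lt_or_eq.1 hj with h | rfl
      · exact Or.inl (Or.inr ⟨j, h, hf⟩)
      · exact Or.inr hf
  · rintro s' ⟨-, h2, h3, h4⟩
    exact ⟨h2, h3, h4⟩

theorem run_insertVec_spans {s : Memory F} (hs : Consts n d s) {G : Set (ℕ → F)}
    {Top : Submodule F (ℕ → F)} {v : ℕ → F} (hv : HoldsVec v s)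
    (hN : ∀ c, base n ^ d ≤ c → v c = 0) (hvT : v ∈ Top)
    (hb : ∃ b Q, HoldsBasis n d b Q s ∧ G ⊆ Submodule.span F (Set.range b) ∧
      Submodule.span F (Set.range b) ≤ Top) :
    Run insertVec s (insertTime (base n ^ d)) fun s' =>
      SameBelow 60 s s' ∧ Spans n d (G ∪ {v}) Top s' := by
  obtain ⟨b, Q, hb, hG, hT⟩ := hb
  refine (run_insertVec hs hb hv hN).mono le_rfl ?_
  rintro s' ⟨h1, h2, b', Q', hb', hE, -⟩
  refine ⟨h1, h2, b', Q', hb', ?_, ?_⟩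
  · rw [hE.span]
    rintro f (hf | rfl)
    · exact Submodule.mem_sup_left (hG hf)
    · exact Submodule.mem_sup_right (Submodule.mem_span_singleton_self f)
  · rw [hE.span]
    exact sup_le hT ((Submodule.span_singleton_le_iff_mem _ _).2 hvT)

/-- Insert the vector with entries `1` and field variables `u`, `w` at the places given by
variables `50`, `51`, `52`. -/
def insertTri (u w : ℕ) : Prog :=
  pre [.fload 13 1 [50], .fadd 13 13 1, .fstore 1 [50] 13, .fload 13 1 [51], .fadd 13 13 u,
    .fstore 1 [51] 13, .fload 13 1 [52], .fadd 13 13 w, .fstore 1 [52] 13] insertVec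

/-- The three cells are read, increased and written back one after the other. Coinciding places
therefore add up, as `tri` requires. The current vector is zero beforehand, by `Spans`. -/
theorem run_insertTri {s : Memory F} (hs : Consts n d s) {G : Set (ℕ → F)}
    {Top : Submodule F (ℕ → F)} (h : Spans n d G Top s) {a b c : ℕ} (ha : a < base n ^ d)
    (hb : b < base n ^ d) (hc : c < base n ^ d) (h50 : s.nvar 50 = a) (h51 : s.nvar 51 = b)
    (h52 : s.nvar 52 = c) {u w : ℕ} (hu : u < 3) (hw : w < 3) {u' w' : F} (hu' : s.fvar u = u')
    (hw' : s.fvar w = w') (hT : tri a b c u' w' ∈ Top) :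
    Run (insertTri u w) s (insertTime (base n ^ d) + 9) fun s' =>
      SameBelow 60 s s' ∧ Spans n d (G ∪ {tri a b c u' w'}) Top s' := by
  obtain ⟨hv, b0, Q, hb0, h⟩ := h
  refine (Run.pre (T := insertTime (base n ^ d)) ?_).mono (by simp; omega) fun _ h => h
  generalize ht : List.foldl (fun s i => Instr.apply s i) s _ = t
  have hsame : SameBelow 60 s t := by simp [← ht, SameBelow.refl]
  refine (run_insertVec_spans (hs.of_same hsame) (v := tri a b c u' w') ?_ ?_ hT
    ⟨b0, Q, hb0.congr (by simp [← ht]) (by simp [← ht]) (by simp [← ht]), h⟩).mono le_rfl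
    fun s' hs' => ⟨hsame.trans hs'.1, hs'.2⟩
  · intro e
    have hv : ∀ e, s.farr 1 [e] = 0 := hv
    simp [← ht, h50, h51, h52, hv, hs.one', show u ≠ 13 by omega, show w ≠ 13 by omega, hu', hw',
      tri, Pi.single_apply]
    split_ifs <;> simp_all
  · intro e he
    simp [tri, show e ≠ a by omega, show e ≠ b by omega, show e ≠ c by omega]

/-- A positive `lowCount n d` means `1 ≤ d`, so the truncated difference `d - 1` is a genuine row of
the table. For `d = 0` the loops that use it are empty. -/
theorem Consts.table_low {s : Memory F} (hs : Consts n d s) (h : 0 < lowCount n d) {i : ℕ}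
    (hi : i < base n) : s.narr 6 [d - 1, i] = i * lowCount n d := by
  rcases d with _ | d
  · simp [lowCount] at h
  · exact hs.table d (by omega) i hi

theorem Consts.table_low₂ {s : Memory F} (hs : Consts n d s) (h : 0 < lowCount₂ n d) {i : ℕ}
    (hi : i < base n) : s.narr 6 [d - 2, i] = i * lowCount₂ n d := by
  rcases d with _ | _ | d
  · simp [lowCount₂] at h
  · simp [lowCount₂, lowCount] at h
  · exact hs.table d (by omega) i hi

/-- Insert the relations that rotate words. -/
def rotLoop (d : ℕ) : Prog :=
  pre [.const 51 0, .const 33 (d - 1)] (forLoop 30 6 (forLoop 31 4 (.seq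
    (pre [.load 34 6 [33, 31], .add 50 30 34, .const 52 0, .add 52 52 51] (insertTri 2 0))
    (block [.add 51 51 3]))))

/-- The machine cannot multiply natural numbers. The product `i * lowCount n d` is read from the
table, while `i + w * base n` runs through consecutive numbers and is simply counted up in variable
`51` across both loops. -/
theorem run_rotLoop {s : Memory F} (hs : Consts n d s) {G : Set (ℕ → F)}
    {Top : Submodule F (ℕ → F)} (h : Spans n d G Top s) {ρ : PAssign n}
    (hT : ∀ f, IsRelation d ρ f → f ∈ Top) :
    Run (rotLoop d) s (lowCount n d * (base n * (insertTime (base n ^ d) + 17) + 4) + 4) fun s' =>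
      SameBelow 30 s s' ∧ Spans n d (G ∪ {f | ∃ w < lowCount n d, ∃ i < base n,
        f = tri (w + i * lowCount n d) (i + w * base n) (i + w * base n) (-1) 0}) Top s' := by
  refine (Run.pre (T := lowCount n d * (base n * (insertTime (base n ^ d) + 17) + 2 + 2) + 2)
    ?_).mono (by simp only [List.length_cons, List.length_nil]; linarith) fun _ h => h
  generalize ht : List.foldl (fun s i => Instr.apply s i) s _ = t
  have hsame : SameBelow 30 s t := by simp [← ht, SameBelow.refl]
  have hst := hs.of_same hsame
  refine (Run.forLoop_spans (n := n) (d := d) (N := lowCount n d) (G := G) (Top := Top)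
    (R := fun w => {f | ∃ i < base n,
      f = tri (w + i * lowCount n d) (i + w * base n) (i + w * base n) (-1) 0})
    (E := fun w t => t.nvar 51 = w * base n ∧ t.nvar 33 = d - 1) hst (by omega) (by omega) hst.low
    (by simp) (by simpa [← ht] using h) (by simp [← ht]) ?_).mono le_rfl ?_
  · rintro w t1 G1 hw hs1 hw1 ⟨e51, e33⟩ hG1
    have c1 := hst.of_same hs1
    refine (Run.forLoop_spans (n := n) (d := d) (N := base n) (G := G1) (Top := Top)
      (T := insertTime (base n ^ d) + 15)
      (R := fun i => {f | f = tri (w + i * lowCount n d) (i + w * base n) (i + w * base n) (-1) 0})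
      (E := fun i t => t.nvar 51 = i + w * base n ∧ t.nvar 33 = d - 1) c1 (by omega) (by omega)
      c1.base_eq (by simp) (by simpa using hG1) (by simp [e51, e33]) ?_).mono le_rfl ?_
    · rintro i t2 G2 hi hs2 hi2 ⟨e51, e33⟩ hG2
      have c3 := c1.of_same hs2
      have e30 : t2.nvar 30 = w := (hs2.nvar 30 (by omega)).trans hw1
      refine (Run.seq (T₂ := 2) ((Run.pre (T := insertTime (base n ^ d) + 9) ?_).mono le_rfl
        fun _ h => h)).mono (by simp; omega) fun _ h => h
      generalize ht3 : List.foldl (fun s i => Instr.apply s i) t2 _ = t3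
      have hs3 : SameBelow 32 t2 t3 := by simp [← ht3, SameBelow.refl]
      have c4 := c3.of_same hs3
      have h1 := add_mul_lowCount_lt w i hw hi
      have h2 := add_mul_base_lt w i hw hi
      refine (run_insertTri c4 (G := G2) (Top := Top) (by simpa [← ht3] using hG2)
        h1 h2 h2 ?_ ?_ ?_ (by omega) (by omega)
        c4.neg_one' c4.zero' (hT _ (.rot w i hw hi))).mono le_rfl ?_
      · simp [← ht3, e30, e33, hi2, c3.table_low (by omega) hi]
      · simp [← ht3, e51]
      · simp [← ht3, e51]
      · rintro t4 ⟨hs4, hG4⟩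
        refine Run.block ?_ (by simp)
        have c5 := c4.of_same hs4
        have e51' : t4.nvar 51 = i + w * base n := by
          rw [hs4.nvar 51 (by omega), ← ht3]; simp [e51]
        have e33' : t4.nvar 33 = d - 1 := by
          rw [hs4.nvar 33 (by omega), ← ht3]; simp [e33]
        have hs5 := hs3.trans (hs4.mono (by omega))
        refine ⟨by simpa using hs5, by simpa using hG4, ?_⟩
        simp [e51', e33', c5.one]
        ring
    · rintro t' ⟨q1, q2, q3, q4⟩
      exact ⟨q1, q2, by rw [q3]; ring, q4⟩
  · rintro s' ⟨q1, q2, -⟩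
    exact ⟨hsame.trans q1, q2⟩

/-- Insert the relations that swap the last two letters, and those that remove a repeated last
letter. -/
def swapLoop (d : ℕ) : Prog :=
  pre [.const 29 (d - 1), .const 28 (d - 2)] (forLoop 30 7 (forLoop 31 4 (.seq
    (pre [.load 38 6 [28, 31], .add 51 30 38, .load 37 6 [29, 31], .add 50 51 37, .const 52 0,
      .add 52 52 51] (insertTri 2 0))
    (forLoop 35 4 (pre [.load 38 6 [28, 31], .load 37 6 [29, 35], .add 50 30 38, .add 50 50 37,
      .load 38 6 [28, 35], .load 37 6 [29, 31], .add 51 30 38, .add 51 51 37, .const 52 0,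
      .add 52 52 51] (insertTri 2 0))))))

theorem run_swapLoop {s : Memory F} (hs : Consts n d s) {G : Set (ℕ → F)}
    {Top : Submodule F (ℕ → F)} (h : Spans n d G Top s) {ρ : PAssign n}
    (hT : ∀ f, IsRelation d ρ f → f ∈ Top) :
    Run (swapLoop d) s (lowCount₂ n d * (base n * (base n * (insertTime (base n ^ d) + 21) +
        insertTime (base n ^ d) + 19) + 4) + 4) fun s' =>
      SameBelow 28 s s' ∧ Spans n d (G ∪ {f | ∃ u < lowCount₂ n d, ∃ i < base n,
        f = tri (u + i * lowCount₂ n d + i * lowCount n d)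
          (u + i * lowCount₂ n d) (u + i * lowCount₂ n d) (-1) 0 ∨
        ∃ j < base n, f = tri (u + i * lowCount₂ n d + j * lowCount n d)
          (u + j * lowCount₂ n d + i * lowCount n d) (u + j * lowCount₂ n d + i * lowCount n d)
          (-1) 0}) Top s' := by
  refine (Run.pre (T := lowCount₂ n d * (base n * ((insertTime (base n ^ d) + 15 +
    (base n * (insertTime (base n ^ d) + 19 + 2) + 2)) + 2) + 2 + 2) + 2)
    ?_).mono (by simp only [List.length_cons, List.length_nil]; linarith) fun _ h => h
  generalize ht : List.foldl (fun s i => Instr.apply s i) s _ = t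
  have hsame : SameBelow 28 s t := by simp [← ht, SameBelow.refl]
  have hst := hs.of_same hsame
  have e28 : t.nvar 28 = d - 2 := by simp [← ht]
  have e29 : t.nvar 29 = d - 1 := by simp [← ht]
  refine (Run.forLoop_spans (n := n) (d := d) (N := lowCount₂ n d) (G := G) (Top := Top)
    (R := fun u => {f | ∃ i < base n,
        f = tri (u + i * lowCount₂ n d + i * lowCount n d)
          (u + i * lowCount₂ n d) (u + i * lowCount₂ n d) (-1) 0 ∨
        ∃ j < base n, f = tri (u + i * lowCount₂ n d + j * lowCount n d)
          (u + j * lowCount₂ n d + i * lowCount n d) (u + j * lowCount₂ n d + i * lowCount n d)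
          (-1) 0})
    (E := fun _ _ => True) hst (by omega) (by omega) hst.low₂
    (by simp) (by simpa [← ht] using h) trivial ?_).mono le_rfl
    fun s' hs' => ⟨hsame.trans (hs'.1.mono (by omega)), hs'.2.1⟩
  rintro u t1 G1 hu hs1 hu1 - hG1
  have c1 := hst.of_same hs1
  -- The loop body is reached only if `lowCount₂ n d` is positive, and then both rows `d - 1` and `d
  -- - 2` of the table exist.
  have hpos : 0 < lowCount n d := by
    have := add_mul_lowCount₂_lt u 0 hu (by unfold base; omega)
    omega
  refine (Run.forLoop_spans (n := n) (d := d) (N := base n) (G := G1) (Top := Top)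
    (R := fun i => {f |
        f = tri (u + i * lowCount₂ n d + i * lowCount n d)
          (u + i * lowCount₂ n d) (u + i * lowCount₂ n d) (-1) 0 ∨
        ∃ j < base n, f = tri (u + i * lowCount₂ n d + j * lowCount n d)
          (u + j * lowCount₂ n d + i * lowCount n d) (u + j * lowCount₂ n d + i * lowCount n d)
          (-1) 0})
    (E := fun _ _ => True) c1 (by omega) (by omega) c1.base_eq
    (by simp) hG1 trivial ?_).mono le_rfl fun s' hs' => ⟨hs'.1, hs'.2.1, trivial⟩
  rintro i t2 G2 hi hs2 hi2 - hG2
  have c2 := c1.of_same hs2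
  have e30 : t2.nvar 30 = u := (hs2.nvar 30 (by omega)).trans hu1
  have e28' : t2.nvar 28 = d - 2 :=
    ((hs2.nvar 28 (by omega)).trans (hs1.nvar 28 (by omega))).trans e28
  have e29' : t2.nvar 29 = d - 1 :=
    ((hs2.nvar 29 (by omega)).trans (hs1.nvar 29 (by omega))).trans e29
  have hui := add_mul_lowCount₂_lt u i hu hi
  refine Run.seq ((Run.pre (T := insertTime (base n ^ d) + 9) ?_).mono (by simp; omega)
    fun _ h => h)
  generalize ht3 : List.foldl (fun s i => Instr.apply s i) t2 _ = t3
  have hs3 : SameBelow 35 t2 t3 := by simp [← ht3, SameBelow.refl]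
  have c3 := c2.of_same hs3
  have hb := hui.trans_le (lowCount_le n d)
  refine (run_insertTri c3 (G := G2) (Top := Top) (by simpa [← ht3] using hG2)
    (add_mul_lowCount_lt _ i hui hi) hb hb ?_ ?_ ?_ (by omega) (by omega)
    c3.neg_one' c3.zero' (hT _ (.idem u i hu hi))).mono le_rfl ?_
  · simp [← ht3, e30, e28', e29', hi2, c2.table_low hpos hi, c2.table_low₂ (by omega) hi]
  · simp [← ht3, e30, e28', hi2, c2.table_low₂ (by omega) hi]
  · simp [← ht3, e30, e28', hi2, c2.table_low₂ (by omega) hi]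
  rintro t4 ⟨hs4, hG4⟩
  have hs24 : SameBelow 35 t2 t4 := hs3.trans (hs4.mono (by omega))
  have c4 := c2.of_same hs24
  refine (Run.forLoop_spans (n := n) (d := d) (N := base n) (Top := Top)
    (R := fun j => {f | f = tri (u + i * lowCount₂ n d + j * lowCount n d)
          (u + j * lowCount₂ n d + i * lowCount n d) (u + j * lowCount₂ n d + i * lowCount n d)
          (-1) 0})
    (E := fun _ _ => True) c4 (by omega) (by omega) c4.base_eq
    (by simp) hG4 trivial ?_).mono le_rfl ?_
  · rintro j t5 G5 hj hs5 hj5 - hG5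
    have hs25 := hs24.trans (hs5.mono (by omega))
    have c5 := c4.of_same hs5
    have k30 := (hs25.nvar 30 (by omega)).trans e30
    have k28 := (hs25.nvar 28 (by omega)).trans e28'
    have k29 := (hs25.nvar 29 (by omega)).trans e29'
    have k31 := (hs25.nvar 31 (by omega)).trans hi2
    have huj := add_mul_lowCount₂_lt u j hu hj
    refine (Run.pre (T := insertTime (base n ^ d) + 9) ?_).mono (by simp; omega) fun _ h => h
    generalize ht6 : List.foldl (fun s i => Instr.apply s i) t5 _ = t6
    have hs6 : SameBelow 36 t5 t6 := by simp [← ht6, SameBelow.refl]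
    have c6 := c5.of_same hs6
    have hb := add_mul_lowCount_lt _ i huj hi
    refine (run_insertTri c6 (G := G5) (Top := Top) (by simpa [← ht6] using hG5)
      (add_mul_lowCount_lt _ j hui hj) hb hb ?_ ?_ ?_ (by omega) (by omega)
      c6.neg_one' c6.zero' (hT _ (.swap u i j hu hi hj))).mono le_rfl ?_
    · simp [← ht6, k30, k28, k29, k31, hj5, c5.table_low hpos hj, c5.table_low₂ (by omega) hi]
    · simp [← ht6, k30, k28, k29, k31, hj5, c5.table_low hpos hi, c5.table_low₂ (by omega) hj]
    · simp [← ht6, k30, k28, k29, k31, hj5, c5.table_low hpos hi, c5.table_low₂ (by omega) hj]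
    · rintro t7 ⟨hs7, hG7⟩
      exact ⟨hs6.trans (hs7.mono (by omega)), hG7, trivial⟩
  · rintro t' ⟨q1, q2, -⟩
    refine ⟨hs24.trans (q1.mono (by omega)) |>.mono (by omega), q2.mono ?_, trivial⟩
    rintro f (hf | rfl | ⟨j, hj, rfl⟩)
    · exact Or.inl (Or.inl hf)
    · exact Or.inl (Or.inr rfl)
    · exact Or.inr ⟨j, hj, rfl⟩

end Generate

/-! ### Inserting the relations that depend on the example -/

section Sample

variable {F : Type*} [Field F] {sys : PCSystem} {n m d : ℕ} {p : List (TermList F sys n)}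
  {q : TermList F sys n} {ε γ : ℝ} {ρ : Fin m → PAssign n}

/-- The memory still holds the input. -/
structure HasInput (p : List (TermList F sys n)) (q : TermList F sys n) (ε γ : ℝ)
    (ρ : Fin m → PAssign n) (s : Memory F) : Prop where
  polys : s.nvar 1 = p.length
  samples : s.nvar 2 = m
  narr : ∀ a < 6, s.narr a = (inputMemory p q ε γ ρ).narr a
  farr : s.farr 0 = (inputMemory p q ε γ ρ).farr 0

theorem HasInput.of_same {k : ℕ} {s s' : Memory F} (h : HasInput p q ε γ ρ s)
    (hs : SameBelow k s s') (hk : 9 ≤ k := by omega) : HasInput p q ε γ ρ s' where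
  polys := (hs.nvar _ (by omega)).trans h.polys
  samples := (hs.nvar _ (by omega)).trans h.samples
  narr a ha := (hs.narr a (by omega)).trans (h.narr a ha)
  farr := hs.farr.trans h.farr

theorem HasInput.sample {s : Memory F} (h : HasInput p q ε γ ρ s) (i : Fin m) (v : Fin n) :
    s.narr 3 [i, v] = starCode (ρ i v) := by
  rw [h.narr 3 (by omega)]
  simp [inputMemory]

/-- Insert the relations for complementary letters, and those for the letters whose value is known
in example number `20`. -/
def valueLoop (d : ℕ) : Prog :=
  pre [.const 29 (d - 1)] (forLoop 30 6 (forLoop 31 0 (.seq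
    (pre [.add 37 31 3, .load 34 6 [29, 37], .add 50 30 34, .add 38 37 0, .load 34 6 [29, 38],
      .add 51 30 34, .const 52 0, .add 52 52 30] (insertTri 1 2))
    (pre [.load 39 3 [20, 31], .const 51 0, .add 51 51 30]
      (.ite (.lt 39 3) (insertTri 0 0)
        (pre [.const 40 2] (.ite (.lt 39 40) (insertTri 2 0) skip)))))))

/-- The codes 0, 1, 2 stand for false, true and `*`, so comparisons with 1 and 2 tell them apart. A
false letter makes the longer word itself a relation, with second coefficient 0. A true letter makes
it equal to the word without that letter, with second coefficient -1. -/
theorem run_valueLoop {s : Memory F} (hs : Consts n d s) (hin : HasInput p q ε γ ρ s)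
    {G : Set (ℕ → F)} {Top : Submodule F (ℕ → F)} (h : Spans n d G Top s) (e : Fin m)
    (he : s.nvar 20 = e) (hT : ∀ f, IsRelation d (ρ e) f → f ∈ Top) :
    Run (valueLoop d) s (lowCount n d * (n * (2 * insertTime (base n ^ d) + 34) + 4) + 3)
      fun s' => SameBelow 29 s s' ∧
        Spans n d (G ∪ {f | ∃ w < lowCount n d, ∃ k < n, ∀ hk : k < n,
          (f = tri (w + (k + 1) * lowCount n d) (w + (n + k + 1) * lowCount n d) w 1 (-1)) ∨
          ∃ b, ρ e ⟨k, hk⟩ = some b ∧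
            f = tri (w + (k + 1) * lowCount n d) w w (if b then -1 else 0) 0}) Top s' := by
  refine (Run.pre (T := lowCount n d * (n * (2 * insertTime (base n ^ d) + 32 + 2) + 2 + 2) + 2)
    ?_).mono (by simp only [List.length_cons, List.length_nil]; linarith) fun _ h => h
  generalize ht : List.foldl (fun s i => Instr.apply s i) s _ = t
  have hsame : SameBelow 29 s t := by simp [← ht, SameBelow.refl]
  have hst := hs.of_same hsame
  have hin := hin.of_same hsame
  have e29 : t.nvar 29 = d - 1 := by simp [← ht]
  have e20 : t.nvar 20 = e := by simp [← ht, he]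
  refine (Run.forLoop_spans (n := n) (d := d) (N := lowCount n d) (G := G) (Top := Top)
    (R := fun w => {f | ∃ k < n, ∀ hk : k < n,
          (f = tri (w + (k + 1) * lowCount n d) (w + (n + k + 1) * lowCount n d) w 1 (-1)) ∨
          ∃ b, ρ e ⟨k, hk⟩ = some b ∧
            f = tri (w + (k + 1) * lowCount n d) w w (if b then -1 else 0) 0})
    (E := fun _ _ => True) hst (by omega) (by omega) hst.low
    (by simp) (by simpa [← ht] using h) trivial ?_).mono le_rfl
    fun s' hs' => ⟨hsame.trans (hs'.1.mono (by omega)), hs'.2.1⟩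
  rintro w t1 G1 hw hs1 hw1 - hG1
  have c1 := hst.of_same hs1
  refine (Run.forLoop_spans (n := n) (d := d) (N := n) (G := G1) (Top := Top)
    (R := fun k => {f | ∀ hk : k < n,
          (f = tri (w + (k + 1) * lowCount n d) (w + (n + k + 1) * lowCount n d) w 1 (-1)) ∨
          ∃ b, ρ e ⟨k, hk⟩ = some b ∧
            f = tri (w + (k + 1) * lowCount n d) w w (if b then -1 else 0) 0})
    (E := fun _ _ => True) c1 (by omega) (by omega) c1.vars
    (by simp) hG1 trivial ?_).mono le_rfl fun s' hs' => ⟨hs'.1, hs'.2.1, trivial⟩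
  rintro k t2 G2 hk hs2 hk2 - hG2
  have c2 := c1.of_same hs2
  have hs02 := hs1.trans (hs2.mono (by omega))
  have e30 : t2.nvar 30 = w := (hs2.nvar 30 (by omega)).trans hw1
  have e29' : t2.nvar 29 = d - 1 := (hs02.nvar 29 (by omega)).trans e29
  have hk1 : k + 1 < base n := by unfold base; omega
  have hk2' : k + 1 + n < base n := by unfold base; omega
  have hwN := hw.trans_le (lowCount_le n d)
  have ha := add_mul_lowCount_lt (d := d) w _ hw hk1
  have hb := add_mul_lowCount_lt (d := d) w (n + k + 1) hw (by omega)
  have hpos : 0 < lowCount n d := by omega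
  refine (Run.seq (T₂ := insertTime (base n ^ d) + 15)
    ((Run.pre (T := insertTime (base n ^ d) + 9) ?_).mono le_rfl
    fun _ h => h)).mono (by simp; omega) fun _ h => h
  generalize ht3 : List.foldl (fun s i => Instr.apply s i) t2 _ = t3
  have hs3 : SameBelow 34 t2 t3 := by simp [← ht3, SameBelow.refl]
  have c3 := c2.of_same hs3
  refine (run_insertTri c3 (G := G2) (Top := Top) (by simpa [← ht3] using hG2)
    ha hb hwN ?_ ?_ ?_ (by omega) (by omega)
    c3.one' c3.neg_one' (hT _ (.compl w ⟨k, hk⟩ hw))).mono le_rfl ?_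
  · simp [← ht3, e30, e29', hk2, c2.one, c2.table_low hpos hk1]
  · simp [← ht3, e30, e29', hk2, c2.one, c2.vars, c2.table_low hpos hk2']
    left; ring
  · simp [← ht3, e30]
  rintro t4 ⟨hs4, hG4⟩
  have hs24 : SameBelow 34 t2 t4 := hs3.trans (hs4.mono (by omega))
  have c4 := c2.of_same hs24
  have k30 := (hs24.nvar 30 (by omega)).trans e30
  have k31 := (hs24.nvar 31 (by omega)).trans hk2
  have k20 := (hs24.nvar 20 (by omega)).trans ((hs02.nvar 20 (by omega)).trans e20)
  have k50 : t4.nvar 50 = w + (k + 1) * lowCount n d := by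
    rw [hs4.nvar 50 (by omega)]
    simp [← ht3, e30, e29', hk2, c2.one, c2.table_low hpos hk1]
  have k52 : t4.nvar 52 = w := by
    rw [hs4.nvar 52 (by omega)]
    simp [← ht3, e30]
  have kval : t4.narr 3 [e, k] = starCode (ρ e ⟨k, hk⟩) :=
    ((hin.of_same hs02).of_same hs24).sample e ⟨k, hk⟩
  refine (Run.pre (T := insertTime (base n ^ d) + 12) ?_).mono (by simp; omega)
    fun _ h => h
  generalize ht5 : List.foldl (fun s i => Instr.apply s i) t4 _ = t5
  have hs5 : SameBelow 39 t4 t5 := by simp [← ht5, SameBelow.refl]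
  have c5 := c4.of_same hs5
  have hs25 : SameBelow 32 t2 t5 := (hs24.mono (by omega)).trans (hs5.mono (by omega))
  have l39 : t5.nvar 39 = starCode (ρ e ⟨k, hk⟩) := by simp [← ht5, k20, k31, kval]
  have l50 : t5.nvar 50 = w + (k + 1) * lowCount n d := by simp [← ht5, k50]
  have l51 : t5.nvar 51 = w := by simp [← ht5, k30]
  have l52 : t5.nvar 52 = w := by simp [← ht5, k52]
  have hG5 : Spans n d (G2 ∪ {tri (w + (k + 1) * lowCount n d)
      (w + (n + k + 1) * lowCount n d) w 1 (-1)}) Top t5 := by simpa [← ht5] using hG4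
  refine (Run.ite (T := insertTime (base n ^ d) + 11) ?_ ?_)
  · intro hlt
    have hv : ρ e ⟨k, hk⟩ = some false := by
      simp only [Test.Holds, l39, c5.one] at hlt
      rcases hρ : ρ e ⟨k, hk⟩ with _ | _ | _ <;> simp [hρ, starCode] at hlt ⊢
    refine (run_insertTri c5 hG5 ha hwN hwN l50 l51 l52 (by omega) (by omega)
      (u' := if false then -1 else 0) (by simpa using c5.zero') c5.zero'
      (hT _ (.value w ⟨k, hk⟩ false hw hv))).mono (by omega) ?_
    rintro t6 ⟨hs6, hG6⟩
    refine ⟨hs25.trans (hs6.mono (by omega)), hG6.mono ?_, trivial⟩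
    rintro f (hf | hf)
    · exact Or.inl (Or.inl hf)
    · rcases hf hk with rfl | ⟨b, hb', rfl⟩
      · exact Or.inl (Or.inr rfl)
      · rw [hv] at hb'
        cases hb'
        exact Or.inr rfl
  · intro hlt
    refine (Run.pre (T := insertTime (base n ^ d) + 10) ?_).mono (by simp; omega)
      fun _ h => h
    generalize ht6 : List.foldl (fun s i => Instr.apply s i) t5 _ = t6
    have hs6 : SameBelow 40 t5 t6 := by simp [← ht6, SameBelow.refl]
    have c6 := c5.of_same hs6
    have hs26 := hs25.trans (hs6.mono (by omega))
    have hG6 : Spans n d (G2 ∪ {tri (w + (k + 1) * lowCount n d)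
      (w + (n + k + 1) * lowCount n d) w 1 (-1)}) Top t6 := by simpa [← ht6] using hG5
    simp only [Test.Holds, l39, c5.one] at hlt
    refine Run.ite (T := insertTime (base n ^ d) + 9) ?_ ?_
    · intro hlt'
      have hv : ρ e ⟨k, hk⟩ = some true := by
        simp only [Test.Holds, ← ht6, l39, List.foldl_cons, List.foldl_nil, Instr.apply_const,
          Memory.setN_nvar] at hlt'
        rcases hρ : ρ e ⟨k, hk⟩ with _ | _ | _ <;> simp [hρ, starCode] at hlt hlt' ⊢
      refine (run_insertTri c6 hG6 ha hwN hwN (by simp [← ht6, l50]) (by simp [← ht6, l51])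
        (by simp [← ht6, l52]) (by omega) (by omega)
        (u' := if true then -1 else 0) (by simpa using c6.neg_one') c6.zero'
        (hT _ (.value w ⟨k, hk⟩ true hw hv))).mono (by omega) ?_
      rintro t7 ⟨hs7, hG7⟩
      refine ⟨hs26.trans (hs7.mono (by omega)), hG7.mono ?_, trivial⟩
      rintro f (hf | hf)
      · exact Or.inl (Or.inl hf)
      · rcases hf hk with rfl | ⟨b, hb', rfl⟩
        · exact Or.inl (Or.inr rfl)
        · rw [hv] at hb'
          cases hb'
          exact Or.inr rfl
    · intro hlt'
      have hv : ρ e ⟨k, hk⟩ = none := by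
        simp only [Test.Holds, ← ht6, l39, List.foldl_cons, List.foldl_nil, Instr.apply_const,
          Memory.setN_nvar] at hlt'
        rcases hρ : ρ e ⟨k, hk⟩ with _ | _ | _ <;> simp [hρ, starCode] at hlt hlt' ⊢
      refine Run.skip ?_
      refine ⟨by simpa using hs26, ?_, trivial⟩
      rw [spans_setN (by omega)]
      refine hG6.mono ?_
      rintro f (hf | hf)
      · exact Or.inl hf
      · rcases hf hk with rfl | ⟨b, hb', rfl⟩
        · exact Or.inr rfl
        · rw [hv] at hb'
          cases hb'

end Sample

/-! ### Reading polynomials and resetting the basis -/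

section Decide

variable {F : Type*} [Field F] {sys : PCSystem} {n m d : ℕ} {p : List (TermList F sys n)}
  {q : TermList F sys n} {ε γ : ℝ} {ρ : Fin m → PAssign n}

theorem wordCode_take_succ (w : List (Indet sys n)) (k : ℕ) (hk : k < w.length) :
    wordCode (w.take (k + 1)) = wordCode (w.take k) + (w[k].code + 1) * base n ^ k := by
  rw [List.take_succ_eq_append_getElem hk]
  simp only [wordCode, List.map_append, Nat.ofDigits_append, List.length_map, List.length_take,
    List.map_cons, List.map_nil, Nat.ofDigits_singleton]
  rw [min_eq_left hk.le, mul_comm]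

theorem TermList.vec_take_succ (L : TermList F sys n) (k : ℕ) (hk : k < L.length) :
    TermList.vec (L.take (k + 1)) =
      TermList.vec (L.take k) + Pi.single (wordCode L[k].2) L[k].1 := by
  simp only [TermList.vec, List.take_succ_eq_append_getElem hk, List.map_append, List.sum_append,
    List.map_cons, List.map_nil, List.sum_cons, List.sum_nil, add_zero]

theorem TermList.vec_eq_zero {L : TermList F sys n} (hL : ∀ t ∈ L, t.2.length ≤ d) (c : ℕ)
    (hc : base n ^ d ≤ c) : L.vec c = 0 := by
  induction L with
  | nil => rfl
  | cons t L ih =>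
    have h1 := wordCode_lt t.2 d (hL t (by simp))
    have h2 := ih fun t ht => hL t (by simp [ht])
    simp only [TermList.vec, List.map_cons, List.sum_cons, Pi.add_apply] at h2 ⊢
    rw [h2, Pi.single_eq_of_ne (by omega), add_zero]

/-- Padded with blanks to length `d`, the digit lists are determined by their numbers. Letters have
nonzero digits, so deleting the zeros recovers the word. -/
theorem wordCode_injOn {w w' : List (Indet sys n)} (hw : w.length ≤ d) (hw' : w'.length ≤ d)
    (h : wordCode w = wordCode w') : w = w' := by
  rcases Nat.eq_zero_or_pos n with rfl | hn
  · rcases w with _ | ⟨l, _⟩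
    · rcases w' with _ | ⟨l, _⟩
      · rfl
      · exact l.1.1.elim0
    · exact l.1.1.elim0
  have key := Nat.ofDigits_inj_of_len_eq (b := base n) (by unfold base; omega)
    (L1 := w.map (fun l => l.code + 1) ++ List.replicate (d - w.length) 0)
    (L2 := w'.map (fun l => l.code + 1) ++ List.replicate (d - w'.length) 0)
    (by simp; omega) (digits_lt _ _) (digits_lt _ _)
    (by simpa [Nat.ofDigits_append_replicate_zero, wordCode] using h)
  have := congrArg (List.filter (· ≠ 0)) key
  simp only [List.filter_append] at this
  have hz : ∀ k, List.filter (fun x : ℕ => decide (x ≠ 0)) (List.replicate k 0) = [] := by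
    intro k; simp
  have hm : ∀ w : List (Indet sys n), List.filter (fun x : ℕ => decide (x ≠ 0))
      (w.map (fun l => l.code + 1)) = w.map (fun l => l.code + 1) := by
    intro w
    rw [List.filter_eq_self]
    intro a ha
    obtain ⟨l, -, rfl⟩ := List.mem_map.1 ha
    simp
  rw [hz, hz, hm, hm, List.append_nil, List.append_nil] at this
  refine List.map_injective_iff.2 ?_ this
  intro a b hab
  exact Indet.code_injective (by simpa using hab)

/-- Distinct monomials are given by distinct words, hence by distinct codes below `base n ^ d`. This
bounds the time for reading a polynomial. -/
theorem TermList.IsRep.length_le {F : Type*} {L : TermList F sys n} (hL : L.IsRep d) :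
    L.length ≤ base n ^ d := by
  have h1 : (L.map fun t => wordCode t.2).Nodup := by
    have h2 := hL.2
    rw [List.nodup_iff_pairwise_ne, List.pairwise_map] at h2 ⊢
    refine h2.imp_of_mem ?_
    intro a b ha hb hab h
    exact hab (by rw [wordCode_injOn (hL.1 a ha) (hL.1 b hb) h])
  have h3 : (L.map fun t => wordCode t.2) ⊆ List.range (base n ^ d) := by
    intro c hc
    obtain ⟨t, ht, rfl⟩ := List.mem_map.1 hc
    exact List.mem_range.2 (wordCode_lt _ _ (hL.1 t ht))
  simpa using (h1.subperm h3).length_le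

/-- Add polynomial number `21` of the input to the current vector. -/
def loadPoly : Prog :=
  pre [.load 22 0 [21]] (forLoop 23 22 (pre [.load 24 1 [21, 23], .const 25 0] (.seq
    (forLoop 26 24 (block [.load 27 2 [21, 23, 26], .add 27 27 3, .load 28 6 [26, 27],
      .add 25 25 28]))
    (block [.fload 13 0 [21, 23], .fload 14 1 [25], .fadd 13 14 13, .fstore 1 [25] 13]))))

theorem run_loadPoly {s : Memory F} (hs : Consts n d s) (hin : HasInput p q ε γ ρ s)
    (hv : HoldsVec (0 : ℕ → F) s) {j : ℕ} {L : TermList F sys n} (hj : (p ++ [q])[j]? = some L)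
    (hL : L.IsRep d) (h21 : s.nvar 21 = j) :
    Run loadPoly s (base n ^ d * (7 * d + 11) + 3) fun s' => SameBelow 22 s s' ∧
      HoldsVec L.vec s' ∧ (∀ c t, s'.farr 2 [c, t] = s.farr 2 [c, t]) ∧ s'.narr = s.narr ∧
      s'.nvar 60 = s.nvar 60 := by
  have hgetD : (p ++ [q]).getD j [] = L := by simp [List.getD, hj]
  have i0 : s.narr 0 [j] = L.length := by
    rw [hin.narr 0 (by omega)]; simp only [inputMemory, hgetD]
  have i1 : ∀ t (ht : t < L.length), s.narr 1 [j, t] = L[t].2.length := by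
    intro t ht
    rw [hin.narr 1 (by omega)]; simp only [inputMemory, hgetD]
    rw [List.getD_eq_getElem _ _ ht]
  have i2 : ∀ t (ht : t < L.length) k (hk : k < L[t].2.length),
      s.narr 2 [j, t, k] = L[t].2[k].code := by
    intro t ht k hk
    rw [hin.narr 2 (by omega)]; simp only [inputMemory, hgetD]
    rw [List.getD_eq_getElem _ _ ht, List.getD_eq_getElem _ _ (by simpa using hk)]
    simp
  have f0 : ∀ t (ht : t < L.length), s.farr 0 [j, t] = L[t].1 := by
    intro t ht
    rw [hin.farr]; simp only [inputMemory, hgetD]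
    rw [List.getD_eq_getElem _ _ ht]
  refine (Run.pre (T := L.length * (7 * d + 9 + 2) + 2) ?_).mono (by
    have := Nat.mul_le_mul_right (7 * d + 9 + 2) hL.length_le
    simp only [List.length_cons, List.length_nil]; linarith) fun _ h => h
  generalize ht : List.foldl (fun s i => Instr.apply s i) s _ = s1
  have hs1 : SameBelow 22 s s1 := by simp [← ht, SameBelow.refl]
  refine (Run.forLoop (N := L.length) (T := 7 * d + 9) (I := fun k t => t.nvar 23 = k ∧
    SameBelow 22 s t ∧ t.nvar 22 = L.length ∧ HoldsVec (TermList.vec (L.take k)) t ∧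
    (∀ c e, t.farr 2 [c, e] = s.farr 2 [c, e]) ∧ t.narr = s.narr ∧ t.nvar 60 = s.nvar 60)
    ?_ ?_ ?_).mono le_rfl ?_
  · refine ⟨by simp, by simpa using hs1, by simp [← ht, h21, i0], ?_, by simp [← ht],
      by simp [← ht], by simp [← ht]⟩
    intro c
    have : s.farr 1 [c] = 0 := hv c
    simp [← ht, this, TermList.vec]
  · rintro k t ⟨h1, -, h2, -⟩
    exact ⟨h1, h2⟩
  · rintro k t hk ⟨h1, h2, h3, h4, h5, h6, h7⟩
    have hlen : L[k].2.length ≤ d := hL.1 _ (List.getElem_mem hk)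
    have e21 : t.nvar 21 = j := (h2.nvar 21 (by omega)).trans h21
    refine (Run.pre (T := 7 * d + 7) ?_).mono (by simp; omega) fun _ h => h
    generalize ht2 : List.foldl (fun s i => Instr.apply s i) t _ = s2
    have hs2 : SameBelow 22 s s2 := by simp [← ht2, h2]
    have hs2' : SameBelow 24 t s2 := by simp [← ht2, SameBelow.refl]
    refine (Run.seq (T₁ := L[k].2.length * 7 + 2) (T₂ := 5) ?_).mono (by omega) fun _ h => h
    refine (Run.forLoop (N := L[k].2.length) (T := 5) (I := fun i u => u.nvar 26 = i ∧
      SameBelow 24 t u ∧ u.nvar 24 = L[k].2.length ∧ u.nvar 25 = wordCode (L[k].2.take i) ∧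
      u.farr = t.farr ∧ u.narr = t.narr ∧ u.nvar 60 = t.nvar 60) ?_ ?_ ?_).mono le_rfl ?_
    · refine ⟨by simp, by simpa using hs2', by simp [← ht2, h1, e21, h6, i1 k hk],
        by simp [← ht2, wordCode], by simp [← ht2], by simp [← ht2], by simp [← ht2]⟩
    · rintro i u ⟨g1, -, g2, -⟩
      exact ⟨g1, g2⟩
    · rintro i u hi ⟨g1, g2, g3, g4, g5, g6, g7⟩
      have hone : u.nvar 3 = 1 := ((hs.of_same h2).of_same g2).one
      have u21 : u.nvar 21 = j := (g2.nvar 21 (by omega)).trans e21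
      have u23 : u.nvar 23 = k := (g2.nvar 23 (by omega)).trans h1
      have hcode : L[k].2[i].code + 1 < base n := by
        have := (L[k].2[i]).code_lt
        unfold base; omega
      refine Run.block ?_ (by simp)
      have htab := hs.table i (by omega) _ hcode
      refine ⟨by simp [g1], by simp [hone], by simp, by simpa using g2, by simp [g3], ?_,
        by simp [g5], by simp [g6], by simp [g7]⟩
      rw [wordCode_take_succ _ _ hi]
      simp [g1, g4, g6, h6, u21, u23, hone, i2 k hk i hi, htab]
    · rintro u ⟨g1, g2, g3, g4, g5, g6, g7⟩
      have hone : u.nvar 3 = 1 := ((hs.of_same h2).of_same g2).one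
      have u21 : u.nvar 21 = j := (g2.nvar 21 (by omega)).trans e21
      have u23 : u.nvar 23 = k := (g2.nvar 23 (by omega)).trans h1
      have hf0 : t.farr 0 [j, k] = L[k].1 := by rw [h2.farr, f0 k hk]
      rw [List.take_length] at g4
      refine Run.block ?_ (by simp)
      refine ⟨by simp [u23], by simp [hone], by simp, ?_, ?_, ?_, ?_, by simp [g6, h6],
        by simp [g7, h7]⟩
      · simpa using h2.trans (g2.mono (by omega))
      · simp [g2.nvar 22 (by omega), h3]
      · intro c
        have h4 : ∀ c, t.farr 1 [c] = TermList.vec (L.take k) c := h4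
        rw [TermList.vec_take_succ _ _ hk]
        simp [g4, g5, u21, u23, hf0, h4, Pi.single_apply]
        split_ifs with hc
        · simp [hc]
        · simp
      · intro c e
        simp [g5, h5]
  · rintro t ⟨h1, h2, h3, h4, h5, h6, h7⟩
    rw [List.take_length] at h4
    exact ⟨h2, h4, h5, h6, h7⟩

/-- Set the basis to zero. -/
def clearBasis : Prog :=
  pre [.const 60 0] (forLoop 30 5 (forLoop 31 5 (block [.fstore 2 [30, 31] 0])))

/-- Because of the echelon form, all nonzero entries lie in a square of side `base n ^ d`. Clearing
this square empties the whole infinite array. -/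
theorem HoldsBasis.arr_eq_zero {s : Memory F} {b : ℕ → ℕ → F} {Q : List ℕ}
    (hb : HoldsBasis n d b Q s) {c t : ℕ} (h : ¬ (c < base n ^ d ∧ t < base n ^ d)) :
    s.farr 2 [c, t] = 0 := by
  rw [hb.arr]
  by_cases h0 : b c = 0
  · rw [h0]; rfl
  · obtain ⟨h1, -, h2⟩ := hb.ech c h0
    exact h2 t (by omega)

theorem isEchelon_zero (N : ℕ) : IsEchelon N (0 : ℕ → ℕ → F) := fun _ h => absurd rfl h

theorem run_clearBasis {s : Memory F} (hs : Consts n d s) (hv : HoldsVec (0 : ℕ → F) s)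
    (hb : ∃ b Q, HoldsBasis n d b Q s) (Top : Submodule F (ℕ → F)) :
    Run clearBasis s (base n ^ d * (base n ^ d * 4 + 4) + 3) fun s' =>
      SameBelow 30 s s' ∧ Spans n d ∅ Top s' := by
  obtain ⟨b, Q, hb⟩ := hb
  refine (Run.pre (T := base n ^ d * (base n ^ d * (2 + 2) + 2 + 2) + 2) ?_).mono
    (by simp only [List.length_cons, List.length_nil]; linarith) fun _ h => h
  simp only [List.foldl_cons, List.foldl_nil, Instr.apply_const]
  refine (Run.forLoop (N := base n ^ d) (T := base n ^ d * (2 + 2) + 2) (I := fun k t =>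
    t.nvar 30 = k ∧ SameBelow 30 s t ∧ t.nvar 60 = 0 ∧ (∀ c, t.farr 1 [c] = 0) ∧
      ∀ c e, t.farr 2 [c, e] = if c < k then 0 else s.farr 2 [c, e]) ?_ ?_ ?_).mono le_rfl ?_
  · refine ⟨by simp, by simp [SameBelow.refl], by simp, fun c => by simpa using hv c, by simp⟩
  · rintro k t ⟨h1, h2, -⟩
    exact ⟨h1, (h2.nvar 5 (by omega)).trans hs.words⟩
  · rintro k t hk ⟨h1, h2, h3, h4, h5⟩
    refine (Run.forLoop (N := base n ^ d) (T := 2) (I := fun i u =>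
      u.nvar 31 = i ∧ SameBelow 31 t u ∧ u.nvar 60 = 0 ∧ (∀ c, u.farr 1 [c] = 0) ∧
        ∀ c e, u.farr 2 [c, e] = if c = k ∧ e < i then 0 else t.farr 2 [c, e])
      ?_ ?_ ?_).mono le_rfl ?_
    · refine ⟨by simp, by simp [SameBelow.refl], by simp [h3], by simpa using h4, by simp⟩
    · rintro i u ⟨g1, g2, -⟩
      exact ⟨g1, (g2.nvar 5 (by omega)).trans ((h2.nvar 5 (by omega)).trans hs.words)⟩
    · rintro i u hi ⟨g1, g2, g3, g4, g5⟩
      have c1 := (hs.of_same h2).of_same g2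
      have u30 : u.nvar 30 = k := (g2.nvar 30 (by omega)).trans h1
      refine Run.block ?_ (by simp)
      refine ⟨by simp [g1], by simp [c1.one], by simp, by simpa using g2, by simp [g3],
        by simpa using g4, ?_⟩
      intro c e
      simp [u30, g1, c1.zero', g5]
      by_cases hc : c = k
      · rcases lt_trichotomy e i with h | h | h
        · simp [hc, h, h.le, h.ne]
        · simp [hc, h]
        · simp [hc, show ¬ e < i by omega, show ¬ e ≤ i by omega, h.ne']
      · simp [hc]
    · rintro u ⟨g1, g2, g3, g4, g5⟩
      have hu := h2.trans (g2.mono (by omega))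
      refine ⟨(g2.nvar 30 (by omega)).trans h1, (hs.of_same hu).one, by simp, by simpa using hu,
        by simp [g3], by simpa using g4, ?_⟩
      intro c e
      simp only [Memory.setN_farr]
      rw [g5, h5]
      rcases lt_trichotomy c k with h | h | h
      · simp [h, h.ne, Nat.lt_succ_of_lt h]
      · subst h
        by_cases he : e < base n ^ d
        · simp [he]
        · simp [he, hb.arr_eq_zero (c := c) (t := e) (by omega)]
      · simp [h.ne', show ¬ c < k by omega, show ¬ c < k + 1 by omega]
  · rintro t ⟨h1, h2, h3, h4, h5⟩
    refine ⟨h2, h4, 0, [], ⟨?_, isEchelon_zero _, by simp [h3], by simp, by simp, by simp⟩,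
      by simp, ?_⟩
    · intro c e
      rw [h5]
      split_ifs with h
      · rfl
      · exact hb.arr_eq_zero (by omega)
    · rw [Submodule.span_le]
      rintro _ ⟨c, rfl⟩
      exact Top.zero_mem

end Decide

/-! ### Closing under multiplication, and the decision for one example -/

section Closure

variable {F : Type*} [Field F] {sys : PCSystem} {n m d : ℕ} {p : List (TermList F sys n)}
  {q : TermList F sys n} {ε γ : ℝ} {ρ : Fin m → PAssign n}

/-- Write the product of row `42` of the basis with a letter into the current vector; variable
`44` holds the distance by which the row is moved. -/
def shiftLoop : Prog :=
  forLoop 45 6 (block [.fload 13 2 [42, 45], .add 46 45 44, .fstore 1 [46] 13])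

theorem run_shiftLoop {s : Memory F} (hs : Consts n d s) (hv : HoldsVec (0 : ℕ → F) s) {c k : ℕ}
    (h42 : s.nvar 42 = c) (h44 : s.nvar 44 = k * lowCount n d) {f : ℕ → F}
    (hf : ∀ t, s.farr 2 [c, t] = f t) :
    Run shiftLoop s (lowCount n d * 6 + 2) fun s' => SameBelow 45 s s' ∧
      HoldsVec (shift d n k f) s' ∧ (∀ c t, s'.farr 2 [c, t] = s.farr 2 [c, t]) ∧
      s'.narr = s.narr ∧ s'.nvar 60 = s.nvar 60 := by
  refine (Run.forLoop (N := lowCount n d) (T := 4) (I := fun i t =>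
    t.nvar 45 = i ∧ SameBelow 45 s t ∧ (∀ e, t.farr 1 [e] =
      if k * lowCount n d ≤ e ∧ e < k * lowCount n d + i then f (e - k * lowCount n d) else 0) ∧
    (∀ c e, t.farr 2 [c, e] = s.farr 2 [c, e]) ∧ t.narr = s.narr ∧ t.nvar 60 = s.nvar 60)
    ?_ ?_ ?_).mono le_rfl ?_
  · refine ⟨by simp, by simp [SameBelow.refl], ?_, by simp, by simp, by simp⟩
    intro e
    rw [if_neg (by omega)]
    exact hv e
  · rintro i t ⟨h1, h2, -⟩
    exact ⟨h1, (h2.nvar 6 (by omega)).trans hs.low⟩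
  · rintro i t hi ⟨h1, h2, h3, h4, h5, h6⟩
    have ht := hs.of_same h2
    have e42 := (h2.nvar 42 (by omega)).trans h42
    have e44 := (h2.nvar 44 (by omega)).trans h44
    refine Run.block ?_ (by simp)
    refine ⟨by simp [h1], by simp [ht.one], by simp, by simpa using h2, ?_, by simp [h4],
      by simp [h5], by simp [h6]⟩
    intro e
    simp [h1, e42, e44, h4, hf, h3]
    by_cases he : e = i + k * lowCount n d
    · subst he
      rw [if_pos rfl, if_pos (by omega)]
      congr 1
      omega
    · rw [if_neg he]
      by_cases h : k * lowCount n d ≤ e ∧ e < k * lowCount n d + i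
      · rw [if_pos h, if_pos (by omega)]
      · rw [if_neg h, if_neg (by omega)]
  · rintro t ⟨h1, h2, h3, h4, h5, h6⟩
    exact ⟨h2, h3, h4, h5, h6⟩

/-- Insert the products of the pivot row number `41` of the queue with all letters. -/
def processRow : Prog :=
  pre [.load 42 7 [41], .const 44 0] (forLoop 43 8 (pre [.add 44 44 6] (.seq shiftLoop insertVec)))

theorem shift_eq_zero_of_le (l : ℕ) (hl : l < 2 * n) (f : ℕ → F) (c : ℕ) (hc : base n ^ d ≤ c) :
    shift d n (l + 1) f c = 0 := by
  simp only [shift, LinearMap.coe_mk, AddHom.coe_mk]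
  rw [if_neg]
  rintro ⟨h1, h2⟩
  have hpos : 0 < lowCount n d := by omega
  have := add_mul_lowCount_lt (n := n) (d := d) (c - (l + 1) * lowCount n d) (l + 1) (by omega)
    (by unfold base; omega)
  omega

/-- Insertions never change a nonzero row. So the row with pivot `c` is the same vector for every
letter, although the basis grows in between. -/
theorem run_processRow {s : Memory F} (hs : Consts n d s) (hv : HoldsVec (0 : ℕ → F) s)
    {Top : Submodule F (ℕ → F)}
    (hT : ∀ f ∈ Top, (∀ c, lowCount n d ≤ c → f c = 0) → ∀ l < 2 * n, shift d n (l + 1) f ∈ Top)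
    {b : ℕ → ℕ → F} {Q : List ℕ} (hb : HoldsBasis n d b Q s)
    (hbT : Submodule.span F (Set.range b) ≤ Top) {r c : ℕ} (hr : Q[r]? = some c)
    (h41 : s.nvar 41 = r) :
    Run processRow s (2 * n * (lowCount n d * 6 + insertTime (base n ^ d) + 5) + 4) fun s' =>
      SameBelow 42 s s' ∧ HoldsVec (0 : ℕ → F) s' ∧ ∃ b' Q', HoldsBasis n d b' Q' s' ∧
        Submodule.span F (Set.range b) ≤ Submodule.span F (Set.range b') ∧
        Submodule.span F (Set.range b') ≤ Top ∧ Q <+: Q' ∧ (∀ e, b e ≠ 0 → b' e = b e) ∧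
        ∀ l < 2 * n, shift d n (l + 1) (b c) ∈ Submodule.span F (Set.range b') := by
  obtain ⟨hcL, hc0⟩ := (hb.mem c).1 (List.mem_of_getElem? hr)
  have hcT : b c ∈ Top := hbT (Submodule.subset_span ⟨c, rfl⟩)
  -- A row ends at its pivot. A pivot below `lowCount n d` therefore means that all words in the row
  -- are shorter than `d` and the row may be multiplied.
  have hclow : ∀ e, lowCount n d ≤ e → b c e = 0 := fun e he =>
    (hb.ech c hc0).2.2 e (by omega)
  refine (Run.pre (T := 2 * n * (lowCount n d * 6 + insertTime (base n ^ d) + 3 + 2) + 2)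
    ?_).mono (by simp only [List.length_cons, List.length_nil]; linarith) fun _ h => h
  generalize ht : List.foldl (fun s i => Instr.apply s i) s _ = s1
  have hs1 : SameBelow 42 s s1 := by simp [← ht, SameBelow.refl]
  have hq := hb.queue r c hr
  refine (Run.forLoop (N := 2 * n) (T := lowCount n d * 6 + insertTime (base n ^ d) + 3)
    (I := fun l t => t.nvar 43 = l ∧ SameBelow 42 s t ∧ t.nvar 42 = c ∧
      t.nvar 44 = l * lowCount n d ∧ HoldsVec (0 : ℕ → F) t ∧ ∃ b' Q', HoldsBasis n d b' Q' t ∧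
        Submodule.span F (Set.range b) ≤ Submodule.span F (Set.range b') ∧
        Submodule.span F (Set.range b') ≤ Top ∧ Q <+: Q' ∧ (∀ e, b e ≠ 0 → b' e = b e) ∧
        ∀ j < l, shift d n (j + 1) (b c) ∈ Submodule.span F (Set.range b'))
    ?_ ?_ ?_).mono le_rfl ?_
  · refine ⟨by simp, by simpa using hs1, by simp [← ht, h41, hq], by simp [← ht], ?_,
      b, Q, hb.congr (by simp [← ht]) (by simp [← ht]) (by simp [← ht]), le_rfl, hbT,
      List.prefix_refl _, fun _ _ => rfl, by simp⟩
    intro e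
    simpa [← ht] using hv e
  · rintro l t ⟨h1, h2, -⟩
    exact ⟨h1, (h2.nvar 8 (by omega)).trans hs.letters⟩
  · rintro l t hl ⟨h1, h2, h3, h4, h5, b1, Q1, hb1, k1, k2, k3, k4, k5⟩
    refine (Run.pre (T := lowCount n d * 6 + 2 + insertTime (base n ^ d)) ?_).mono
      (by simp; omega) fun _ h => h
    generalize ht2 : List.foldl (fun s i => Instr.apply s i) t _ = s2
    have hs2 : SameBelow 44 t s2 := by simp [← ht2, SameBelow.refl]
    have c2 := (hs.of_same h2).of_same hs2
    have hrow : b1 c = b c := k4 c hc0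
    have hb2 : HoldsBasis n d b1 Q1 s2 :=
      hb1.congr (by simp [← ht2]) (by simp [← ht2]) (by simp [← ht2])
    refine Run.seq ((run_shiftLoop c2 (c := c) (k := l + 1) (f := b c) ?_ ?_ ?_ ?_).mono le_rfl ?_)
    · intro e; simpa [← ht2] using h5 e
    · simp [← ht2, h3]
    · simp [← ht2, h4, (hs.of_same h2).low]; ring
    · intro e; rw [hb2.arr, hrow]
    rintro s3 ⟨g1, g2, g3, g4, g5⟩
    have c3 := c2.of_same g1
    have hb3 : HoldsBasis n d b1 Q1 s3 := hb2.congr g3 g5 (by simp [g4])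
    refine (run_insertVec c3 hb3 g2 (shift_eq_zero_of_le l hl (b c))).mono le_rfl ?_
    rintro s4 ⟨j1, j2, b4, Q4, hb4, hE, -⟩
    have hs34 : SameBelow 44 t s4 := hs2.trans ((g1.mono (by omega)).trans (j1.mono (by omega)))
    have hs44 : s4.nvar 44 = s2.nvar 44 := (j1.nvar 44 (by omega)).trans (g1.nvar 44 (by omega))
    have hmono : Submodule.span F (Set.range b1) ≤ Submodule.span F (Set.range b4) := by
      rw [hE.span]; exact le_sup_left
    refine ⟨(hs34.nvar 43 (by omega)).trans h1, (c3.of_same j1).one, by simp,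
      by simpa using h2.trans (hs34.mono (by omega)), ?_, ?_, fun e => by simpa using j2 e, b4, Q4,
      hb4.congr (by simp) (by simp) (by simp), k1.trans hmono, ?_, k3.trans hE.queue, ?_, ?_⟩
    · simpa using (hs34.nvar 42 (by omega)).trans h3
    · simp [hs44, ← ht2, h4, (hs.of_same h2).low]; ring
    · rw [hE.span]
      exact sup_le k2 ((Submodule.span_singleton_le_iff_mem _ _).2 (hT _ hcT hclow l hl))
    · intro e he
      rw [hE.rows e (by rw [k4 e he]; exact he), k4 e he]
    · intro j hj
      rcases Nat.lt_succ_iff_lt_or_eq.1 hj with h | rfl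
      · exact hmono (k5 j h)
      · rw [hE.span]
        exact Submodule.mem_sup_right (Submodule.mem_span_singleton_self _)
  · rintro t ⟨h1, h2, h3, h4, h5, h6⟩
    exact ⟨h2, h5, h6⟩

/-- Close the span of the basis under multiplication with letters. -/
def closureLoop : Prog := forLoop 41 6 (.ite (.lt 41 60) processRow skip)

/-- New rows may enter the queue while it is processed, but the queue only grows at its end and
earlier rows are final. Once each entry has been processed, all products of rows with small pivot
are in the span. This suffices by linearity, because a vector of the span with small support is a
combination of those rows. -/
theorem run_closureLoop {s : Memory F} (hs : Consts n d s) {G : Set (ℕ → F)}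
    {Top : Submodule F (ℕ → F)}
    (hT : ∀ f ∈ Top, (∀ c, lowCount n d ≤ c → f c = 0) → ∀ l < 2 * n, shift d n (l + 1) f ∈ Top)
    (h : Spans n d G Top s) :
    Run closureLoop s (lowCount n d *
        (2 * n * (lowCount n d * 6 + insertTime (base n ^ d) + 5) + 7) + 2) fun s' =>
      SameBelow 41 s s' ∧ HoldsVec (0 : ℕ → F) s' ∧ ∃ b Q, HoldsBasis n d b Q s' ∧
        G ⊆ Submodule.span F (Set.range b) ∧ Submodule.span F (Set.range b) ≤ Top ∧
        ∀ f ∈ Submodule.span F (Set.range b), (∀ c, lowCount n d ≤ c → f c = 0) →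
          ∀ l < 2 * n, shift d n (l + 1) f ∈ Submodule.span F (Set.range b) := by
  obtain ⟨hv, b, Q, hb, hG, hbT⟩ := h
  refine (Run.forLoop (N := lowCount n d)
    (T := 2 * n * (lowCount n d * 6 + insertTime (base n ^ d) + 5) + 5)
    (I := fun r t => t.nvar 41 = r ∧ SameBelow 41 s t ∧ HoldsVec (0 : ℕ → F) t ∧
      ∃ b Q, HoldsBasis n d b Q t ∧
        G ⊆ Submodule.span F (Set.range b) ∧ Submodule.span F (Set.range b) ≤ Top ∧
        ∀ j < r, ∀ c, Q[j]? = some c → ∀ l < 2 * n,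
          shift d n (l + 1) (b c) ∈ Submodule.span F (Set.range b)) ?_ ?_ ?_).mono le_rfl ?_
  · refine ⟨by simp, by simp [SameBelow.refl], fun e => by simpa using hv e, b, Q,
      hb.congr (by simp) (by simp) (by simp), hG, hbT, by simp⟩
  · rintro r t ⟨h1, h2, -⟩
    exact ⟨h1, (h2.nvar 6 (by omega)).trans hs.low⟩
  · rintro r t hr ⟨h1, h2, h3, b1, Q1, hb1, k1, k2, k3⟩
    have ht := hs.of_same h2
    refine Run.ite (T := 2 * n * (lowCount n d * 6 + insertTime (base n ^ d) + 5) + 4) ?_ ?_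
    · intro hlt
      have hlt : r < Q1.length := by simpa [Test.Holds, h1, hb1.len] using hlt
      refine (run_processRow ht h3 hT hb1 k2 (List.getElem?_eq_getElem hlt) h1).mono le_rfl ?_
      rintro t' ⟨g1, g2, b2, Q2, hb2, g3, g4, g5, g6, g7⟩
      have hst := h2.trans (g1.mono (by omega))
      refine ⟨(g1.nvar 41 (by omega)).trans h1, (hs.of_same hst).one, by simp, by simpa using hst,
        fun e => by simpa using g2 e, b2, Q2, hb2.congr (by simp) (by simp) (by simp),
        k1.trans g3, g4, ?_⟩
      intro j hj c hc l hl
      have hjlen : j < Q1.length := by omega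
      have hQ : Q2[j]? = some Q1[j] := by
        obtain ⟨Q', rfl⟩ := g5
        rw [List.getElem?_append_left hjlen, List.getElem?_eq_getElem hjlen]
      have hcj : c = Q1[j] := by rw [hQ] at hc; exact (Option.some.inj hc).symm
      have hne : b1 c ≠ 0 := ((hb1.mem c).1 (hcj ▸ List.getElem_mem hjlen)).2
      rw [g6 c hne]
      rcases Nat.lt_succ_iff_lt_or_eq.1 hj with h | rfl
      · exact g3 (k3 j h c (by rw [hcj]; exact List.getElem?_eq_getElem hjlen) l hl)
      · rw [hcj]; exact g7 l hl
    · intro hlt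
      have hlt : Q1.length ≤ r := by simpa [Test.Holds, h1, hb1.len] using hlt
      refine Run.skip ?_
      refine ⟨by simp [h1], by simp [ht.one], by simp, by simpa using h2,
        fun e => by simpa using h3 e, b1, Q1, hb1.congr (by simp) (by simp) (by simp), k1, k2, ?_⟩
      intro j hj c hc l hl
      have hjl : j < Q1.length := (List.getElem?_eq_some_iff.1 hc).1
      exact k3 j (by omega) c hc l hl
  · rintro t ⟨h1, h2, h3, b1, Q1, hb1, k1, k2, k3⟩
    refine ⟨h2, h3, b1, Q1, hb1, k1, k2, ?_⟩
    -- The queue consists of distinct pivots below `lowCount n d`, so `lowCount n d` rounds reach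
    -- every entry, including those appended on the way.
    have hlen : Q1.length ≤ lowCount n d := by
      have hsub : Q1 ⊆ List.range (lowCount n d) := fun c hc =>
        List.mem_range.2 ((hb1.mem c).1 hc).1
      simpa using (hb1.nodup.subperm hsub).length_le
    intro f hf hlow l hl
    obtain ⟨A, x, hA, rfl⟩ := hb1.ech.exists_sum_low hf hlow
    rw [map_sum]
    refine Submodule.sum_mem _ fun c hc => ?_
    rw [map_smul]
    obtain ⟨j, hj, hjc⟩ := List.getElem_of_mem ((hb1.mem c).2 (hA c hc))
    exact Submodule.smul_mem _ _ (k3 j (by omega) c (by rw [← hjc]; simp) l hl)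

/-- Decide whether the query is in the closure for example number `20`: variable `61` is `0` if so
and `1` otherwise. -/
def decideSample (d : ℕ) : Prog :=
  .seq clearBasis (.seq (rotLoop d) (.seq (swapLoop d) (.seq (valueLoop d)
    (.seq (forLoop 21 1 (.seq loadPoly insertVec)) (.seq closureLoop
      (pre [.const 21 0, .add 21 21 1] (.seq loadPoly (pre [.const 61 0] insertVec))))))))

/-- A bound on the time of `decideSample`. -/
def decideTime (n d ℓ : ℕ) : ℕ :=
  (base n ^ d * (base n ^ d * 4 + 4) + 3) +
  ((lowCount n d * (base n * (insertTime (base n ^ d) + 17) + 4) + 4) +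
  ((lowCount₂ n d * (base n * (base n * (insertTime (base n ^ d) + 21) +
        insertTime (base n ^ d) + 19) + 4) + 4) +
  ((lowCount n d * (n * (2 * insertTime (base n ^ d) + 34) + 4) + 3) +
  ((ℓ * (base n ^ d * (7 * d + 11) + 3 + insertTime (base n ^ d) + 2) + 2) +
  ((lowCount n d * (2 * n * (lowCount n d * 6 + insertTime (base n ^ d) + 5) + 7) + 2) +
  (2 + ((base n ^ d * (7 * d + 11) + 3) + (1 + insertTime (base n ^ d)))))))))

theorem run_decideSample {s : Memory F} (hs : Consts n d s) (hin : HasInput p q ε γ ρ s)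
    (hp : ∀ L ∈ p, L.IsRep d) (hq : q.IsRep d) (hv : HoldsVec (0 : ℕ → F) s)
    (hb : ∃ b Q, HoldsBasis n d b Q s) (e : Fin m) (he : s.nvar 20 = e) :
    Run (decideSample d) s (decideTime n d p.length) fun s' => SameBelow 21 s s' ∧
      HoldsVec (0 : ℕ → F) s' ∧ (∃ b Q, HoldsBasis n d b Q s') ∧
      (q.vec ∈ closureSpace d (ρ e) p ∧ s'.nvar 61 = 0 ∨
        q.vec ∉ closureSpace d (ρ e) p ∧ s'.nvar 61 = 1) := by
  have hcl := isClosedSpace_closureSpace d (ρ e) p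
  refine Run.seq ((run_clearBasis hs hv hb (closureSpace d (ρ e) p)).mono le_rfl ?_)
  rintro s1 ⟨h1, g1⟩
  have h1 : SameBelow 21 s s1 := h1.mono (by omega)
  refine Run.seq ((run_rotLoop (hs.of_same h1) g1 hcl.rel).mono le_rfl ?_)
  rintro s2 ⟨h2, g2⟩
  have h2 : SameBelow 21 s s2 := h1.trans (h2.mono (by omega))
  refine Run.seq ((run_swapLoop (hs.of_same h2) g2 hcl.rel).mono le_rfl ?_)
  rintro s3 ⟨h3, g3⟩
  have h3 : SameBelow 21 s s3 := h2.trans (h3.mono (by omega))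
  refine Run.seq ((run_valueLoop (hs.of_same h3) (hin.of_same h3) g3 e
    ((h3.nvar 20 (by omega)).trans he) hcl.rel).mono le_rfl ?_)
  rintro s4 ⟨h4, g4⟩
  have h4 : SameBelow 21 s s4 := h3.trans (h4.mono (by omega))
  have hin4 := hin.of_same h4
  refine Run.seq ((Run.forLoop_spans (n := n) (d := d) (N := p.length)
    (T := base n ^ d * (7 * d + 11) + 3 + insertTime (base n ^ d))
    (R := fun j => {f | ∃ L, p[j]? = some L ∧ f = TermList.vec L}) (E := fun _ _ => True)
    (hs.of_same h4) (by omega) (by omega) hin4.polys (by simp) g4 trivial ?_).mono le_rfl ?_)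
  · rintro j t G hj ht hjt - hG
    have ct := (hs.of_same h4).of_same ht
    have hL := hp p[j] (List.getElem_mem hj)
    obtain ⟨hvt, b, Q, hbt, hG⟩ := hG
    refine Run.seq ((run_loadPoly ct (hin4.of_same ht) hvt (j := j) (L := p[j]) ?_ hL hjt).mono
      le_rfl ?_)
    · rw [List.getElem?_append_left hj, List.getElem?_eq_getElem hj]
    rintro t1 ⟨k1, k2, k3, k4, k5⟩
    refine (run_insertVec_spans (ct.of_same k1) k2 (fun c => TermList.vec_eq_zero hL.1 c)
      (hcl.hyp _ (List.getElem_mem hj)) ⟨b, Q, hbt.congr k3 k5 (by simp [k4]), hG⟩).mono le_rfl ?_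
    rintro t2 ⟨j1, j2⟩
    refine ⟨k1.trans (j1.mono (by omega)), j2.mono ?_, trivial⟩
    rintro f (hf | ⟨L, hL', rfl⟩)
    · exact Or.inl hf
    · rw [List.getElem?_eq_getElem hj] at hL'
      cases hL'
      exact Or.inr rfl
  rintro s5 ⟨h5, g5, -⟩
  have h5 : SameBelow 21 s s5 := h4.trans (h5.mono (by omega))
  refine Run.seq ((run_closureLoop (hs.of_same h5) hcl.mul g5).mono le_rfl ?_)
  rintro s6 ⟨h6, hv6, b, Q, hb6, hG, hT, hmul⟩
  have h6 : SameBelow 21 s s6 := h5.trans (h6.mono (by omega))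
  -- Only elements of the closure were ever inserted, which gives one inclusion. The other holds
  -- because the final span is itself a closed space.
  have hW : Submodule.span F (Set.range b) = closureSpace d (ρ e) p := by
    refine le_antisymm hT (closureSpace_le ⟨?_, ?_, hmul⟩)
    · intro f hf
      apply hG
      cases hf with
      | rot w i hw hi => exact Or.inl (Or.inl (Or.inl (Or.inr ⟨w, hw, i, hi, rfl⟩)))
      | swap u i j hu hi hj =>
        exact Or.inl (Or.inl (Or.inr ⟨u, hu, i, hi, Or.inr ⟨j, hj, rfl⟩⟩))
      | idem u i hu hi => exact Or.inl (Or.inl (Or.inr ⟨u, hu, i, hi, Or.inl rfl⟩))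
      | compl w i hw => exact Or.inl (Or.inr ⟨w, hw, i, i.2, fun _ => Or.inl rfl⟩)
      | value w i b hw hb =>
        exact Or.inl (Or.inr ⟨w, hw, i, i.2, fun _ => Or.inr ⟨b, hb, rfl⟩⟩)
    · intro L hL
      apply hG
      obtain ⟨j, hj, rfl⟩ := List.getElem_of_mem hL
      exact Or.inr ⟨j, hj, p[j], List.getElem?_eq_getElem hj, rfl⟩
  refine Run.pre (is := [.const 21 0, .add 21 21 1]) ?_
  generalize ht7 : List.foldl (fun s i => Instr.apply s i) s6 _ = s7
  have h67 : SameBelow 21 s6 s7 := by simp [← ht7, SameBelow.refl]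
  have h7 := h6.trans h67
  have hb7 : HoldsBasis n d b Q s7 :=
    hb6.congr (by simp [← ht7]) (by simp [← ht7]) (by simp [← ht7])
  refine Run.seq ((run_loadPoly (hs.of_same h7) (hin.of_same h7) (j := p.length) (L := q) ?_
    (by simp) hq ?_).mono le_rfl ?_)
  · intro c; simpa [← ht7] using hv6 c
  · simpa [← ht7] using (hin.of_same h6).polys
  rintro s8 ⟨k1, k2, k3, k4, k5⟩
  have h8 : SameBelow 21 s s8 := h7.trans (k1.mono (by omega))
  -- Earlier insertions may have set the flag, so it is reset just before the query is inserted.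
  refine Run.pre (is := [.const 61 0]) ?_
  simp only [List.foldl_cons, List.foldl_nil, Instr.apply_const]
  have h9 : SameBelow 21 s (s8.setN 61 0) := by simpa using h8
  have hb9 : HoldsBasis n d b Q (s8.setN 61 0) :=
    hb7.congr (by simpa using k3) (by simpa using k5) (by simp [k4])
  refine (run_insertVec (hs.of_same h9) hb9 (v := q.vec) (fun c => by simpa using k2 c)
    (fun c => TermList.vec_eq_zero hq.1 c)).mono le_rfl ?_
  rintro s10 ⟨j1, j2, b', Q', hb10, -, hflag⟩
  refine ⟨h9.trans (j1.mono (by omega)), j2, ⟨b', Q', hb10⟩, ?_⟩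
  rw [hW] at hflag
  simpa using hflag

end Closure

/-! ## The algorithm -/

section Main

variable {F : Type*} [Field F] {sys : PCSystem} {n m d : ℕ} {p : List (TermList F sys n)}
  {q : TermList F sys n} {ε γ : ℝ} {ρ : Fin m → PAssign n}

/-- Compute the constants. -/
def initConsts (d : ℕ) : Prog :=
  pre [.const 3 1, .add 8 0 0, .add 4 8 3, .fzero 0, .fone 1, .fsub 2 0 1, .const 5 1,
    .const 14 d] (forLoop 30 14 (.seq
      (pre [.const 32 0] (forLoop 31 4 (block [.store 6 [30, 31] 32, .add 32 32 5])))
      (block [.const 7 0, .add 7 7 6, .const 6 0, .add 6 6 5, .const 5 0, .add 5 5 32])))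

/-- Powers arise by repeated addition: filling row `k` of the table with the multiples of `base n ^
k` leaves the next power in variable `32`. The variables for `words`, `low` and `low₂` then each
move one power up. -/
theorem run_initConsts :
    Run (initConsts d) (inputMemory p q ε γ ρ) (d * (base n * 5 + 12) + 10) fun s =>
      Consts n d s ∧ HasInput p q ε γ ρ s ∧ HoldsVec (0 : ℕ → F) s ∧
      (∃ b Q, HoldsBasis n d b Q s) ∧ s.nvar 12 = 0 ∧ s.nvar 13 = 0 := by
  refine (Run.pre (T := d * (base n * 5 + 10 + 2) + 2) ?_).mono
    (by simp only [List.length_cons, List.length_nil]; linarith) fun _ h => h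
  generalize ht : List.foldl (fun s i => Instr.apply s i) (inputMemory p q ε γ ρ) _ = s1
  refine (Run.forLoop (N := d) (T := base n * 5 + 10) (I := fun k t => t.nvar 30 = k ∧
    (∀ x < 30, x ≠ 5 → x ≠ 6 → x ≠ 7 → t.nvar x = s1.nvar x) ∧ t.nvar 60 = 0 ∧
    (∀ a < 6, t.narr a = s1.narr a) ∧ t.fvar = s1.fvar ∧ t.farr = s1.farr ∧
    t.nvar 5 = base n ^ k ∧ t.nvar 6 = lowCount n k ∧ t.nvar 7 = lowCount₂ n k ∧
    ∀ j < k, ∀ i < base n, t.narr 6 [j, i] = i * base n ^ j) ?_ ?_ ?_).mono le_rfl ?_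
  · refine ⟨by simp, ?_, ?_, by simp, by simp, by simp, ?_, ?_, ?_, by simp⟩
    · intro x hx h5 h6 h7
      simp [show x ≠ 30 by omega]
    · simp [← ht, inputMemory]
    · simp [← ht]
    · simp [← ht, inputMemory, lowCount]
    · simp [← ht, inputMemory, lowCount₂]
  · rintro k t ⟨h1, h2, -⟩
    exact ⟨h1, by rw [h2 14 (by omega) (by omega) (by omega) (by omega)]; simp [← ht]⟩
  · rintro k t hk ⟨h1, h2, h3, h4, h5, h6, h7, h8, h9, h10⟩
    have h3one : t.nvar 3 = 1 := by
      rw [h2 3 (by omega) (by omega) (by omega) (by omega)]; simp [← ht]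
    have h4base : t.nvar 4 = base n := by
      rw [h2 4 (by omega) (by omega) (by omega) (by omega)]
      simp [← ht, inputMemory, base]; omega
    refine (Run.seq (T₂ := 7) ((Run.pre (T := base n * (3 + 2) + 2) ?_).mono le_rfl
      fun _ h => h)).mono (by simp; omega) fun _ h => h
    simp only [List.foldl_cons, List.foldl_nil, Instr.apply_const]
    refine (Run.forLoop (N := base n) (T := 3) (I := fun i u => u.nvar 31 = i ∧
      (∀ x < 31, u.nvar x = t.nvar x) ∧ u.nvar 60 = 0 ∧ u.nvar 32 = i * base n ^ k ∧
      (∀ a < 6, u.narr a = t.narr a) ∧ u.fvar = t.fvar ∧ u.farr = t.farr ∧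
      ∀ j e, u.narr 6 [j, e] = if j = k ∧ e < i then e * base n ^ k else t.narr 6 [j, e])
      ?_ ?_ ?_).mono le_rfl ?_
    · refine ⟨by simp, fun x hx => ?_, by simp [h3], by simp, by simp, by simp, by simp, by simp⟩
      simp [show x ≠ 31 by omega, show x ≠ 32 by omega]
    · rintro i u ⟨g1, g2, -⟩
      exact ⟨g1, (g2 4 (by omega)).trans h4base⟩
    · rintro i u hi ⟨g1, g2, g3, g4, g5, g6, g7, g8⟩
      have u30 := (g2 30 (by omega)).trans h1
      have u3 := (g2 3 (by omega)).trans h3one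
      have u5 := (g2 5 (by omega)).trans h7
      refine Run.block ?_ (by simp)
      refine ⟨by simp [g1], by simp [u3], by simp, fun x hx => ?_, by simp [g3],
        by simp [g4, u5]; ring, fun a ha => ?_, by simp [g6], by simp [g7], fun j e => ?_⟩
      · simp [show x ≠ 31 by omega, show x ≠ 32 by omega, show x ≠ 99 by omega, g2 x hx]
      · funext x
        simp [show a ≠ 6 by omega, g5 a ha]
      · simp [u30, g1, g4, g8]
        by_cases hj : j = k
        · rcases lt_trichotomy e i with h | h | h
          · simp [hj, h, h.le, h.ne]
          · simp [hj, h]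
          · simp [hj, show ¬ e < i by omega, show ¬ e ≤ i by omega, h.ne']
        · simp [hj]
    · rintro u ⟨g1, g2, g3, g4, g5, g6, g7, g8⟩
      refine Run.block ?_ (by simp)
      have u30 := (g2 30 (by omega)).trans h1
      have u3 := (g2 3 (by omega)).trans h3one
      have u5 := (g2 5 (by omega)).trans h7
      have u6 := (g2 6 (by omega)).trans h8
      refine ⟨by simp [u30], by simp [u3], by simp, fun x hx hx5 hx6 hx7 => ?_, by simp [g3],
        fun a ha => by simp [g5 a ha, h4 a ha], by simp [g6, h5], by simp [g7, h6],
        by simp [g4]; ring, by simp [u5, lowCount], by simp [u6, lowCount₂], ?_⟩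
      · simp [show x ≠ 30 by omega, show x ≠ 99 by omega, hx5, hx6, hx7, g2 x (by omega),
          h2 x hx hx5 hx6 hx7]
      · intro j hj i hi
        simp only [Memory.setN_narr, List.foldl_cons, List.foldl_nil, Instr.apply_const,
          Instr.apply_add]
        rw [g8]
        rcases Nat.lt_succ_iff_lt_or_eq.1 hj with h | rfl
        · rw [if_neg (by omega), h10 j h i hi]
        · rw [if_pos ⟨rfl, hi⟩]
  · rintro t ⟨h1, h2, h3, h4, h5, h6, h7, h8, h9, h10⟩
    refine ⟨⟨?_, ?_, h7, h8, h9, ?_, ?_, ?_, ?_, ?_, h10⟩, ⟨?_, ?_, ?_, ?_⟩, ?_, ⟨0, [], ?_⟩, ?_,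
      ?_⟩
    · rw [h2 3 (by omega) (by omega) (by omega) (by omega)]; simp [← ht]
    · rw [h2 4 (by omega) (by omega) (by omega) (by omega)]
      simp [← ht, inputMemory, base]; omega
    · rw [h2 8 (by omega) (by omega) (by omega) (by omega)]
      simp [← ht, inputMemory]; omega
    · simp [h5, ← ht]
    · simp [h5, ← ht]
    · simp [h5, ← ht]
    · rw [h2 0 (by omega) (by omega) (by omega) (by omega)]; simp [← ht, inputMemory]
    · rw [h2 1 (by omega) (by omega) (by omega) (by omega)]; simp [← ht, inputMemory]
    · rw [h2 2 (by omega) (by omega) (by omega) (by omega)]; simp [← ht, inputMemory]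
    · intro a ha
      rw [h4 a ha]; simp [← ht]
    · simp [h6, ← ht]
    · intro c
      simp [h6, ← ht, inputMemory]
    · refine ⟨fun c e => ?_, isEchelon_zero _, by simpa using h3, by simp, by simp, by simp⟩
      simp [h6, ← ht, inputMemory]
    · rw [h2 12 (by omega) (by omega) (by omega) (by omega)]; simp [← ht, inputMemory]
    · rw [h2 13 (by omega) (by omega) (by omega) (by omega)]; simp [← ht, inputMemory]

/-- Compute in variable `10` a power `P` of two that is at least the number of examples, and in
variable `11` the integer part of `ε * P`. -/
def initThreshold : Prog :=
  pre [.const 10 1, .const 11 0] (forLoop 30 2 (.ite (.lt 10 2)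
    (block [.add 10 10 10, .add 11 11 11, .load 31 4 [30], .add 11 11 31]) skip))

/-- Doubling shifts the binary expansion by one place, and the next digit enters the integer part.
-/
theorem floor_mul_two_pow_succ (r : ℝ) (k : ℕ) :
    ⌊r * 2 ^ (k + 1)⌋₊ = 2 * ⌊r * 2 ^ k⌋₊ + bit r k := by
  have h : ⌊r * 2 ^ (k + 1)⌋₊ / 2 = ⌊r * 2 ^ k⌋₊ := by
    have := Nat.floor_div_natCast (r * 2 ^ (k + 1)) 2
    rw [← this]
    congr 1
    rw [pow_succ]
    push_cast
    ring
  rw [bit, ← h]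
  omega

theorem run_initThreshold {s : Memory F} (hs : Consts n d s) (hin : HasInput p q ε γ ρ s)
    (hε1 : ε < 1) :
    Run initThreshold s (m * 8 + 4) fun t => SameBelow 10 s t ∧ t.farr = s.farr ∧
      t.nvar 60 = s.nvar 60 ∧ t.narr = s.narr ∧ t.nvar 12 = s.nvar 12 ∧ t.nvar 13 = s.nvar 13 ∧
      m ≤ t.nvar 10 ∧ 0 < t.nvar 10 ∧ t.nvar 11 = ⌊ε * t.nvar 10⌋₊ := by
  refine (Run.pre (T := m * (6 + 2) + 2) ?_).mono (by simp; omega) fun _ h => h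
  generalize ht : List.foldl (fun s i => Instr.apply s i) s _ = s1
  -- The exponent `j` equals the number of rounds until `2 ^ j` reaches `m`, and is then frozen. If
  -- it is never frozen, `j = m` suffices because `m < 2 ^ m`.
  refine (Run.forLoop (N := m) (T := 6) (I := fun k t => t.nvar 30 = k ∧ SameBelow 10 s t ∧
    t.farr = s.farr ∧ t.nvar 60 = s.nvar 60 ∧ t.narr = s.narr ∧ t.nvar 12 = s.nvar 12 ∧
    t.nvar 13 = s.nvar 13 ∧ ∃ j, (j = k ∨ m ≤ 2 ^ j) ∧ t.nvar 10 = 2 ^ j ∧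
      t.nvar 11 = ⌊ε * 2 ^ j⌋₊) ?_ ?_ ?_).mono le_rfl ?_
  · refine ⟨by simp, by simp [← ht, SameBelow.refl], by simp [← ht], by simp [← ht],
      by simp [← ht], by simp [← ht], by simp [← ht], 0, Or.inl rfl, by simp [← ht], ?_⟩
    simp [← ht, Nat.floor_eq_zero.2 hε1]
  · rintro k t ⟨h1, h2, -⟩
    exact ⟨h1, (h2.nvar 2 (by omega)).trans hin.samples⟩
  · rintro k t hk ⟨h1, h2, h3, h4, h5, h6, h7, j, h8, h9, h10⟩
    have hone := (hs.of_same h2).one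
    have hsam := (hin.of_same h2).samples
    refine Run.ite (T := 5) ?_ ?_
    · intro hlt
      have hj : j = k := by
        rcases h8 with h | h
        · exact h
        · simp only [Test.Holds, h9, hsam] at hlt; omega
      subst hj
      have hbit : t.narr 4 [j] = bit ε j := by
        rw [(hin.of_same h2).narr 4 (by omega)]; simp [inputMemory]
      refine Run.block ?_ (by simp)
      refine ⟨by simp [h1], by simp [hone], by simp, by simpa using h2, by simp [h3],
        by simp [h4], by simp [h5], by simp [h6], by simp [h7], j + 1, Or.inl rfl,
        by simp [h9]; ring, ?_⟩
      rw [floor_mul_two_pow_succ]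
      simp [h1, h10, hbit]
      ring
    · intro hlt
      refine Run.skip ?_
      refine ⟨by simp [h1], by simp [hone], by simp, by simpa using h2, by simp [h3],
        by simp [h4], by simp [h5], by simp [h6], by simp [h7], j, Or.inr ?_,
        by simp [h9], by simp [h10]⟩
      simp only [Test.Holds, h9, hsam] at hlt
      omega
  · rintro t ⟨h1, h2, h3, h4, h5, h6, h7, j, h8, h9, h10⟩
    refine ⟨h2, h3, h4, h5, h6, h7, ?_, ?_, ?_⟩
    · rw [h9]
      rcases h8 with rfl | h
      · exact Nat.lt_two_pow_self.le
      · exact h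
    · rw [h9]; positivity
    · rw [h10, h9]; push_cast; rfl

open Classical in
/-- The number of examples for which the query is not in the closure. -/
noncomputable def failures (d : ℕ) (p : List (TermList F sys n)) (q : TermList F sys n)
    (ρ : Fin m → PAssign n) : ℕ :=
  (Finset.univ.filter fun i => q.vec ∉ closureSpace d (ρ i) p).card

/-- Add `P` to variable `12` for every failure, and `⌊ε * P⌋` to variable `13` for every
example. -/
def samplesLoop (d : ℕ) : Prog :=
  forLoop 20 2 (.seq (decideSample d) (.ite (.lt 61 3) (block [.add 13 13 11])
    (block [.add 12 12 10, .add 13 13 11])))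

/-- Both sides of the final comparison, `P` times the failures and `⌊ε * P⌋ * m`, are products that
the machine can only form by adding once per example. -/
theorem run_samplesLoop {s : Memory F} (hs : Consts n d s) (hin : HasInput p q ε γ ρ s)
    (hp : ∀ L ∈ p, L.IsRep d) (hq : q.IsRep d) (hv : HoldsVec (0 : ℕ → F) s)
    (hb : ∃ b Q, HoldsBasis n d b Q s) (h12 : s.nvar 12 = 0) (h13 : s.nvar 13 = 0) :
    Run (samplesLoop d) s (m * (decideTime n d p.length + 6) + 2) fun t =>
      t.nvar 12 = s.nvar 10 * failures d p q ρ ∧ t.nvar 13 = s.nvar 11 * m := by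
  classical
  refine (Run.forLoop (N := m) (T := decideTime n d p.length + 4) (I := fun k t =>
    t.nvar 20 = k ∧ SameBelow 12 s t ∧ HoldsVec (0 : ℕ → F) t ∧ (∃ b Q, HoldsBasis n d b Q t) ∧
    t.nvar 12 = s.nvar 10 * (Finset.univ.filter fun i : Fin m =>
      i.1 < k ∧ q.vec ∉ closureSpace d (ρ i) p).card ∧ t.nvar 13 = s.nvar 11 * k)
    ?_ ?_ ?_).mono le_rfl ?_
  · obtain ⟨b, Q, hb⟩ := hb
    exact ⟨by simp, by simp [SameBelow.refl], fun c => by simpa using hv c,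
      ⟨b, Q, hb.congr (by simp) (by simp) (by simp)⟩, by simp [h12], by simp [h13]⟩
  · rintro k t ⟨h1, h2, -⟩
    exact ⟨h1, (h2.nvar 2 (by omega)).trans hin.samples⟩
  · rintro k t hk ⟨h1, h2, h3, h4, h5, h6⟩
    have ht := hs.of_same h2
    refine Run.seq ((run_decideSample ht (hin.of_same h2) hp hq h3 h4 ⟨k, hk⟩ h1).mono le_rfl ?_)
    rintro t1 ⟨g1, g2, ⟨b1, Q1, g3⟩, g4⟩
    have hs1 := h2.trans (g1.mono (by omega))
    have hone := (hs.of_same hs1).one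
    have e20 := (g1.nvar 20 (by omega)).trans h1
    have e10 := hs1.nvar 10 (by omega)
    have e11 := hs1.nvar 11 (by omega)
    have e12 := (g1.nvar 12 (by omega)).trans h5
    have e13 := (g1.nvar 13 (by omega)).trans h6
    refine Run.ite (T := 3) ?_ ?_
    · intro hlt
      simp only [Test.Holds, hone] at hlt
      have hmem : q.vec ∈ closureSpace d (ρ ⟨k, hk⟩) p := by
        rcases g4 with h | h
        · exact h.1
        · omega
      refine Run.block ?_ (by simp)
      refine ⟨by simp [e20], by simp [hone], by simp, by simpa using hs1,
        fun c => by simpa using g2 c, ⟨b1, Q1, g3.congr (by simp) (by simp) (by simp)⟩, ?_,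
        by simp [e13, e11]; ring⟩
      have : (Finset.univ.filter fun i : Fin m =>
          i.1 < k + 1 ∧ q.vec ∉ closureSpace d (ρ i) p) =
          Finset.univ.filter fun i : Fin m => i.1 < k ∧ q.vec ∉ closureSpace d (ρ i) p := by
        ext i
        simp only [Finset.mem_filter, Finset.mem_univ, true_and]
        refine ⟨fun h => ⟨?_, h.2⟩, fun h => ⟨by omega, h.2⟩⟩
        by_contra hne
        have : i = ⟨k, hk⟩ := Fin.ext (by simp; omega)
        exact h.2 (this ▸ hmem)
      rw [this]
      simp [e12]
    · intro hlt
      simp only [Test.Holds, hone] at hlt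
      have hmem : q.vec ∉ closureSpace d (ρ ⟨k, hk⟩) p := by
        rcases g4 with h | h
        · omega
        · exact h.1
      refine Run.block ?_ (by simp)
      refine ⟨by simp [e20], by simp [hone], by simp, by simpa using hs1,
        fun c => by simpa using g2 c, ⟨b1, Q1, g3.congr (by simp) (by simp) (by simp)⟩, ?_,
        by simp [e13, e11]; ring⟩
      have : (Finset.univ.filter fun i : Fin m =>
          i.1 < k + 1 ∧ q.vec ∉ closureSpace d (ρ i) p) = insert ⟨k, hk⟩
          (Finset.univ.filter fun i : Fin m => i.1 < k ∧ q.vec ∉ closureSpace d (ρ i) p) := by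
        ext i
        simp only [Finset.mem_filter, Finset.mem_univ, true_and, Finset.mem_insert]
        constructor
        · rintro ⟨h, h'⟩
          by_cases hik : i.1 < k
          · exact Or.inr ⟨hik, h'⟩
          · exact Or.inl (Fin.ext (by simp; omega))
        · rintro (rfl | h)
          · exact ⟨by simp, hmem⟩
          · exact ⟨by omega, h.2⟩
      rw [this, Finset.card_insert_of_notMem (by simp)]
      simp [e12, e10]
      ring
  · rintro t ⟨h1, h2, h3, h4, h5, h6⟩
    refine ⟨?_, h6⟩
    rw [h5, failures]
    simp

/-- The algorithm. -/
def learner (d : ℕ) : Prog :=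
  .seq (initConsts d) (.seq initThreshold (.seq (samplesLoop d)
    (.ite (.lt 13 12) (block [.const 0 0]) (block [.const 0 1]))))

/-- The number of steps of the algorithm. -/
def learnerTime (n d ℓ m : ℕ) : ℕ :=
  d * (base n * 5 + 12) + 10 + ((m * 8 + 4) + ((m * (decideTime n d ℓ + 6) + 2) + 3))

theorem run_learner (hp : ∀ L ∈ p, L.IsRep d) (hq : q.IsRep d) (hε1 : ε < 1) :
    ∃ P : ℕ, m ≤ P ∧ 0 < P ∧
      Run (learner d) (inputMemory p q ε γ ρ) (learnerTime n d p.length m) fun s =>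
        s.nvar 0 = if ⌊ε * P⌋₊ * m < P * failures d p q ρ then 0 else 1 := by
  have key : Run (learner d) (inputMemory p q ε γ ρ) (learnerTime n d p.length m) fun s =>
      ∃ P : ℕ, m ≤ P ∧ 0 < P ∧
        s.nvar 0 = if ⌊ε * P⌋₊ * m < P * failures d p q ρ then 0 else 1 := by
    refine Run.seq (run_initConsts.mono le_rfl ?_)
    rintro s1 ⟨c1, i1, v1, ⟨b, Q, b1⟩, e12, e13⟩
    refine Run.seq ((run_initThreshold c1 i1 hε1).mono le_rfl ?_)
    rintro s2 ⟨h2, a1, a2, a3, a4, a5, hm, hP, hE⟩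
    refine Run.seq ((run_samplesLoop (c1.of_same h2) (i1.of_same h2) hp hq
      (fun c => by rw [a1]; exact v1 c)
      ⟨b, Q, b1.congr (fun c t => by rw [a1]) a2 (fun r => by rw [a3])⟩
      (a4.trans e12) (a5.trans e13)).mono le_rfl ?_)
    rintro s3 ⟨k12, k13⟩
    rw [hE] at k13
    refine Run.ite (T := 2) ?_ ?_
    · intro hlt
      simp only [Test.Holds, k12, k13] at hlt
      refine Run.block ⟨s2.nvar 10, hm, hP, ?_⟩ (by simp)
      rw [if_pos hlt]; simp
    · intro hlt
      simp only [Test.Holds, k12, k13] at hlt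
      refine Run.block ⟨s2.nvar 10, hm, hP, ?_⟩ (by simp)
      rw [if_neg hlt]; simp
  obtain ⟨t, s', he, ht, P, hm, hP, h⟩ := key
  exact ⟨P, hm, hP, t, s', he, ht, h⟩

end Main

/-! ## The running time and the sample size -/

section Time

theorem lowCount_mul_base_le (n d : ℕ) : lowCount n d * base n ≤ base n ^ d := by
  rcases Nat.eq_zero_or_pos d with rfl | hd
  · simp [lowCount]
  · exact (lowCount_mul_base hd).le

theorem lowCount₂_mul_base_le (n d : ℕ) : lowCount₂ n d * base n ≤ lowCount n d := by
  rcases d with _ | d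
  · simp [lowCount₂]
  · exact lowCount_mul_base_le n d

/-- With `N = base n ^ d`, each family of relations has at most `N` members, as has the set of
products of short rows with letters, and there are `ℓ` hypotheses and one query. Each insertion
costs at most `30 N²`, and everything else is of lower order. -/
theorem decideTime_le (n d ℓ : ℕ) :
    decideTime n d ℓ ≤ (7 * d + 400) * ((ℓ + base n ^ d) * (base n ^ d) ^ 2) := by
  have hN : 1 ≤ base n ^ d := Nat.one_le_pow _ _ (by unfold base; omega)
  have hL := lowCount_le n d
  have hL2 := lowCount₂_le n d
  have hLB := lowCount_mul_base_le n d
  have hL2B := lowCount₂_mul_base_le n d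
  have hL2BB : lowCount₂ n d * base n * base n ≤ base n ^ d :=
    (Nat.mul_le_mul_right _ hL2B).trans hLB
  have hLn : lowCount n d * (2 * n) ≤ base n ^ d :=
    (Nat.mul_le_mul_left _ (by unfold base; omega)).trans hLB
  unfold decideTime insertTime
  generalize base n ^ d = N at *
  generalize lowCount n d = L at *
  generalize lowCount₂ n d = L₂ at *
  generalize base n = B at *
  have hNN : N ≤ N ^ 2 := by nlinarith
  have hNNN : N ^ 2 ≤ N ^ 3 := by nlinarith
  have hIT : N * (N * 8 + 20) + 2 ≤ 30 * N ^ 2 := by nlinarith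
  generalize N * (N * 8 + 20) + 2 = I at *
  have e1 : L * (B * (I + 17) + 4) ≤ 51 * N ^ 3 := by
    calc L * (B * (I + 17) + 4) = (L * B) * (I + 17) + 4 * L := by ring
      _ ≤ N * (30 * N ^ 2 + 17 * N ^ 2) + 4 * N ^ 3 := by
          gcongr
          · nlinarith
          · nlinarith
      _ = 51 * N ^ 3 := by ring
  have e2 : L₂ * (B * (B * (I + 21) + I + 19) + 4) ≤ 104 * N ^ 3 := by
    calc L₂ * (B * (B * (I + 21) + I + 19) + 4)
        = (L₂ * B * B) * (I + 21) + (L₂ * B) * (I + 19) + 4 * L₂ := by ring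
      _ ≤ N * (30 * N ^ 2 + 21 * N ^ 2) + N * (30 * N ^ 2 + 19 * N ^ 2) + 4 * N ^ 3 := by
          gcongr
          · nlinarith
          · omega
          · nlinarith
          · nlinarith
      _ = 104 * N ^ 3 := by ring
  have e3 : L * (n * (2 * I + 34) + 4) ≤ 98 * N ^ 3 := by
    calc L * (n * (2 * I + 34) + 4) = (L * (2 * n)) * (I + 17) + 4 * L := by ring
      _ ≤ N * (30 * N ^ 2 + 64 * N ^ 2) + 4 * N ^ 3 := by
          gcongr
          · nlinarith
          · nlinarith
      _ = 98 * N ^ 3 := by ring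
  have e4 : ℓ * (N * (7 * d + 11) + 3 + I + 2) ≤ (7 * d + 46) * (ℓ * N ^ 2) := by
    calc ℓ * (N * (7 * d + 11) + 3 + I + 2)
        ≤ ℓ * (N ^ 2 * (7 * d + 11) + 3 * N ^ 2 + 30 * N ^ 2 + 2 * N ^ 2) := by
          gcongr <;> nlinarith
      _ = (7 * d + 46) * (ℓ * N ^ 2) := by ring
  have e5 : L * (2 * n * (L * 6 + I + 5) + 7) ≤ 48 * N ^ 3 := by
    calc L * (2 * n * (L * 6 + I + 5) + 7) = (L * (2 * n)) * (L * 6 + I + 5) + 7 * L := by ring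
      _ ≤ N * (N ^ 2 * 6 + 30 * N ^ 2 + 5 * N ^ 2) + 7 * N ^ 3 := by
          gcongr
          · nlinarith
          · nlinarith
          · nlinarith
      _ = 48 * N ^ 3 := by ring
  have e6 : N * (7 * d + 11) ≤ (7 * d + 11) * N ^ 3 := by
    calc N * (7 * d + 11) ≤ N ^ 3 * (7 * d + 11) := by gcongr; omega
      _ = (7 * d + 11) * N ^ 3 := by ring
  have e7 : N * (N * 4 + 4) ≤ 8 * N ^ 3 := by nlinarith
  have e8 : (7 * d + 400) * ((ℓ + N) * N ^ 2) =
      (7 * d + 46) * (ℓ * N ^ 2) + 354 * (ℓ * N ^ 2) + (7 * d + 11) * N ^ 3 + 389 * N ^ 3 := by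
    ring
  rw [e8]
  omega

/-- The setup does not depend on the examples; `m + 1` instead of `m` pays for it. -/
theorem learnerTime_le (n d ℓ m : ℕ) :
    learnerTime n d ℓ m ≤
      (24 * d + 440) * ((m + 1) * ((ℓ + base n ^ d) * (base n ^ d) ^ 2)) := by
  have h := decideTime_le n d ℓ
  have hN : 1 ≤ base n ^ d := Nat.one_le_pow _ _ (by unfold base; omega)
  have hX : base n ^ d ≤ (ℓ + base n ^ d) * (base n ^ d) ^ 2 := by
    calc base n ^ d = base n ^ d * 1 := (mul_one _).symm
      _ ≤ (ℓ + base n ^ d) * (base n ^ d) ^ 2 := by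
          gcongr
          · omega
          · exact Nat.one_le_pow _ _ hN
  have hd : d * (base n * 5 + 12) ≤ 17 * d * base n ^ d := by
    rcases Nat.eq_zero_or_pos d with rfl | hd
    · simp
    · have hB : base n ≤ base n ^ d := Nat.le_self_pow hd.ne' _
      calc d * (base n * 5 + 12) ≤ d * (base n ^ d * 5 + 12 * base n ^ d) := by
            gcongr
            omega
        _ = 17 * d * base n ^ d := by ring
  unfold learnerTime
  generalize (ℓ + base n ^ d) * (base n ^ d) ^ 2 = X at *
  generalize base n ^ d = N at *
  have h1 : m * (decideTime n d ℓ + 6) ≤ m * ((7 * d + 400) * X + 6 * X) := by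
    gcongr
    omega
  have h2 : 17 * d * N ≤ 17 * d * X := by gcongr
  have h3 : m ≤ m * X := Nat.le_mul_of_pos_right _ (by omega)
  have e : (24 * d + 440) * ((m + 1) * X) = m * ((7 * d + 400) * X + 6 * X) + 17 * (d * (m * X)) +
      34 * (m * X) + 17 * d * X + 7 * (d * X) + 440 * X := by ring
  rw [e]
  omega

/-- The sample size. -/
noncomputable def sampleSize (γ δ : ℝ) : ℕ := ⌈4 * (1 / γ ^ 2 * Real.log (2 / δ))⌉₊

variable {γ δ : ℝ}

theorem half_le_log (hδ : 0 < δ) (hδ1 : δ < 1) : 1 / 2 ≤ Real.log (2 / δ) := by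
  have h1 : Real.log 2 ≤ Real.log (2 / δ) :=
    Real.log_le_log (by norm_num) (by rw [le_div_iff₀ hδ]; linarith)
  have := Real.log_two_gt_d9
  linarith

theorem half_le_sample (hγ : 0 < γ) (hγ1 : γ < 1) (hδ : 0 < δ) (hδ1 : δ < 1) :
    1 / 2 ≤ 1 / γ ^ 2 * Real.log (2 / δ) := by
  have h1 := half_le_log hδ hδ1
  have h2 : 1 ≤ 1 / γ ^ 2 := by
    rw [le_div_iff₀ (by positivity)]
    nlinarith
  nlinarith

theorem sampleSize_add_one_le (hγ : 0 < γ) (hγ1 : γ < 1) (hδ : 0 < δ) (hδ1 : δ < 1) :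
    (sampleSize γ δ : ℝ) + 1 ≤ 8 * (1 / γ ^ 2 * Real.log (2 / δ)) := by
  have h := half_le_sample hγ hγ1 hδ hδ1
  have := (Nat.ceil_lt_add_one (a := 4 * (1 / γ ^ 2 * Real.log (2 / δ))) (by positivity)).le
  unfold sampleSize
  linarith

theorem four_mul_log_le (hγ : 0 < γ) : 4 * Real.log (2 / δ) ≤ γ ^ 2 * sampleSize γ δ := by
  have h : 4 * (1 / γ ^ 2 * Real.log (2 / δ)) ≤ sampleSize γ δ := Nat.le_ceil _
  calc 4 * Real.log (2 / δ) = γ ^ 2 * (4 * (1 / γ ^ 2 * Real.log (2 / δ))) := by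
        field_simp
    _ ≤ γ ^ 2 * sampleSize γ δ := by gcongr

/-- Guarantees that half of the margin, `γ / 2 * m`, is at least one example, which is what rounding
`ε` costs. With `log (2 / δ) ≥ 1 / 2`, the factor 4 in the sample size yields exactly this bound. -/
theorem two_le_mul_sampleSize (hγ : 0 < γ) (hγ1 : γ < 1) (hδ : 0 < δ) (hδ1 : δ < 1) :
    2 ≤ γ * sampleSize γ δ := by
  have h1 := half_le_log hδ hδ1
  have h2 := four_mul_log_le (δ := δ) hγ
  have h3 : γ ^ 2 * sampleSize γ δ ≤ γ * sampleSize γ δ := by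
    gcongr
    nlinarith
  linarith

theorem exp_neg_sampleSize_le (hγ : 0 < γ) (hδ : 0 < δ) (hδ1 : δ < 1) {r : ℝ}
    (hr : γ / 2 ≤ r) : Real.exp (-(2 * r ^ 2 * sampleSize γ δ)) ≤ δ := by
  have h2 := four_mul_log_le (δ := δ) hγ
  have h1 := half_le_log hδ hδ1
  -- For `r ≥ γ / 2` the exponent is at least `γ² m / 2`, hence at least `2 log (2 / δ)`, twice what
  -- is needed.
  have h3 : γ ^ 2 / 4 ≤ r ^ 2 := by nlinarith
  have h4 : γ ^ 2 / 4 * sampleSize γ δ ≤ r ^ 2 * sampleSize γ δ := by gcongr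
  calc Real.exp (-(2 * r ^ 2 * sampleSize γ δ)) ≤ Real.exp (-Real.log (2 / δ)) := by
        apply Real.exp_le_exp.2
        linarith
    _ = δ / 2 := by rw [Real.exp_neg, Real.exp_log (by positivity), inv_div]
    _ ≤ δ := by linarith

end Time

/-! ### Acceptance, rejection and halting -/

section Correctness

open MeasureTheory

variable {F : Type*} [Field F] {sys : PCSystem} {n m d : ℕ} {p : List (TermList F sys n)}
  {q : TermList F sys n} {ε γ δ : ℝ}

/-- Replacing `ε * P` by its floor lowers the threshold by at most `m ≤ P`, while the margin `γ / 2
* m ≥ 1` is worth at least `P` after multiplication by `P`. -/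
theorem accepts_learner {ρ : Fin m → PAssign n} (hp : ∀ L ∈ p, L.IsRep d) (hq : q.IsRep d)
    (hε1 : ε < 1) (hγm : 2 ≤ γ * m) (h : (failures d p q ρ : ℝ) < (ε - γ / 2) * m) :
    Accepts (learner d) (inputMemory p q ε γ ρ) := by
  obtain ⟨P, hm, hP, t, s', he, -, hs'⟩ := run_learner (γ := γ) (ρ := ρ) hp hq hε1
  refine ⟨t, s', he, ?_⟩
  rw [hs', if_neg]
  intro hlt
  have hlt' : (⌊ε * P⌋₊ : ℝ) * m < P * failures d p q ρ := by exact_mod_cast hlt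
  have hfl : ε * P < ⌊ε * P⌋₊ + 1 := Nat.lt_floor_add_one _
  have hm' : (m : ℝ) ≤ P := by exact_mod_cast hm
  have hP' : (0 : ℝ) < P := by exact_mod_cast hP
  have h1 : (P : ℝ) * failures d p q ρ ≤ P * ((ε - γ / 2) * m) := by gcongr
  have h2 : (ε * P) * m ≤ (⌊ε * P⌋₊ + 1) * m := by gcongr
  have h3 : (P : ℝ) * 2 ≤ P * (γ * m) := by gcongr
  linarith

/-- Rounding the threshold down only favours rejection, so no margin is needed here. -/
theorem rejects_learner {ρ : Fin m → PAssign n} (hp : ∀ L ∈ p, L.IsRep d) (hq : q.IsRep d)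
    (hε : 0 < ε) (hε1 : ε < 1) (h : ε * m < (failures d p q ρ : ℝ)) :
    Rejects (learner d) (inputMemory p q ε γ ρ) := by
  obtain ⟨P, hm, hP, t, s', he, -, hs'⟩ := run_learner (γ := γ) (ρ := ρ) hp hq hε1
  refine ⟨t, s', he, ?_⟩
  rw [hs', if_pos]
  have hP' : (0 : ℝ) < P := by exact_mod_cast hP
  have hfl : (⌊ε * P⌋₊ : ℝ) ≤ ε * P := Nat.floor_le (by positivity)
  have h1 : (P : ℝ) * (ε * m) < P * failures d p q ρ := by gcongr
  have h2 : (⌊ε * P⌋₊ : ℝ) * m ≤ (ε * P) * m := by gcongr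
  have : (⌊ε * P⌋₊ : ℝ) * m < P * failures d p q ρ := by linarith
  exact_mod_cast this

theorem haltsWithin_learner (hn : 1 ≤ n) (hp : ∀ L ∈ p, L.IsRep d) (hq : q.IsRep d)
    (hε1 : ε < 1) (hγ : 0 < γ) (hγ1 : γ < 1) (hδ : 0 < δ) (hδ1 : δ < 1)
    (ρ : Fin (sampleSize γ δ) → PAssign n) :
    HaltsWithin (learner d) (inputMemory p q ε γ ρ)
      ((24 * d + 440) * 8 * 27 ^ d * (((p.length : ℝ) + (n : ℝ) ^ d) / γ ^ 2 *
        (n : ℝ) ^ (2 * d) * Real.log (2 / δ))) := by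
  obtain ⟨P, -, -, t, s', he, ht, -⟩ := run_learner (γ := γ) (ρ := ρ) hp hq hε1
  refine ⟨t, s', he, ?_⟩
  have h1 := ht.trans (learnerTime_le n d p.length (sampleSize γ δ))
  have h1' : (t : ℝ) ≤ (24 * d + 440) * ((sampleSize γ δ + 1) *
      ((p.length + (base n : ℝ) ^ d) * ((base n : ℝ) ^ d) ^ 2)) := by exact_mod_cast h1
  -- Since `2 n + 1 ≤ 3 n`. The bound enters with the third power in all, whence `27 ^ d`; the
  -- factor 8 comes from `sampleSize_add_one_le`.
  have hb : (base n : ℝ) ^ d ≤ 3 ^ d * (n : ℝ) ^ d := by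
    rw [← mul_pow]
    gcongr
    have : (1 : ℝ) ≤ n := by exact_mod_cast hn
    unfold base
    push_cast
    linarith
  have h3 : (1 : ℝ) ≤ 3 ^ d := one_le_pow₀ (by norm_num)
  have hlog := half_le_log hδ hδ1
  calc (t : ℝ) ≤ _ := h1'
    _ ≤ (24 * d + 440) * ((8 * (1 / γ ^ 2 * Real.log (2 / δ))) *
        ((3 ^ d * p.length + 3 ^ d * (n : ℝ) ^ d) * (3 ^ d * (n : ℝ) ^ d) ^ 2)) := by
        gcongr
        · exact sampleSize_add_one_le hγ hγ1 hδ hδ1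
        · exact le_mul_of_one_le_left (by positivity) h3
    _ = (24 * d + 440) * 8 * 27 ^ d * (((p.length : ℝ) + (n : ℝ) ^ d) / γ ^ 2 *
        (n : ℝ) ^ (2 * d) * Real.log (2 / δ)) := by
        rw [show (27 : ℝ) = 3 ^ 3 by norm_num, ← pow_mul, mul_comm 2 d, mul_comm 3 d, pow_mul,
          pow_mul]
        field_simp

theorem one_sub_le_accepts (hp : ∀ L ∈ p, L.IsRep d) (hq : q.IsRep d)
    (hε1 : ε < 1) (hγ : 0 < γ) (hγ1 : γ < 1) (hδ : 0 < δ) (hδ1 : δ < 1)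
    (μ : Measure (PAssign n)) [IsProbabilityMeasure μ]
    (h : List (MvPolynomial (Indet sys n) F))
    (hμ : 1 - ε + γ ≤ μ.real {ρ | ∀ g ∈ h, WitnessedZero ρ g})
    (hder : Derives d {g | g ∈ p.map TermList.poly ∨ g ∈ h} q.poly) :
    1 - δ ≤ (Measure.pi fun _ : Fin (sampleSize γ δ) => μ).real
      {ρ | Accepts (learner d) (inputMemory p q ε γ ρ)} := by
  classical
  refine one_sub_le_measureReal_pi_of_le μ {ρ | q.vec ∉ closureSpace d ρ p} (sampleSize γ δ)
    (ε - γ / 2) (γ / 2) δ (by positivity) ?_ (exp_neg_sampleSize_le hγ hδ hδ1 le_rfl) _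
    fun ρ hρ => accepts_learner hp hq hε1 (two_le_mul_sampleSize hγ hγ1 hδ hδ1) ?_
  -- By completeness, a failure means that some `h_i` is not witnessed, which has probability at
  -- most `ε - γ`. The threshold `ε - γ / 2` leaves half of the margin for sampling and half for
  -- rounding.
  · have hsub : {ρ : PAssign n | q.vec ∉ closureSpace d ρ p} ⊆
        {ρ | ∀ g ∈ h, WitnessedZero ρ g}ᶜ := fun ρ hρ hw =>
      hρ (vec_mem_closureSpace_of_derives hp hq h hw hder)
    have := measureReal_mono (μ := μ) hsub
    rw [probReal_compl_eq_one_sub (Set.toFinite _).measurableSet] at this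
    linarith
  · convert hρ using 2
    rw [failures]
    congr

theorem one_sub_le_rejects (hn : 1 ≤ n) (hp : ∀ L ∈ p, L.IsRep d) (hq : q.IsRep d) (hε : 0 < ε)
    (hε1 : ε < 1) (hγ : 0 < γ) (hδ : 0 < δ) (hδ1 : δ < 1)
    (D : PMF (Assign n)) (M : PMF (Mask n))
    (h : D.toMeasure.real {x | (∀ L ∈ p, HoldsAt x L.poly) → HoldsAt x q.poly} ≤ 1 - ε - γ) :
    1 - δ ≤ (Measure.pi fun _ : Fin (sampleSize γ δ) => (masked M D).toMeasure).real
      {ρ | Rejects (learner d) (inputMemory p q ε γ ρ)} := by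
  classical
  refine one_sub_le_measureReal_pi_of_ge _ {ρ | q.vec ∉ closureSpace d ρ p} (sampleSize γ δ)
    ε γ δ hγ.le ?_ (exp_neg_sampleSize_le hγ hδ hδ1 (by linarith)) _
    fun ρ hρ => rejects_learner hp hq hε hε1 ?_
  -- By soundness, success on `ρ` implies that the implication holds at every `x` behind `ρ`. So
  -- success has probability at most `1 - ε - γ`, and failure at least `ε + γ`.
  · have hle := measureReal_masked_le M D {ρ | q.vec ∈ closureSpace d ρ p}
      {x | (∀ L ∈ p, HoldsAt x L.poly) → HoldsAt x q.poly}
      fun x ρ hρ hmem hx => holdsAt_of_vec_mem_closureSpace hn hρ hp hq hmem hx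
    have hc : {ρ : PAssign n | q.vec ∉ closureSpace d ρ p} =
      {ρ | q.vec ∈ closureSpace d ρ p}ᶜ := rfl
    rw [hc, probReal_compl_eq_one_sub (Set.toFinite _).measurableSet]
    linarith
  · convert hρ using 2
    rw [failures]
    congr

end Correctness

end PolyCalc

theorem mainTheorem9 (sys : PCSystem) (d : ℕ) :
    ∃ (prog : Prog) (size : ℝ → ℝ → ℕ) (K : ℝ),
      (∀ γ δ : ℝ, 0 < γ → γ < 1 → 0 < δ → δ < 1 →
        (size γ δ : ℝ) ≤ K * (1 / γ ^ 2 * Real.log (2 / δ))) ∧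
      ∀ (F : Type*) [Field F] (n : ℕ), 1 ≤ n →
      ∀ (p : List (TermList F sys n)) (q : TermList F sys n),
        (∀ L ∈ p, L.IsRep d) → q.IsRep d →
      ∀ ε γ δ : ℝ, 0 < ε → ε < 1 → 0 < γ → γ < 1 → 0 < δ → δ < 1 →
        -- running time, on every sample
        (∀ ρ : Fin (size γ δ) → PAssign n,
          HaltsWithin prog (inputMemory p q ε γ ρ)
            (K * (((p.length : ℝ) + (n : ℝ) ^ d) / γ ^ 2 * (n : ℝ) ^ (2 * d) *
              Real.log (2 / δ)))) ∧
        ∀ (D : PMF (Assign n)) (M : PMF (Mask n)),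
          -- first case: accept with probability at least 1 - δ
          ((∃ h : List (MvPolynomial (Indet sys n) F),
              1 - ε + γ ≤ (masked M D).toMeasure.real {ρ | ∀ g ∈ h, WitnessedZero ρ g} ∧
              Derives d {g | g ∈ p.map TermList.poly ∨ g ∈ h} q.poly) →
            1 - δ ≤ (Measure.pi fun _ : Fin (size γ δ) => (masked M D).toMeasure).real
              {ρ | Accepts prog (inputMemory p q ε γ ρ)}) ∧
          -- second case: reject with probability at least 1 - δ
          (D.toMeasure.real {x | (∀ L ∈ p, HoldsAt x L.poly) → HoldsAt x q.poly} ≤ 1 - ε - γ →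
            1 - δ ≤ (Measure.pi fun _ : Fin (size γ δ) => (masked M D).toMeasure).real
              {ρ | Rejects prog (inputMemory p q ε γ ρ)}) := by
  refine ⟨learner d, sampleSize, (24 * d + 440) * 8 * 27 ^ d, fun γ δ hγ hγ1 hδ hδ1 => ?_,
    fun F _ n hn p q hp hq ε γ δ hε hε1 hγ hγ1 hδ hδ1 =>
      ⟨fun ρ => haltsWithin_learner hn hp hq hε1 hγ hγ1 hδ hδ1 ρ, fun D M =>
        ⟨fun ⟨h, hμ, hder⟩ => one_sub_le_accepts hp hq hε1 hγ hγ1 hδ hδ1 _ h hμ hder,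
          fun h => one_sub_le_rejects hn hp hq hε hε1 hγ hδ hδ1 D M h⟩⟩⟩
  have hS := half_le_sample hγ hγ1 hδ hδ1
  have hm := sampleSize_add_one_le hγ hγ1 hδ hδ1
  have h27 : (1 : ℝ) ≤ 27 ^ d := one_le_pow₀ (by norm_num)
  have hd : (0 : ℝ) ≤ d := Nat.cast_nonneg d
  -- One constant `K` serves for both bounds: it is dictated by the running time and exceeds the 8
  -- required by the sample size.
  have hK : (8 : ℝ) ≤ (24 * d + 440) * 8 * 27 ^ d := by nlinarith
  exact (by linarith : (sampleSize γ δ : ℝ) ≤ 8 * (1 / γ ^ 2 * Real.log (2 / δ))).trans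
    (mul_le_mul_of_nonneg_right hK (by linarith))
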